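/- Let $\Bbbk$ be a field. For a finite dimensional $\Bbbk$-algebra $R$ let $\mathrm{mod}\,R$ be the category of finitely generated right $R$-modules, let $\Omega_R(M)$ be the kernel of the projective cover of $M$, and let $K_0(R)$ be the abelian group generated by the symbols $[M]$, $M\in\mathrm{mod}\,R$, modulo the relations $[M]=[M']+[M'']$ whenever $M\cong M'\oplus M''$ and $[P]=0$ for $P$ projective. Let $\bar\Omega$ be the endomorphism of $K_0(R)$ with $\bar\Omega[M]=[\Omega_R(M)]$, and let $\langle\mathrm{add}\,M\rangle\subseteq K_0(R)$ be the subgroup generated by the classes of the indecomposable direct summands of $M$. Let $\phi(M)$ be the least $k\ge 0$ such that $\bar\Omega$ is injective on $\bar\Omega^{m}(\langle\mathrm{add}\,M\rangle)$ for all $m\ge k$, and put $\phi\dim(R)=\sup\{\phi(M): M\in\mathrm{mod}\,R\}$. Let $Q_A$, $Q_B$ be finite quivers with disjoint vertex sets, and let $Q_C$ be a quiver whose vertices are those of $Q_A$ and $Q_B$ and whose arrows are those of $Q_A$, those of $Q_B$, finitely many arrows $\alpha_j$ ($j\in J$) from vertices of $Q_A$ to vertices of $Q_B$, and finitely many arrows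 $\beta_k$ ($k\in K$) from vertices of $Q_B$ to vertices of $Q_A$. Paths are composed from left to right. Let $A=\Bbbk Q_A/I_A$, $B=\Bbbk Q_B/I_B$, $C=\Bbbk Q_C/I_C$ with admissible ideals $I_A,I_B,I_C$ (an ideal $I$ of $\Bbbk Q$ is admissible if $\mathcal J^m\subseteq I\subseteq \mathcal J^2$ for some $m\ge2$, where $\mathcal J$ is the ideal generated by the arrows), such that $$I_C\cap\Bbbk Q_A=I_A,\qquad I_C\cap\Bbbk Q_B=I_B,$$ $$\langle I_A,\ I_B,\ \alpha\alpha_j,\ \beta\beta_k,\ \alpha_j\beta_k,\ \beta_k\alpha_j \;:\; \alpha\in (Q_A)_1,\ \beta\in (Q_B)_1,\ j\in J,\ k\in K\rangle\subseteq I_C .$$ Right $A$-modules and right $B$-modules are regarded as right $C$-modules on which the remaining vertices and arrows act by zero. For a vertex $v$ of $Q_C$ let $S_v$ be the simple right $C$-module at $v$, and suppose that for every $v$ we have $\Omega_C(S_v)\cong M_A\oplus N_B$ with $M_A\in\mathrm{mod}\,A$ and $N_B\in\mathrm{mod}\,B$, where $\mathrm{pd}_B(N_B)<\infty$ if $v$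 is a vertex of $Q_A$, and $\mathrm{pd}_A(M_A)<\infty$ if $v$ is a vertex of $Q_B$. If $\phi\dim(A)<\infty$ and $\phi\dim(B)<\infty$, then $\phi\dim(C)<\infty$. -/

import Mathlib

open CategoryTheory

universe u

noncomputable section

/-! ## The Igusa-Todorov function and the `φ`-dimension of a Noetherian ring

Everything is written for left modules over a ring `R`; right modules over an algebra `A` are
modules over `Aᵐᵒᵖ`. -/

namespace IgusaTodorov

section Modules

variable {R : Type u} [Ring R]

/-- A surjection from a projective module whose kernel is superfluous. -/
def IsProjectiveCover {P M : Type u} [AddCommGroup P] [Module R P] [AddCommGroup M] [Module R M]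
    (f : P →ₗ[R] M) : Prop :=
  Module.Projective R P ∧ Function.Surjective f ∧
    ∀ N : Submodule R P, N ⊔ LinearMap.ker f = ⊤ → N = ⊤

theorem exists_presentation (M : FGModuleCat.{u} R) :
    ∃ (P : FGModuleCat.{u} R) (f : P →ₗ[R] M), Module.Projective R P ∧ Function.Surjective f ∧
      ((∃ (P' : FGModuleCat.{u} R) (f' : P' →ₗ[R] M), IsProjectiveCover f') →
        IsProjectiveCover f) := by
  by_cases h : ∃ (P' : FGModuleCat.{u} R) (f' : P' →ₗ[R] M), IsProjectiveCover f'
  · obtain ⟨P, f, hf⟩ := h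
    exact ⟨P, f, hf.1, hf.2.1, fun _ => hf⟩
  · obtain ⟨n, f, hf⟩ := Module.Finite.exists_fin' R M
    exact ⟨FGModuleCat.of R (Fin n → R), f, inferInstanceAs (Module.Projective R (Fin n → R)), hf,
      fun h' => absurd h' h⟩

/-- The projective cover `P(M)` (for rings over which `M` has no projective cover, which do not
occur among Artin algebras, some finitely generated projective module mapping onto `M`). -/
def coverObj (M : FGModuleCat.{u} R) : FGModuleCat.{u} R := (exists_presentation M).choose

/-- The covering map `P(M) → M`. -/
def coverMap (M : FGModuleCat.{u} R) : coverObj M →ₗ[R] M :=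
  (exists_presentation M).choose_spec.choose

theorem coverObj_projective (M : FGModuleCat.{u} R) : Module.Projective R (coverObj M) :=
  (exists_presentation M).choose_spec.choose_spec.1

theorem coverMap_surjective (M : FGModuleCat.{u} R) : Function.Surjective (coverMap M) :=
  (exists_presentation M).choose_spec.choose_spec.2.1

theorem coverMap_isProjectiveCover (M : FGModuleCat.{u} R)
    (h : ∃ (P : FGModuleCat.{u} R) (f : P →ₗ[R] M), IsProjectiveCover f) :
    IsProjectiveCover (coverMap M) :=
  (exists_presentation M).choose_spec.choose_spec.2.2 h

/-- The syzygy `Ω(M)`: the kernel of the projective cover of `M`. -/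
def syzygy [IsNoetherianRing R] (M : FGModuleCat.{u} R) : FGModuleCat.{u} R :=
  FGModuleCat.of R (LinearMap.ker (coverMap M))

variable (R) in
/-- The relations of the Igusa-Todorov group: `[M] - [M'] - [M'']` if `M ≅ M' ⊕ M''`, and `[P]`
for `P` projective. -/
def K0Relations : Set (FreeAbelianGroup (FGModuleCat.{u} R)) :=
  {x | ∃ M M' M'' : FGModuleCat.{u} R, Nonempty (M ≃ₗ[R] M' × M'') ∧
      x = FreeAbelianGroup.of M - FreeAbelianGroup.of M' - FreeAbelianGroup.of M''} ∪
    {x | ∃ P : FGModuleCat.{u} R, Module.Projective R P ∧ x = FreeAbelianGroup.of P}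

variable (R) in
/-- The Igusa-Todorov group `K₀(R)`. -/
abbrev K0 : Type (u + 1) :=
  FreeAbelianGroup (FGModuleCat.{u} R) ⧸ AddSubgroup.closure (K0Relations R)

/-- The class `[M]` in `K₀(R)`. -/
def K0.mk (M : FGModuleCat.{u} R) : K0 R :=
  QuotientAddGroup.mk (FreeAbelianGroup.of M)

theorem K0.mk_eq_add {M M' M'' : FGModuleCat.{u} R} (e : M ≃ₗ[R] M' × M'') :
    K0.mk M = K0.mk M' + K0.mk M'' := by
  have : FreeAbelianGroup.of M - FreeAbelianGroup.of M' - FreeAbelianGroup.of M'' ∈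
      AddSubgroup.closure (K0Relations R) :=
    AddSubgroup.subset_closure (Or.inl ⟨M, M', M'', ⟨e⟩, rfl⟩)
  have h := (QuotientAddGroup.eq_zero_iff _).2 this
  rw [sub_sub, QuotientAddGroup.mk_sub, sub_eq_zero, QuotientAddGroup.mk_add] at h
  exact h

theorem K0.mk_projective (P : FGModuleCat.{u} R) [Module.Projective R P] : K0.mk P = 0 :=
  (QuotientAddGroup.eq_zero_iff _).2
    (AddSubgroup.subset_closure (Or.inr ⟨P, inferInstance, rfl⟩))

/-- Two isomorphic modules have the same class. -/
theorem K0.mk_congr {M N : FGModuleCat.{u} R} (e : M ≃ₗ[R] N) : K0.mk M = K0.mk N := by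
  have h := K0.mk_eq_add (M := M) (M' := N) (M'' := FGModuleCat.of R PUnit.{u + 1})
    (e.trans LinearEquiv.prodUnique.symm)
  have h0 := K0.mk_projective (R := R) (FGModuleCat.of R PUnit.{u + 1})
  rw [h, h0, add_zero]

section Schanuel

variable {P Q M : Type u} [AddCommGroup P] [Module R P] [AddCommGroup Q] [Module R Q]
  [AddCommGroup M] [Module R M]

/-- Half of Schanuel's lemma: the pullback of two surjections onto `M` splits over a projective
source. -/
theorem exists_pullback_equiv [Module.Projective R P] (f : P →ₗ[R] M) (g : Q →ₗ[R] M)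
    (hg : Function.Surjective g) :
    Nonempty (LinearMap.eqLocus (f ∘ₗ LinearMap.fst R P Q) (g ∘ₗ LinearMap.snd R P Q) ≃ₗ[R]
      P × LinearMap.ker g) := by
  obtain ⟨s, hs⟩ := Module.projective_lifting_property g f hg
  have hs' : ∀ p, g (s p) = f p := fun p => LinearMap.congr_fun hs p
  exact ⟨{
    toFun := fun x => (x.1.1, ⟨x.1.2 - s x.1.1, by
      have := x.2
      simp only [LinearMap.mem_eqLocus, LinearMap.coe_comp, Function.comp_apply,
        LinearMap.fst_apply, LinearMap.snd_apply] at this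
      simp [LinearMap.mem_ker, hs', this]⟩)
    map_add' := fun x y => by
      ext <;> simp
      abel
    map_smul' := fun r x => by
      ext <;> simp [smul_sub]
    invFun := fun y => ⟨(y.1, y.2.1 + s y.1), by
      have := y.2.2
      simp only [LinearMap.mem_ker] at this
      simp [hs', this]⟩
    left_inv := fun x => by ext <;> simp
    right_inv := fun y => by ext <;> simp }⟩

/-- Schanuel's lemma. -/
theorem schanuel [Module.Projective R P] [Module.Projective R Q] (f : P →ₗ[R] M) (g : Q →ₗ[R] M)
    (hf : Function.Surjective f) (hg : Function.Surjective g) :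
    Nonempty ((P × LinearMap.ker g) ≃ₗ[R] (Q × LinearMap.ker f)) := by
  obtain ⟨e₁⟩ := exists_pullback_equiv f g hg
  obtain ⟨e₂⟩ := exists_pullback_equiv g f hf
  let σ : LinearMap.eqLocus (f ∘ₗ LinearMap.fst R P Q) (g ∘ₗ LinearMap.snd R P Q) ≃ₗ[R]
      LinearMap.eqLocus (g ∘ₗ LinearMap.fst R Q P) (f ∘ₗ LinearMap.snd R Q P) := {
    toFun := fun x => ⟨(x.1.2, x.1.1), x.2.symm⟩
    map_add' := fun x y => rfl
    map_smul' := fun r x => rfl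
    invFun := fun x => ⟨(x.1.2, x.1.1), x.2.symm⟩
    left_inv := fun x => rfl
    right_inv := fun x => rfl }
  exact ⟨e₁.symm.trans (σ.trans e₂)⟩

end Schanuel

variable [IsNoetherianRing R]

/-- The class of `Ω(M)` can be computed from any finitely generated projective presentation. -/
theorem K0.mk_syzygy_eq {M P : FGModuleCat.{u} R} [Module.Projective R P] (f : P →ₗ[R] M)
    (hf : Function.Surjective f) :
    K0.mk (syzygy M) = K0.mk (FGModuleCat.of R (LinearMap.ker f)) := by
  have := coverObj_projective M
  obtain ⟨e⟩ := schanuel (coverMap M) f (coverMap_surjective M) hf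
  have h₁ := K0.mk_eq_add (M := FGModuleCat.of R (coverObj M × LinearMap.ker f))
    (M' := coverObj M) (M'' := FGModuleCat.of R (LinearMap.ker f)) (LinearEquiv.refl _ _)
  have h₂ := K0.mk_eq_add (M := FGModuleCat.of R (coverObj M × LinearMap.ker f))
    (M' := P) (M'' := syzygy M) e
  rw [K0.mk_projective (coverObj M), zero_add] at h₁
  rw [K0.mk_projective P, zero_add] at h₂
  exact h₂.symm.trans h₁

theorem syzygy_respects :
    AddSubgroup.closure (K0Relations R) ≤
      (FreeAbelianGroup.lift fun M : FGModuleCat.{u} R => K0.mk (syzygy M)).ker := by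
  rw [AddSubgroup.closure_le]
  rintro x (⟨M, M', M'', ⟨e⟩, rfl⟩ | ⟨P, hP, rfl⟩)
  · simp only [SetLike.mem_coe, AddMonoidHom.mem_ker, map_sub, FreeAbelianGroup.lift_apply_of]
    have := coverObj_projective M'
    have := coverObj_projective M''
    have h := K0.mk_syzygy_eq (M := M) (P := FGModuleCat.of R (coverObj M' × coverObj M''))
      (e.symm.toLinearMap ∘ₗ (coverMap M').prodMap (coverMap M''))
      (e.symm.surjective.comp ((coverMap_surjective M').prodMap (coverMap_surjective M'')))
    rw [h, sub_sub, sub_eq_zero]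
    refine K0.mk_eq_add ?_
    have key : ∀ x : coverObj M' × coverObj M'',
        x ∈ LinearMap.ker (e.symm.toLinearMap ∘ₗ (coverMap M').prodMap (coverMap M'')) ↔
          coverMap M' x.1 = 0 ∧ coverMap M'' x.2 = 0 := fun x => by
      rw [LinearMap.mem_ker, LinearMap.comp_apply, LinearEquiv.coe_coe,
        LinearEquiv.map_eq_zero_iff]
      exact Prod.mk_eq_zero
    exact {
      toFun := fun x => (⟨x.1.1, ((key _).1 x.2).1⟩, ⟨x.1.2, ((key _).1 x.2).2⟩)
      map_add' := fun x y => rfl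
      map_smul' := fun r x => rfl
      invFun := fun x => ⟨(x.1.1, x.2.1), (key _).2 ⟨x.1.2, x.2.2⟩⟩
      left_inv := fun x => rfl
      right_inv := fun x => rfl }
  · simp only [SetLike.mem_coe, AddMonoidHom.mem_ker, FreeAbelianGroup.lift_apply_of]
    rw [K0.mk_syzygy_eq (M := P) (P := P) LinearMap.id Function.surjective_id]
    have : Subsingleton (LinearMap.ker (LinearMap.id : P →ₗ[R] P)) := by
      rw [LinearMap.ker_id]; infer_instance
    exact K0.mk_projective (R := R) _

variable (R) in
/-- The endomorphism `Ω̄` of `K₀(R)` with `Ω̄ [M] = [Ω(M)]`. -/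
def omegaBar : K0 R →+ K0 R :=
  QuotientAddGroup.lift _
    (FreeAbelianGroup.lift fun M : FGModuleCat.{u} R => K0.mk (syzygy M)) syzygy_respects

theorem omegaBar_mk (M : FGModuleCat.{u} R) : omegaBar R (K0.mk M) = K0.mk (syzygy M) :=
  FreeAbelianGroup.lift_apply_of _ _


/-- A nonzero module that is not a direct sum of two nonzero modules. -/
def IsIndecomposable (N : FGModuleCat.{u} R) : Prop :=
  Nontrivial N ∧ ∀ N' N'' : FGModuleCat.{u} R, Nonempty (N ≃ₗ[R] N' × N'') →
    Subsingleton N' ∨ Subsingleton N''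

/-- `⟨add M⟩`: the subgroup of `K₀(R)` generated by the classes of the indecomposable direct
summands of `M`. -/
def addSubgroup (M : FGModuleCat.{u} R) : AddSubgroup (K0 R) :=
  AddSubgroup.closure {x | ∃ N N' : FGModuleCat.{u} R,
    IsIndecomposable N ∧ Nonempty (M ≃ₗ[R] N × N') ∧ x = K0.mk N}

/-- `η_f(X)`: the least `k` such that `f` is injective on `f^m(X)` for all `m ≥ k` (and `⊤` if
there is no such `k`, which does not occur for finitely generated `X`). -/
def eta {G : Type*} [AddCommGroup G] (f : G →+ G) (X : AddSubgroup G) : ℕ∞ :=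
  ⨅ k ∈ {k : ℕ | ∀ m ≥ k, Set.InjOn f (f^[m] '' X)}, (k : ℕ∞)

/-- The Igusa-Todorov function `φ(M) = η_Ω̄(⟨add M⟩)`. -/
def phi (M : FGModuleCat.{u} R) : ℕ∞ := eta (omegaBar R) (addSubgroup M)

variable (R) in
/-- The `φ`-dimension: the supremum of `φ(M)` over all finitely generated modules `M`. -/
def phiDim : ℕ∞ := ⨆ M : FGModuleCat.{u} R, phi M

end Modules

/-! ## Path algebras and bound quiver algebras -/

open Quiver

section PathAlgebra

/-- The underlying space of the path algebra `kQ` of a quiver with finite vertex set `V`: an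
element assigns to every pair of vertices a finitely supported family of coefficients on the paths
between them, that is, it is a linear combination of paths. -/
def PathAlgebra (k V : Type u) [Field k] [Quiver.{u} V] : Type u :=
  ∀ a b : V, Path a b →₀ k

variable {k V : Type u} [Field k] [Quiver.{u} V]

namespace PathAlgebra

instance : AddCommGroup (PathAlgebra k V) :=
  inferInstanceAs (AddCommGroup (∀ a b : V, Path a b →₀ k))

instance : Module k (PathAlgebra k V) :=
  inferInstanceAs (Module k (∀ a b : V, Path a b →₀ k))

@[ext] theorem ext {x y : PathAlgebra k V} (h : ∀ a b, x a b = y a b) : x = y :=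
  funext fun a => funext fun b => h a b

@[simp] theorem zero_apply (a b : V) : (0 : PathAlgebra k V) a b = 0 := rfl
@[simp] theorem add_apply (x y : PathAlgebra k V) (a b : V) : (x + y) a b = x a b + y a b := rfl
@[simp] theorem smul_apply (c : k) (x : PathAlgebra k V) (a b : V) :
    (c • x) a b = c • x a b := rfl

/-- Bilinear extension of the composition of paths (from left to right). -/
def compₗ (a b c : V) : (Path a b →₀ k) →ₗ[k] (Path b c →₀ k) →ₗ[k] (Path a c →₀ k) :=
  Finsupp.lift _ k _ fun p => Finsupp.lmapDomain k k fun q => p.comp q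

@[simp] theorem compₗ_single {a b c : V} (p : Path a b) (q : Path b c) (r s : k) :
    compₗ a b c (Finsupp.single p r) (Finsupp.single q s) = Finsupp.single (p.comp q) (r * s) := by
  simp [compₗ]

theorem compₗ_assoc {a b c d : V} (x : Path a b →₀ k) (y : Path b c →₀ k) (z : Path c d →₀ k) :
    compₗ a c d (compₗ a b c x y) z = compₗ a b d x (compₗ b c d y z) := by
  induction x using Finsupp.induction_linear with
  | zero => simp
  | add x x' hx hx' => simp [hx, hx']
  | single p r =>
    induction y using Finsupp.induction_linear with
    | zero => simp
    | add y y' hy hy' => simp [hy, hy']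
    | single q s =>
      induction z using Finsupp.induction_linear with
      | zero => simp
      | add z z' hz hz' => simp only [map_add, hz, hz']
      | single w t => rw [compₗ_single, compₗ_single, compₗ_single, compₗ_single, mul_assoc,
          Path.comp_assoc]

@[simp] theorem nil_compₗ {a b : V} (x : Path a b →₀ k) :
    compₗ a a b (Finsupp.single Path.nil 1) x = x := by
  induction x using Finsupp.induction_linear with
  | zero => simp
  | add x x' hx hx' => simp [hx, hx']
  | single p r => simp

@[simp] theorem compₗ_nil {a b : V} (x : Path a b →₀ k) :
    compₗ a b b x (Finsupp.single Path.nil 1) = x := by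
  induction x using Finsupp.induction_linear with
  | zero => simp
  | add x x' hx hx' => simp [hx, hx']
  | single p r => simp

section

variable [DecidableEq V]

/-- A path, as an element of the path algebra. -/
def ofPath {a b : V} (p : Path a b) : PathAlgebra k V :=
  Pi.single a (Pi.single b (Finsupp.single p 1))

variable (k) in
/-- The trivial path `e_v`. -/
def vertex (v : V) : PathAlgebra k V := ofPath (Path.nil : Path v v)

variable (k) in
/-- An arrow, as an element of the path algebra. -/
def arrow {a b : V} (e : a ⟶ b) : PathAlgebra k V := ofPath e.toPath

theorem vertex_apply_self (a : V) : vertex k a a a = Finsupp.single Path.nil 1 := by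
  simp [vertex, ofPath]

theorem vertex_apply_left {a v : V} (h : v ≠ a) (b : V) : vertex k v a b = 0 := by
  simp [vertex, ofPath, Pi.single_eq_of_ne h.symm]

theorem vertex_apply_right {b v : V} (h : v ≠ b) (a : V) : vertex k v a b = 0 := by
  by_cases h' : v = a
  · subst h'
    simp [vertex, ofPath, Pi.single_eq_of_ne h.symm]
  · exact vertex_apply_left h' b

end

theorem sum_apply {ι : Type*} (s : Finset ι) (f : ι → PathAlgebra k V) (a b : V) :
    (∑ i ∈ s, f i) a b = ∑ i ∈ s, f i a b := by
  rw [show (∑ i ∈ s, f i) a = ∑ i ∈ s, f i a from Finset.sum_apply a s f, Finset.sum_apply]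

variable [Fintype V]

/-- The product of the path algebra: concatenation of paths, and zero when they do not compose. -/
instance : Mul (PathAlgebra k V) := ⟨fun x y a c => ∑ b, compₗ a b c (x a b) (y b c)⟩

theorem mul_apply (x y : PathAlgebra k V) (a c : V) :
    (x * y) a c = ∑ b, compₗ a b c (x a b) (y b c) := rfl

variable [DecidableEq V]

/-- The identity is the sum of the trivial paths. -/
instance : One (PathAlgebra k V) := ⟨∑ v, vertex k v⟩

theorem one_def : (1 : PathAlgebra k V) = ∑ v, vertex k v := rfl

theorem one_apply_self (a : V) : (1 : PathAlgebra k V) a a = Finsupp.single Path.nil 1 := by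
  rw [one_def, sum_apply, Finset.sum_eq_single a, vertex_apply_self]
  · exact fun v _ h => vertex_apply_left h a
  · simp

theorem one_apply_ne {a b : V} (h : a ≠ b) : (1 : PathAlgebra k V) a b = 0 := by
  rw [one_def, sum_apply]
  refine Finset.sum_eq_zero fun v _ => ?_
  by_cases h' : v = a
  · exact vertex_apply_right (h' ▸ h) a
  · exact vertex_apply_left h' b

instance : Ring (PathAlgebra k V) where
  __ := (inferInstance : AddCommGroup (PathAlgebra k V))
  left_distrib x y z := by ext1 a b; simp [mul_apply, Finset.sum_add_distrib]
  right_distrib x y z := by ext1 a b; simp [mul_apply, Finset.sum_add_distrib]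
  zero_mul x := by ext1 a b; simp [mul_apply]
  mul_zero x := by ext1 a b; simp [mul_apply]
  mul_assoc x y z := by
    ext1 a d
    simp only [mul_apply, map_sum, LinearMap.sum_apply, compₗ_assoc]
    exact Finset.sum_comm
  one_mul x := by
    ext1 a b
    rw [mul_apply, Finset.sum_eq_single a, one_apply_self, nil_compₗ]
    · intro c _ h
      rw [one_apply_ne h.symm]; simp
    · simp
  mul_one x := by
    ext1 a b
    rw [mul_apply, Finset.sum_eq_single b, one_apply_self, compₗ_nil]
    · intro c _ h
      rw [one_apply_ne h]; simp
    · simp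

instance : Algebra k (PathAlgebra k V) :=
  Algebra.ofModule (fun c x y => by ext1 a b; simp [mul_apply, Finset.smul_sum])
    (fun c x y => by ext1 a b; simp [mul_apply, Finset.smul_sum])

theorem ofPath_mul_ofPath {a b c : V} (p : Path a b) (q : Path b c) :
    (ofPath p * ofPath q : PathAlgebra k V) = ofPath (p.comp q) := by
  ext1 a' c'
  rw [mul_apply, Finset.sum_eq_single b]
  · by_cases ha : a' = a
    · subst ha
      by_cases hc : c' = c
      · subst hc
        simp [ofPath]
      · simp [ofPath, Pi.single_eq_of_ne hc]
    · simp [ofPath, Pi.single_eq_of_ne ha]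
  · intro b' _ h
    simp [ofPath, Pi.single_eq_of_ne h]
  · simp

/-- The paths span the path algebra. -/
theorem span_ofPath :
    Submodule.span k {x : PathAlgebra k V | ∃ (a b : V) (p : Path a b), x = ofPath p} = ⊤ := by
  rw [eq_top_iff]
  rintro x -
  have hx : x = ∑ a, ∑ b, (x a b).sum fun p r => r • ofPath p := by
    ext1 a b
    rw [sum_apply, Finset.sum_eq_single a, sum_apply, Finset.sum_eq_single b]
    · conv_lhs => rw [← Finsupp.sum_single (x a b)]
      rw [Finsupp.sum, Finsupp.sum, sum_apply]
      refine Finset.sum_congr rfl fun p _ => ?_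
      rw [smul_apply]
      simp [ofPath]
    · intro b' _ h
      rw [Finsupp.sum, sum_apply]
      exact Finset.sum_eq_zero fun p _ => by
        rw [smul_apply]
        simp [ofPath, Pi.single_eq_of_ne h.symm]
    · simp
    · intro a' _ h
      rw [sum_apply]
      refine Finset.sum_eq_zero fun b' _ => ?_
      rw [Finsupp.sum, sum_apply]
      exact Finset.sum_eq_zero fun p _ => by
        rw [smul_apply]
        simp [ofPath, Pi.single_eq_of_ne h.symm]
    · simp
  rw [hx]
  exact Submodule.sum_mem _ fun a _ => Submodule.sum_mem _ fun b _ => Submodule.sum_mem _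
    fun p _ => Submodule.smul_mem _ _ (Submodule.subset_span ⟨a, b, p, rfl⟩)

end PathAlgebra

variable [DecidableEq V] [Fintype V]

variable (k V) in
/-- The power `J^n` of the ideal `J` of the path algebra generated by the arrows, that is, the
two-sided ideal generated by the products of `n` composable arrows. -/
def arrowIdealPow (n : ℕ) : TwoSidedIdeal (PathAlgebra k V) :=
  TwoSidedIdeal.span {x | ∃ (a b : V) (p : Path a b), p.length = n ∧ x = PathAlgebra.ofPath p}

/-- Admissible ideals: `J^m ⊆ I ⊆ J²` for some `m ≥ 2`. -/
class IsAdmissible (I : TwoSidedIdeal (PathAlgebra k V)) : Prop where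
  exists_pow_le : ∃ m, 2 ≤ m ∧ arrowIdealPow k V m ≤ I
  le_sq : I ≤ arrowIdealPow k V 2

/-- The quotient algebra `kQ / I`. -/
abbrev BoundQuiverAlgebra (I : TwoSidedIdeal (PathAlgebra k V)) : Type u := I.ringCon.Quotient

/-- The quotient map `kQ → kQ / I`. -/
abbrev BoundQuiverAlgebra.mk (I : TwoSidedIdeal (PathAlgebra k V)) :
    PathAlgebra k V →ₐ[k] BoundQuiverAlgebra I := I.ringCon.mkₐ k

theorem BoundQuiverAlgebra.mk_eq_zero {I : TwoSidedIdeal (PathAlgebra k V)}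
    {x : PathAlgebra k V} (hx : x ∈ I) : BoundQuiverAlgebra.mk I x = 0 :=
  (RingCon.eq _).2 hx

theorem ofPath_mem_of_le_length {I : TwoSidedIdeal (PathAlgebra k V)} {m : ℕ}
    (hI : arrowIdealPow k V m ≤ I) {a b : V} (p : Path a b) (hp : m ≤ p.length) :
    PathAlgebra.ofPath p ∈ I := by
  induction p with
  | nil =>
    exact hI (TwoSidedIdeal.subset_span ⟨a, a, Path.nil, (Nat.le_zero.1 hp).symm, rfl⟩)
  | @cons b c p e ih =>
    by_cases h : m ≤ p.length
    · have := I.mul_mem_right _ (PathAlgebra.arrow k e) (ih h)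
      rwa [PathAlgebra.arrow, PathAlgebra.ofPath_mul_ofPath] at this
    · refine hI (TwoSidedIdeal.subset_span ⟨a, c, p.cons e, ?_, rfl⟩)
      rw [Path.length_cons] at hp ⊢
      omega

theorem finite_paths [∀ a b : V, Finite (a ⟶ b)] (n : ℕ) (a b : V) :
    Finite {p : Path a b // p.length < n} := by
  induction n generalizing b with
  | zero =>
    have : IsEmpty {p : Path a b // p.length < 0} := ⟨fun p => absurd p.2 (Nat.not_lt_zero _)⟩
    infer_instance
  | succ n ih =>
    let f : Unit ⊕ (Σ c : V, {p : Path a c // p.length < n} × (c ⟶ b)) →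
        Option {p : Path a b // p.length < n + 1} := fun x => match x with
      | .inl _ => if h : a = b then some ⟨h ▸ Path.nil, by subst h; simp⟩ else none
      | .inr ⟨c, p, e⟩ => some ⟨p.1.cons e, by simpa using p.2⟩
    have hf : ∀ p : {p : Path a b // p.length < n + 1}, ∃ x, f x = some p := by
      rintro ⟨p, hp⟩
      cases p with
      | nil => exact ⟨.inl (), by simp [f]⟩
      | cons p e => exact ⟨.inr ⟨_, ⟨p, by simpa using hp⟩, e⟩, rfl⟩
    choose g hg using hf
    exact Finite.of_injective g fun p q h => by
      have := hg p
      rw [h, hg q] at this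
      exact (Option.some.inj this).symm

/-- A bound quiver algebra of a finite quiver is finite dimensional. -/
instance BoundQuiverAlgebra.finite [∀ a b : V, Finite (a ⟶ b)]
    (I : TwoSidedIdeal (PathAlgebra k V)) [hI : IsAdmissible I] :
    Module.Finite k (BoundQuiverAlgebra I) := by
  obtain ⟨m, -, hm⟩ := hI.exists_pow_le
  have := fun a b : V => finite_paths m a b
  let g : (Σ (a b : V), {p : Path a b // p.length < m}) → BoundQuiverAlgebra I :=
    fun x => BoundQuiverAlgebra.mk I (PathAlgebra.ofPath x.2.2.1)
  refine ⟨⟨(Set.finite_range g).toFinset, ?_⟩⟩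
  rw [Set.Finite.coe_toFinset, eq_top_iff]
  have h := congrArg (Submodule.map (BoundQuiverAlgebra.mk I).toLinearMap)
    (PathAlgebra.span_ofPath (k := k) (V := V))
  rw [Submodule.map_top, LinearMap.range_eq_top.2 (I.ringCon.mkₐ_surjective (α := k)),
    Submodule.map_span] at h
  rw [← h, Submodule.span_le]
  rintro _ ⟨_, ⟨a, b, p, rfl⟩, rfl⟩
  by_cases hp : p.length < m
  · exact Submodule.subset_span ⟨⟨a, b, p, hp⟩, rfl⟩
  · have := BoundQuiverAlgebra.mk_eq_zero (ofPath_mem_of_le_length hm p (not_lt.1 hp))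
    simp only [AlgHom.toLinearMap_apply, this]
    exact Submodule.zero_mem _

instance BoundQuiverAlgebra.isNoetherianRing_op [∀ a b : V, Finite (a ⟶ b)]
    (I : TwoSidedIdeal (PathAlgebra k V)) [IsAdmissible I] :
    IsNoetherianRing (BoundQuiverAlgebra I)ᵐᵒᵖ :=
  IsNoetherianRing.of_finite k _

instance finite_op_self (A : Type u) [Ring A] : Module.Finite Aᵐᵒᵖ A :=
  ⟨⟨{1}, by
    rw [eq_top_iff]
    rintro x -
    have : MulOpposite.op x • (1 : A) ∈ Submodule.span Aᵐᵒᵖ (({1} : Finset A) : Set A) :=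
      Submodule.smul_mem _ _ (Submodule.subset_span (by simp))
    simpa using this⟩⟩

/-- The simple right module `S_v` at the vertex `v`: the quotient of `C = kQ / I` by the right ideal
generated by the arrows and the trivial paths `e_w` with `w ≠ v`, so that it has dimension one at
`v`, dimension zero at the other vertices, and all arrows act on it by zero. -/
def vertexSimple [∀ a b : V, Finite (a ⟶ b)] (I : TwoSidedIdeal (PathAlgebra k V))
    [IsAdmissible I] (v : V) : FGModuleCat.{u} (BoundQuiverAlgebra I)ᵐᵒᵖ :=
  FGModuleCat.of _ (BoundQuiverAlgebra I ⧸ Submodule.span (BoundQuiverAlgebra I)ᵐᵒᵖ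
    ({x | ∃ (a b : V) (e : a ⟶ b), x = BoundQuiverAlgebra.mk I (PathAlgebra.arrow k e)} ∪
      {x | ∃ w, w ≠ v ∧ x = BoundQuiverAlgebra.mk I (PathAlgebra.vertex k w)}))

end PathAlgebra

/-! ## Gluing two quivers -/

section Glue

/-- The disjoint union of the vertex sets of two quivers, together with families `J a b` of new
arrows `a → b` from the first to the second and `K b a` of new arrows `b → a` from the second to
the first. -/
@[nolint unusedArguments]
def GluedQuiver {VA VB : Type u} (_J : VA → VB → Type u) (_K : VB → VA → Type u) : Type u :=
  VA ⊕ VB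

variable {k VA VB : Type u} [Field k] [Quiver.{u} VA] [Quiver.{u} VB]
  {J : VA → VB → Type u} {K : VB → VA → Type u}

namespace GluedQuiver

/-- A vertex of the first quiver. -/
abbrev inl (a : VA) : GluedQuiver J K := Sum.inl a

/-- A vertex of the second quiver. -/
abbrev inr (b : VB) : GluedQuiver J K := Sum.inr b

instance [Fintype VA] [Fintype VB] : Fintype (GluedQuiver J K) :=
  inferInstanceAs (Fintype (VA ⊕ VB))

instance [DecidableEq VA] [DecidableEq VB] : DecidableEq (GluedQuiver J K) :=
  inferInstanceAs (DecidableEq (VA ⊕ VB))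

/-- The arrows of the glued quiver. -/
def Arrow (J : VA → VB → Type u) (K : VB → VA → Type u) : VA ⊕ VB → VA ⊕ VB → Type u
  | .inl a, .inl a' => a ⟶ a'
  | .inl a, .inr b => J a b
  | .inr b, .inl a => K b a
  | .inr b, .inr b' => b ⟶ b'

instance : Quiver.{u} (GluedQuiver J K) := ⟨Arrow J K⟩

instance [∀ a a' : VA, Finite (a ⟶ a')] [∀ b b' : VB, Finite (b ⟶ b')] [∀ a b, Finite (J a b)]
    [∀ b a, Finite (K b a)] : ∀ v w : GluedQuiver J K, Finite (v ⟶ w)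
  | .inl a, .inl a' => inferInstanceAs (Finite (a ⟶ a'))
  | .inl a, .inr b => inferInstanceAs (Finite (J a b))
  | .inr b, .inl a => inferInstanceAs (Finite (K b a))
  | .inr b, .inr b' => inferInstanceAs (Finite (b ⟶ b'))

variable (J K) in
/-- The inclusion of the first quiver. -/
def inclA : VA ⥤q GluedQuiver J K where
  obj a := inl a
  map e := e

variable (J K) in
/-- The inclusion of the second quiver. -/
def inclB : VB ⥤q GluedQuiver J K where
  obj b := inr b
  map e := e

/-- A new arrow from the first quiver to the second. -/
def newJ {a : VA} {b : VB} (x : J a b) : (inl a : GluedQuiver J K) ⟶ inr b := x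

/-- A new arrow from the second quiver to the first. -/
def newK {b : VB} {a : VA} (y : K b a) : (inr b : GluedQuiver J K) ⟶ inl a := y

variable (J K) in
/-- The linear inclusion of the path algebra of the first quiver, given by the inclusion of
paths. -/
def extA (x : PathAlgebra k VA) : PathAlgebra k (GluedQuiver J K)
  | .inl a, .inl a' => (x a a').mapDomain (inclA J K).mapPath
  | .inl _, .inr _ => 0
  | .inr _, _ => 0

variable (J K) in
/-- The linear inclusion of the path algebra of the second quiver, given by the inclusion of
paths. -/
def extB (x : PathAlgebra k VB) : PathAlgebra k (GluedQuiver J K)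
  | .inr b, .inr b' => (x b b').mapDomain (inclB J K).mapPath
  | .inr _, .inl _ => 0
  | .inl _, _ => 0

variable [Fintype VA] [Fintype VB] [DecidableEq VA] [DecidableEq VB]

open PathAlgebra in
/-- The two-sided ideal `⟨I_A, I_B, α α_j, β β_k, α_j β_k, β_k α_j⟩` of the path algebra of the
glued quiver, where `α` and `β` run over the arrows of the first and of the second quiver, `α_j`
over the new arrows from the first to the second, and `β_k` over those from the second to the
first. -/
def gluingIdeal (J : VA → VB → Type u) (K : VB → VA → Type u)
    (IA : TwoSidedIdeal (PathAlgebra k VA)) (IB : TwoSidedIdeal (PathAlgebra k VB)) :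
    TwoSidedIdeal (PathAlgebra k (GluedQuiver J K)) :=
  TwoSidedIdeal.span
    (extA J K '' IA ∪ extB J K '' IB ∪
      {z | ∃ (a a' : VA) (b : VB) (α : a ⟶ a') (x : J a' b),
        z = arrow k ((inclA J K).map α) * arrow k (newJ x)} ∪
      {z | ∃ (b b' : VB) (a : VA) (β : b ⟶ b') (y : K b' a),
        z = arrow k ((inclB J K).map β) * arrow k (newK y)} ∪
      {z | ∃ (a a' : VA) (b : VB) (x : J a b) (y : K b a'),
        z = arrow k (newJ (K := K) x) * arrow k (newK y)} ∪
      {z | ∃ (b b' : VB) (a : VA) (y : K b a) (x : J a b'),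
        z = arrow k (newK (J := J) y) * arrow k (newJ x)})

open MulOpposite in
/-- The right `C`-module `M'` is the right `A`-module `M`, regarded as a `C`-module on which the
vertices of the second quiver and all arrows outside the first quiver act by zero: the path algebra
of the first quiver (including its identity element, so that `M'` is supported on the vertices of
the first quiver) acts on `M'` as it does on `M`. -/
def IsInflationA (IA : TwoSidedIdeal (PathAlgebra k VA))
    (IC : TwoSidedIdeal (PathAlgebra k (GluedQuiver J K)))
    (M : FGModuleCat.{u} (BoundQuiverAlgebra IA)ᵐᵒᵖ)
    (M' : FGModuleCat.{u} (BoundQuiverAlgebra IC)ᵐᵒᵖ) : Prop :=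
  ∃ e : M ≃+ M', ∀ (x : PathAlgebra k VA) (m : M),
    e (op (BoundQuiverAlgebra.mk IA x) • m) = op (BoundQuiverAlgebra.mk IC (extA J K x)) • e m

open MulOpposite in
/-- The right `C`-module `N'` is the right `B`-module `N`, regarded as a `C`-module on which the
vertices of the first quiver and all arrows outside the second quiver act by zero. -/
def IsInflationB (IB : TwoSidedIdeal (PathAlgebra k VB))
    (IC : TwoSidedIdeal (PathAlgebra k (GluedQuiver J K)))
    (N : FGModuleCat.{u} (BoundQuiverAlgebra IB)ᵐᵒᵖ)
    (N' : FGModuleCat.{u} (BoundQuiverAlgebra IC)ᵐᵒᵖ) : Prop :=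
  ∃ e : N ≃+ N', ∀ (x : PathAlgebra k VB) (n : N),
    e (op (BoundQuiverAlgebra.mk IB x) • n) = op (BoundQuiverAlgebra.mk IC (extB J K x)) • e n

end GluedQuiver

end Glue

end IgusaTodorov

end

/-! Over an Artinian ring every element of `K0 R` lies in some ⟨add M⟩. Hence the φ-dimension is
finite exactly when the kernels of the powers of Ω̄ on the whole group become stationary, and the
task is to bound uniformly the power of Ω̄ that kills a class of `K0` of the glued algebra C, once
some power does.

A path that is nonzero in C contains at most one new arrow, and then as its first arrow. The
relations of a minimal presentation have coefficients in the arrow ideal, so they cannot cross from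
one side to the other: every syzygy over C is, up to projectives, a direct sum of an A-module and a
B-module (`IsGluing.kerEquiv`). If M is already an A-module, the A-part is the syzygy of M over A,
up to projectives, and the B-part is a direct sum of modules N_v, one for each generator at the
vertex v (`IsGluing.omegaBar_mk_left`, `IsGluing.defl_mk_kerLeft`). For M = S_v this gives the class
of N_v in `K0` of B as that of the given module of finite projective dimension, so some power of Ω̄
kills it.

Going down: reduction to A or to B (`K0.defl`) commutes with Ω̄ on classes of A- and B-modules, once
a fixed power of Ω̄ is applied. If Ω̄^n z = 0 over C, both reductions of z are therefore killed by
some power, and then by exponents s and t that depend only on A and B.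

Going up: inflation does not preserve projectives, so it induces no map on `K0`. The syzygy of an
inflated projective is however a sum of modules N_v. So X ↦ [Ω X] is well defined modulo the
subgroup F generated by the Ω̄-orbits of the finitely many N_v on both sides, and it intertwines the
operators Ω̄ (`IsGluing.inflOmega_omegaBar`). It follows that Ω̄^(s+t+1) z lies in F. With X acting
as Ω̄, F is a finitely generated ℤ[X]-module, hence Noetherian, and the kernels on it become
stationary at some r (`exists_invariant_addSubgroup`). One further Ω̄ turns an arbitrary class into
a combination of A- and B-modules. -/

noncomputable section

namespace IgusaTodorov

/-! ### Stationary kernels on subgroups generated by finitely many orbits. -/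

section Stabilization

/-- The subgroup generated by the orbits of finitely many elements under an additive endomorphism
is invariant, and the kernels of the iterates of the endomorphism on it become stationary. -/
theorem exists_invariant_addSubgroup {G : Type*} [AddCommGroup G] (f : G →+ G) {s : Set G}
    (hs : s.Finite) :
    ∃ F : AddSubgroup G, s ⊆ F ∧ (∀ x ∈ F, f x ∈ F) ∧
      ∃ p : ℕ, ∀ z ∈ F, ∀ n, f^[n] z = 0 → f^[p] z = 0 := by
  let φ : Module.End ℤ G := f.toIntLinearMap
  let o := Module.AEval'.of φ
  have hX : ∀ (n : ℕ) (z : G), (Polynomial.X ^ n : Polynomial ℤ) • o z = o (f^[n] z) := by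
    intro n
    induction n with
    | zero => intro z; simp
    | succ n ih =>
      intro z
      rw [pow_succ, mul_smul, Module.AEval'.X_smul_of, ih]
      rfl
  -- With X acting as `f`, this is a finitely generated module over the Noetherian ring ℤ[X]. The
  -- kernels of the powers of X on it form an ascending chain of submodules.
  let S : Submodule (Polynomial ℤ) (Module.AEval' φ) := Submodule.span _ (o '' s)
  have hfin : Module.Finite (Polynomial ℤ) S :=
    Module.Finite.iff_fg.2 (Submodule.fg_span (hs.image _))
  have hN : IsNoetherian (Polynomial ℤ) S := isNoetherian_of_isNoetherianRing_of_finite _ _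
  let c : ℕ →o Submodule (Polynomial ℤ) S :=
    { toFun := fun n => LinearMap.ker (LinearMap.lsmul (Polynomial ℤ) S (Polynomial.X ^ n))
      monotone' := by
        intro m n hmn x hx
        rw [LinearMap.mem_ker, LinearMap.lsmul_apply] at hx ⊢
        rw [← Nat.sub_add_cancel hmn, pow_add, mul_smul, hx, smul_zero] }
  obtain ⟨p, hp⟩ := monotone_stabilizes_iff_noetherian.2 hN c
  refine ⟨S.toAddSubgroup.comap o.toLinearMap.toAddMonoidHom, fun x hx => ?_, fun x hx => ?_, p,
    fun z hz n hn => ?_⟩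
  · have : o x ∈ S := Submodule.subset_span (Set.mem_image_of_mem o hx)
    exact this
  · have : (Polynomial.X ^ 1 : Polynomial ℤ) • o x ∈ S := S.smul_mem _ hx
    rw [hX] at this
    exact this
  · have key : ∀ m, (⟨o z, hz⟩ : S) ∈ c m ↔ f^[m] z = 0 := fun m => by
      change LinearMap.lsmul (Polynomial ℤ) S (Polynomial.X ^ m) ⟨o z, hz⟩ = 0 ↔ _
      rw [LinearMap.lsmul_apply, ← Subtype.coe_inj]
      change Polynomial.X ^ m • o z = 0 ↔ _
      rw [hX, LinearEquiv.map_eq_zero_iff]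
    rw [← key]
    by_cases h : n ≤ p
    · exact c.monotone h ((key n).2 hn)
    · rw [hp n (by omega)]
      exact (key n).2 hn

end Stabilization

/-! ### The Igusa-Todorov group, and finiteness of the φ-dimension as stationarity of kernels. -/

section Modules

variable {R : Type u} [Ring R]

theorem K0.mk_subsingleton (M : FGModuleCat.{u} R) [Subsingleton M] : K0.mk M = 0 :=
  K0.mk_projective M

theorem K0.mk_prod (M N : Type u) [AddCommGroup M] [Module R M] [Module.Finite R M]
    [AddCommGroup N] [Module R N] [Module.Finite R N] :
    K0.mk (FGModuleCat.of R (M × N)) = K0.mk (FGModuleCat.of R M) + K0.mk (FGModuleCat.of R N) :=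
  K0.mk_eq_add (M := FGModuleCat.of R (M × N)) (M' := FGModuleCat.of R M)
    (M'' := FGModuleCat.of R N) (LinearEquiv.refl _ _)

theorem K0.mk_pi : ∀ {n : ℕ} (N : Fin n → Type u) [∀ i, AddCommGroup (N i)] [∀ i, Module R (N i)]
    [∀ i, Module.Finite R (N i)],
    K0.mk (FGModuleCat.of R (∀ i, N i)) = ∑ i, K0.mk (FGModuleCat.of R (N i))
  | 0, N, _, _, _ => by
    rw [Finset.univ_eq_empty, Finset.sum_empty]
    have : Subsingleton (FGModuleCat.of R (∀ i, N i)) :=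
      inferInstanceAs (Subsingleton (∀ i, N i))
    exact K0.mk_subsingleton _
  | n + 1, N, _, _, _ => by
    rw [Fin.sum_univ_succ, ← K0.mk_pi fun i : Fin n => N i.succ, ← K0.mk_prod]
    exact K0.mk_congr (M := FGModuleCat.of R (∀ i, N i))
      (N := FGModuleCat.of R (N 0 × ∀ i : Fin n, N i.succ)) (Fin.consLinearEquiv R N).symm

theorem K0.induction {p : K0 R → Prop} (mk : ∀ M, p (K0.mk M))
    (neg : ∀ x, p x → p (-x)) (add : ∀ x y, p x → p y → p (x + y)) (z : K0 R) : p z := by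
  obtain ⟨x, rfl⟩ := QuotientAddGroup.mk_surjective z
  induction x using FreeAbelianGroup.induction_on with
  | zero =>
    have := mk (FGModuleCat.of R PUnit.{u + 1})
    rwa [K0.mk_projective (R := R) (FGModuleCat.of R PUnit.{u + 1})] at this
  | of M => exact mk M
  | neg M h => exact neg _ h
  | add x y hx hy => exact add _ _ hx hy

theorem addSubgroup_mono {M W : FGModuleCat.{u} R} (N : FGModuleCat.{u} R)
    (e : W ≃ₗ[R] M × N) : addSubgroup M ≤ addSubgroup W := by
  refine AddSubgroup.closure_mono ?_
  rintro _ ⟨L, L', hL, ⟨e'⟩, rfl⟩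
  exact ⟨L, FGModuleCat.of R (L' × N), hL,
    ⟨(e.trans (e'.prodCongr (LinearEquiv.refl R N))).trans (LinearEquiv.prodAssoc R _ _ _)⟩, rfl⟩

/-- Splitting off summands terminates because it lowers the length. Only the existence of a
decomposition into indecomposables is used, never its uniqueness. -/
theorem mk_mem_addSubgroup [IsArtinianRing R] (M : FGModuleCat.{u} R) :
    K0.mk M ∈ addSubgroup M := by
  have hlen : ∀ M : FGModuleCat.{u} R, Module.length R M ≠ ⊤ := fun M => Module.length_ne_top
  obtain ⟨n, hn⟩ : ∃ n : ℕ, Module.length R M = n := ⟨_, (ENat.natCast_toNat (hlen M)).symm⟩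
  induction n using Nat.strong_induction_on generalizing M with
  | _ n ih =>
    by_cases hM : Nontrivial M
    · by_cases hind : IsIndecomposable M
      · exact AddSubgroup.subset_closure ⟨M, FGModuleCat.of R PUnit.{u + 1}, hind,
          ⟨LinearEquiv.prodUnique.symm⟩, rfl⟩
      · simp only [IsIndecomposable, hM, true_and, not_forall, not_or,
          not_subsingleton_iff_nontrivial] at hind
        obtain ⟨M', M'', ⟨e⟩, h', h''⟩ := hind
        have hlt : Module.length R M = Module.length R M' + Module.length R M'' := by
          rw [e.length_eq, Module.length_prod]
        have hpos' : 0 < Module.length R M' := Module.length_pos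
        have hpos'' : 0 < Module.length R M'' := Module.length_pos
        obtain ⟨a, ha⟩ : ∃ n : ℕ, Module.length R M' = n :=
          ⟨_, (ENat.natCast_toNat (hlen M')).symm⟩
        obtain ⟨b, hb⟩ : ∃ n : ℕ, Module.length R M'' = n :=
          ⟨_, (ENat.natCast_toNat (hlen M'')).symm⟩
        rw [hn, ha, hb] at hlt
        rw [ha] at hpos'
        rw [hb] at hpos''
        norm_cast at hlt hpos' hpos''
        rw [K0.mk_eq_add e]
        exact add_mem (addSubgroup_mono M'' e (ih a (by omega) M' ha))
          (addSubgroup_mono M' (e.trans (LinearEquiv.prodComm R _ _)) (ih b (by omega) M'' hb))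
    · rw [not_nontrivial_iff_subsingleton] at hM
      rw [K0.mk_subsingleton M]
      exact zero_mem _

/-- This turns statements about all the subgroups ⟨add M⟩ into statements about the whole group:
finitely many modules are summands of a single one. -/
theorem exists_mem_addSubgroup [IsArtinianRing R] (z : K0 R) :
    ∃ M : FGModuleCat.{u} R, z ∈ addSubgroup M := by
  induction z using K0.induction with
  | mk M => exact ⟨M, mk_mem_addSubgroup M⟩
  | neg x h => exact h.imp fun M hM => neg_mem hM
  | add x y hx hy =>
    obtain ⟨M, hM⟩ := hx
    obtain ⟨N, hN⟩ := hy
    exact ⟨FGModuleCat.of R (M × N), add_mem (addSubgroup_mono N (LinearEquiv.refl R _) hM)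
      (addSubgroup_mono M (LinearEquiv.prodComm R _ _) hN)⟩

variable [IsNoetherianRing R]

/-- If the `φ`-dimension is finite, then the kernels of the powers of `Ω̄` become stationary. -/
theorem exists_omegaBar_stable [IsArtinianRing R] (h : phiDim R < ⊤) :
    ∃ d : ℕ, ∀ (z : K0 R) (n : ℕ), (omegaBar R)^[n] z = 0 → (omegaBar R)^[d] z = 0 := by
  obtain ⟨d, hd⟩ := ENat.ne_top_iff_exists.1 h.ne
  have hinj : ∀ (M : FGModuleCat.{u} R), ∀ m ≥ d,
      Set.InjOn (omegaBar R) ((omegaBar R)^[m] '' addSubgroup M) := by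
    intro M m hm
    -- `phi M` is an infimum of admissible bounds, so being below `d + 1` provides an admissible `k
    -- ≤ d`.
    have h1 : phi M < ((d + 1 : ℕ) : ℕ∞) := by
      have : phi M ≤ phiDim R := le_iSup (fun M : FGModuleCat.{u} R => phi M) M
      rw [← hd] at this
      exact this.trans_lt (by exact_mod_cast Nat.lt_succ_self d)
    obtain ⟨k, hk⟩ := iInf_lt_iff.1 h1
    obtain ⟨hk1, hk2⟩ := iInf_lt_iff.1 hk
    have hk3 : k < d + 1 := by exact_mod_cast hk2
    exact hk1 m (by omega)
  refine ⟨d, fun z n hn => ?_⟩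
  obtain ⟨M, hM⟩ := exists_mem_addSubgroup z
  by_cases hnd : n ≤ d
  · rw [← Nat.sub_add_cancel hnd, Function.iterate_add_apply, hn, iterate_map_zero]
  -- For exponents beyond `d`, injectivity of Ω̄ on the images of ⟨add M⟩ cancels one factor at a
  -- time until the exponent is `d`.
  · obtain ⟨j, rfl⟩ := Nat.exists_eq_add_of_le (le_of_not_ge hnd)
    clear hnd
    induction j with
    | zero => exact hn
    | succ j ih =>
      refine ih (hinj M (d + j) (by omega) ⟨z, hM, rfl⟩ ⟨0, zero_mem _, ?_⟩ ?_)
      · rw [iterate_map_zero]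
      · rw [map_zero, ← hn, ← add_assoc, Function.iterate_succ_apply']

/-- If the kernels of the powers of `Ω̄` become stationary, then the `φ`-dimension is finite. -/
theorem phiDim_lt_top {d : ℕ}
    (h : ∀ (z : K0 R) (n : ℕ), (omegaBar R)^[n] z = 0 → (omegaBar R)^[d] z = 0) :
    phiDim R < ⊤ := by
  refine lt_of_le_of_lt (iSup_le fun M => ?_) (ENat.natCast_lt_top d)
  refine iInf₂_le d fun m hm => ?_
  rintro _ ⟨x, hx, rfl⟩ _ ⟨y, hy, rfl⟩ hxy
  -- Two elements with the same image differ by a class killed by some power of Ω̄, hence already by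
  -- its `d`-th power, and `m ≥ d`.
  have hz : (omegaBar R)^[m + 1] (x - y) = 0 := by
    rw [iterate_map_sub, Function.iterate_succ_apply', Function.iterate_succ_apply', hxy, sub_self]
  have := h _ _ hz
  rw [← sub_eq_zero, ← iterate_map_sub, ← Nat.sub_add_cancel hm, Function.iterate_add_apply, this,
    iterate_map_zero]

theorem omegaBar_iterate_of_hasProjectiveDimensionLT (n : ℕ) (M : FGModuleCat.{u} R)
    (h : HasProjectiveDimensionLT M.obj n) : (omegaBar R)^[n] (K0.mk M) = 0 := by
  induction n generalizing M with
  | zero =>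
    have := ModuleCat.subsingleton_of_isZero (isZero_of_hasProjectiveDimensionLT_zero M.obj)
    exact K0.mk_subsingleton M
  | succ n ih =>
    rw [Function.iterate_succ_apply, omegaBar_mk]
    -- Passing to the syzygy lowers the bound on the projective dimension only from `n + 2` to `n +
    -- 1`; the projective case is settled directly by [P] = 0.
    cases n with
    | zero =>
      have hp : Projective M.obj := projective_iff_hasProjectiveDimensionLT_one.2 h
      have : Module.Projective R M := (IsProjective.iff_projective M).2 hp
      rw [← omegaBar_mk, K0.mk_projective M, map_zero]
      rfl
    | succ n =>
      refine ih _ ?_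
      let S : ShortComplex (ModuleCat.{u} R) :=
        ShortComplex.mk (ModuleCat.ofHom (LinearMap.ker (coverMap M)).subtype)
          (ModuleCat.ofHom (coverMap M)) (by ext x; exact x.2)
      have hS : S.ShortExact := by
        refine ShortComplex.ShortExact.mk' ?_ ?_ ?_
        · rw [ShortComplex.moduleCat_exact_iff]
          intro x hx
          exact ⟨⟨x, hx⟩, rfl⟩
        · rw [ModuleCat.mono_iff_injective]
          exact Subtype.val_injective
        · rw [ModuleCat.epi_iff_surjective]
          exact coverMap_surjective M
      have hproj : Projective S.X₂ :=
        (IsProjective.iff_projective (coverObj M)).1 (coverObj_projective M)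
      exact (hS.hasProjectiveDimensionLT_X₃_iff n hproj).1 h

theorem exists_omegaBar_iterate_eq_zero (M : FGModuleCat.{u} R)
    (h : projectiveDimension M.obj < ⊤) : ∃ n, (omegaBar R)^[n] (K0.mk M) = 0 := by
  obtain ⟨n, hn⟩ : ∃ n : ℕ, projectiveDimension M.obj < n := by
    induction hd : projectiveDimension M.obj with
    | bot => exact ⟨0, bot_lt_iff_ne_bot.2 (by simp)⟩
    | coe a =>
      rw [hd] at h
      have ha : a ≠ ⊤ := by
        rintro rfl
        exact absurd h (by simp)
      obtain ⟨m, rfl⟩ := ENat.ne_top_iff_exists.1 ha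
      exact ⟨m + 1, by exact_mod_cast Nat.lt_succ_self m⟩
  exact ⟨n, omegaBar_iterate_of_hasProjectiveDimensionLT n M
    ((projectiveDimension_lt_iff).1 hn)⟩

end Modules

end IgusaTodorov

namespace IgusaTodorov

/-! ### Inflation and deflation along a surjective ring homomorphism. -/

section Inflation

variable {R S : Type u} [Ring R] [Ring S]

/-- A module over `S` regarded as a module over `R` along a ring homomorphism `R → S`. -/
def Infl (_p : R →+* S) (X : Type u) : Type u := X

variable (p : R →+* S) (X : Type u) [AddCommGroup X] [Module S X]

instance : AddCommGroup (Infl p X) := inferInstanceAs (AddCommGroup X)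

instance : Module R (Infl p X) := Module.compHom X p

/-- The identity map from a module to its inflation. -/
def toInfl : X ≃+ Infl p X := AddEquiv.refl X

variable {X}

theorem toInfl_symm_smul (r : R) (x : Infl p X) :
    (toInfl p X).symm (r • x) = p r • (toInfl p X).symm x := rfl

variable [hp : RingHomSurjective p]

instance [hX : Module.Finite S X] : Module.Finite R (Infl p X) := by
  obtain ⟨s, hs⟩ := hX.fg_top
  let s' : Finset (Infl p X) := s
  refine ⟨⟨s', ?_⟩⟩
  rw [eq_top_iff]
  rintro x -
  have hx : (toInfl p X).symm x ∈ Submodule.span S (s : Set X) := hs ▸ Submodule.mem_top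
  suffices h : ∀ y ∈ Submodule.span S (s : Set X), toInfl p X y ∈
      Submodule.span R (s' : Set (Infl p X)) from h _ hx
  intro y hy
  induction hy using Submodule.span_induction with
  | mem x h => exact Submodule.subset_span h
  | zero => rw [map_zero]; exact zero_mem _
  | add x y _ _ hx hy => rw [map_add]; exact add_mem hx hy
  | smul a x _ h =>
    obtain ⟨r, rfl⟩ := hp.is_surjective a
    exact Submodule.smul_mem _ r h

/-- The inflation of a linear map. -/
def Infl.map {Y : Type u} [AddCommGroup Y] [Module S Y] (f : X →ₗ[S] Y) :
    Infl p X →ₗ[R] Infl p Y where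
  toFun := f
  map_add' := f.map_add
  map_smul' r x := f.map_smul (p r) x

/-- Inflation is compatible with finite products. -/
def Infl.congrProd {Y Z : Type u} [AddCommGroup Y] [Module S Y] [AddCommGroup Z] [Module S Z]
    (e : X ≃ₗ[S] Y × Z) : Infl p X ≃ₗ[R] Infl p Y × Infl p Z where
  toFun := e
  invFun := e.symm
  map_add' := e.map_add
  map_smul' r x := e.map_smul (p r) x
  left_inv := e.left_inv
  right_inv := e.right_inv

variable (M : Type u) [AddCommGroup M] [Module R M]

/-- The largest quotient of an `R`-module that is annihilated by the kernel of `R → S`. -/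
def Defl (_p : R →+* S) (M : Type u) [AddCommGroup M] [Module R M] : Type u :=
  M ⧸ (RingHom.ker _p • ⊤ : Submodule R M)

namespace Defl

instance : AddCommGroup (Defl p M) :=
  inferInstanceAs (AddCommGroup (M ⧸ (RingHom.ker p • ⊤ : Submodule R M)))

/-- The action of `R` on the deflation. -/
abbrev moduleSource : Module R (Defl p M) :=
  inferInstanceAs (Module R (M ⧸ (RingHom.ker p • ⊤ : Submodule R M)))

attribute [local instance] moduleSource

omit hp in
variable {M} in
theorem ker_smul {r : R} (hr : p r = 0) (x : Defl p M) : r • x = 0 := by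
  obtain ⟨m, rfl⟩ := Submodule.Quotient.mk_surjective _ x
  refine (Submodule.Quotient.mk_eq_zero _).2 ?_
  exact Submodule.smul_mem_smul hr Submodule.mem_top

/-- The chosen preimage is immaterial, since the kernel of `p` acts by zero on the quotient;
`map_smul_def` records this independence. -/
instance : SMul S (Defl p M) := ⟨fun s x => Function.surjInv hp.is_surjective s • x⟩

variable {M} in
theorem map_smul_def (r : R) (x : Defl p M) : p r • x = r • x := by
  change Function.surjInv hp.is_surjective (p r) • x = r • x
  rw [← sub_eq_zero, ← sub_smul]
  refine ker_smul p ?_ x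
  rw [map_sub, Function.surjInv_eq hp.is_surjective, sub_self]

instance : Module S (Defl p M) :=
  Function.Surjective.moduleLeft p hp.is_surjective (map_smul_def p)

/-- The quotient map onto the deflation. -/
def mk : M →ₗ[R] Infl p (Defl p M) where
  toFun m := Submodule.Quotient.mk (p := (RingHom.ker p • ⊤ : Submodule R M)) m
  map_add' _ _ := rfl
  map_smul' r m := (map_smul_def p r (M := M) (Submodule.Quotient.mk m)).symm

theorem mk_surjective : Function.Surjective (mk p M) := Submodule.Quotient.mk_surjective _

variable {M}

theorem mk_eq_zero {m : M} : mk p M m = 0 ↔ m ∈ (RingHom.ker p • ⊤ : Submodule R M) :=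
  Submodule.Quotient.mk_eq_zero _

/-- The universal property of the deflation, as a map of `R`-modules. -/
def liftSource (f : M →ₗ[R] Infl p X) : Defl p M →ₗ[R] Infl p X :=
  Submodule.liftQ (RingHom.ker p • ⊤ : Submodule R M) f (by
    rw [Submodule.smul_le]
    intro r hr m _
    rw [LinearMap.mem_ker, map_smul]
    change toInfl p X (p r • (toInfl p X).symm (f m)) = 0
    rw [(RingHom.mem_ker).1 hr, zero_smul, map_zero])

/-- The universal property of the deflation. -/
def lift (f : M →ₗ[R] Infl p X) : Defl p M →ₗ[S] X where
  toFun x := (toInfl p X).symm (liftSource p f x)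
  map_add' x y := by rw [map_add, map_add]
  map_smul' s x := by
    obtain ⟨r, rfl⟩ := hp.is_surjective s
    rw [map_smul_def, map_smul]
    rfl

theorem lift_mk (f : M →ₗ[R] Infl p X) (m : M) :
    lift p f ((toInfl p _).symm (mk p M m)) = (toInfl p X).symm (f m) := rfl

variable {N : Type u} [AddCommGroup N] [Module R N]

/-- The deflation of a linear map. -/
def map (f : M →ₗ[R] N) : Defl p M →ₗ[S] Defl p N := lift p (mk p N ∘ₗ f)

theorem map_mk (f : M →ₗ[R] N) (m : M) :
    map p f ((toInfl p _).symm (mk p M m)) = (toInfl p _).symm (mk p N (f m)) := rfl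

theorem exists_mk (x : Defl p M) : ∃ m, (toInfl p _).symm (mk p M m) = x := mk_surjective p M x

instance [Module.Finite R M] : Module.Finite S (Defl p M) :=
  Module.Finite.of_surjective
    ({ toFun := fun m => (toInfl p _).symm (mk p M m)
       map_add' := fun _ _ => rfl
       map_smul' := fun r m => congrArg (toInfl p _).symm ((mk p M).map_smul r m) } : M →ₛₗ[p] Defl p M)
    (mk_surjective p M)

/-- Deflation is compatible with finite products. -/
def congrProd {L : Type u} [AddCommGroup L] [Module R L] (e : M ≃ₗ[R] N × L) :
    Defl p M ≃ₗ[S] Defl p N × Defl p L :=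
  LinearEquiv.ofLinearMap
    ((map p (LinearMap.fst R N L ∘ₗ e.toLinearMap)).prod
      (map p (LinearMap.snd R N L ∘ₗ e.toLinearMap)))
    ((map p (e.symm.toLinearMap ∘ₗ LinearMap.inl R N L)).coprod
      (map p (e.symm.toLinearMap ∘ₗ LinearMap.inr R N L)))
    (by
      refine LinearMap.ext fun x => ?_
      obtain ⟨x, y⟩ := x
      obtain ⟨x, rfl⟩ := exists_mk p x
      obtain ⟨y, rfl⟩ := exists_mk p y
      simp only [LinearMap.comp_apply, LinearMap.coprod_apply, LinearMap.prod_apply, map_mk,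
        Function.prod_apply, ← map_add, LinearEquiv.coe_coe, LinearMap.inl_apply, LinearMap.inr_apply,
        LinearEquiv.apply_symm_apply, Prod.mk_add_mk, add_zero, zero_add, LinearMap.fst_apply,
        LinearMap.snd_apply, LinearMap.id_apply])
    (by
      refine LinearMap.ext fun x => ?_
      obtain ⟨x, rfl⟩ := exists_mk p x
      simp only [LinearMap.comp_apply, LinearMap.coprod_apply, LinearMap.prod_apply, map_mk,
        Function.prod_apply, ← map_add, LinearEquiv.coe_coe, LinearMap.inl_apply, LinearMap.inr_apply,
        Prod.mk_add_mk, add_zero, zero_add, LinearMap.fst_apply, Prod.mk.eta,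
        LinearMap.snd_apply, LinearMap.id_apply, LinearEquiv.symm_apply_apply])

/-- Deflation is left adjoint to inflation, and inflation preserves surjections. A lifting problem
over `S` is solved over `R` and transported back by the universal property. -/
instance [Module.Projective R M] : Module.Projective S (Defl p M) := by
  refine Module.Projective.of_lifting_property'' fun f hf => ?_
  obtain ⟨g, hg⟩ := Module.projective_lifting_property (Infl.map p f) (mk p M) hf
  refine ⟨lift p g, LinearMap.ext fun x => ?_⟩
  obtain ⟨x, rfl⟩ := exists_mk p x
  exact LinearMap.congr_fun hg x

/-- A module that is isomorphic to an inflation has the inflated module as its deflation. -/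
def equivOfInfl (e : M ≃ₗ[R] Infl p X) : Defl p M ≃ₗ[S] X :=
  LinearEquiv.ofBijective (lift p e.toLinearMap) ⟨by
    rw [injective_iff_map_eq_zero]
    intro x hx
    obtain ⟨x, rfl⟩ := exists_mk p x
    rw [lift_mk, map_eq_zero_iff _ (AddEquiv.injective _), LinearEquiv.coe_coe,
      LinearEquiv.map_eq_zero_iff] at hx
    rw [hx, map_zero, map_zero], fun x => by
    obtain ⟨m, rfl⟩ := e.surjective x
    exact ⟨(toInfl p _).symm (mk p M m), rfl⟩⟩

/-- A module annihilated by the kernel of `R → S` is the inflation of its deflation. -/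
def inflEquiv (h : ∀ r, p r = 0 → ∀ m : M, r • m = 0) : M ≃ₗ[R] Infl p (Defl p M) :=
  LinearEquiv.ofBijective (mk p M) ⟨by
    rw [injective_iff_map_eq_zero]
    intro m hm
    rw [mk_eq_zero] at hm
    refine Submodule.smul_induction_on hm (fun r hr n _ => h r hr n) ?_
    rintro x y rfl rfl
    exact add_zero 0, mk_surjective p M⟩

theorem subsingleton (h : ∀ m : M, ∃ r, p r = 0 ∧ r • m = m) : Subsingleton (Defl p M) := by
  refine subsingleton_of_forall_eq 0 fun x => ?_
  obtain ⟨m, rfl⟩ := exists_mk p x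
  obtain ⟨r, hr, hm⟩ := h m
  rw [← hm, map_smul, toInfl_symm_smul, hr, zero_smul]

end Defl

/-- Inflation of finitely generated modules. -/
def infl (X : FGModuleCat.{u} S) : FGModuleCat.{u} R := FGModuleCat.of R (Infl p X)

/-- Deflation of finitely generated modules. -/
def defl (M : FGModuleCat.{u} R) : FGModuleCat.{u} S := FGModuleCat.of S (Defl p M)

/-- Deflation is additive and preserves projectives, so it descends to the Igusa-Todorov groups.
Inflation fails the second condition, which is why only this direction gives a homomorphism
outright. -/
theorem defl_respects :
    AddSubgroup.closure (K0Relations R) ≤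
      (FreeAbelianGroup.lift fun M : FGModuleCat.{u} R => K0.mk (defl p M)).ker := by
  rw [AddSubgroup.closure_le]
  rintro x (⟨M, M', M'', ⟨e⟩, rfl⟩ | ⟨P, hP, rfl⟩)
  · simp only [SetLike.mem_coe, AddMonoidHom.mem_ker, map_sub, FreeAbelianGroup.lift_apply_of]
    rw [sub_sub, sub_eq_zero]
    exact K0.mk_eq_add (M := defl p M) (M' := defl p M') (M'' := defl p M'') (Defl.congrProd p e)
  · simp only [SetLike.mem_coe, AddMonoidHom.mem_ker, FreeAbelianGroup.lift_apply_of]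
    have : Module.Projective S (defl p P) := inferInstanceAs (Module.Projective S (Defl p P))
    exact K0.mk_projective _

/-- The homomorphism of Igusa-Todorov groups induced by deflation. -/
def K0.defl : K0 R →+ K0 S :=
  QuotientAddGroup.lift _
    (FreeAbelianGroup.lift fun M : FGModuleCat.{u} R => K0.mk (IgusaTodorov.defl p M))
    (defl_respects p)

theorem K0.defl_mk (M : FGModuleCat.{u} R) :
    K0.defl p (K0.mk M) = K0.mk (IgusaTodorov.defl p M) :=
  FreeAbelianGroup.lift_apply_of _ _

theorem K0.defl_mk_of_equiv {M : FGModuleCat.{u} R} {X : FGModuleCat.{u} S}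
    (e : M ≃ₗ[R] Infl p X) : K0.defl p (K0.mk M) = K0.mk X := by
  rw [K0.defl_mk]
  exact K0.mk_congr (M := IgusaTodorov.defl p M) (Defl.equivOfInfl p e)

theorem K0.defl_mk_eq_zero {M : FGModuleCat.{u} R} (h : ∀ m : M, ∃ r, p r = 0 ∧ r • m = m) :
    K0.defl p (K0.mk M) = 0 := by
  rw [K0.defl_mk]
  have : Subsingleton (IgusaTodorov.defl p M) := Defl.subsingleton p h
  exact K0.mk_subsingleton _

end Inflation

end IgusaTodorov

namespace IgusaTodorov

/-! ### Minimal presentations by sums of modules R w with w idempotent. -/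

section Presentation

variable {R : Type u} [Ring R]

/-- The left ideal `{a | a w = a}`, which is `R w` if `w` is idempotent. -/
def fixedIdeal (w : R) : Submodule R R where
  carrier := {a | a * w = a}
  add_mem' {a b} ha hb := by rw [Set.mem_ofPred_eq] at *; rw [add_mul, ha, hb]
  zero_mem' := zero_mul w
  smul_mem' r a ha := by rw [Set.mem_ofPred_eq, smul_eq_mul] at *; rw [mul_assoc, ha]

theorem mem_fixedIdeal {w a : R} : a ∈ fixedIdeal w ↔ a * w = a := Iff.rfl

/-- The module `⨁ R w_i` for a finite family of idempotents. -/
abbrev Pres {n : ℕ} (w : Fin n → R) : Type u := ∀ i, fixedIdeal (w i)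

/-- The map `⨁ R w_i → M` given by a family of elements. -/
def presMap {n : ℕ} (w : Fin n → R) {M : Type u} [AddCommGroup M] [Module R M] (x : Fin n → M) :
    Pres w →ₗ[R] M where
  toFun a := ∑ i, (a i : R) • x i
  map_add' a b := by simp [add_smul, Finset.sum_add_distrib]
  map_smul' r a := by simp [mul_smul, Finset.smul_sum]

theorem presMap_apply {n : ℕ} (w : Fin n → R) {M : Type u} [AddCommGroup M] [Module R M]
    (x : Fin n → M) (a : Pres w) : presMap w x a = ∑ i, (a i : R) • x i := rfl

theorem pres_projective {n : ℕ} {w : Fin n → R} (hw : ∀ i, w i * w i = w i) :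
    Module.Projective R (Pres w) := by
  refine Module.Projective.of_split (M := Fin n → R)
    (LinearMap.pi fun i => (fixedIdeal (w i)).subtype ∘ₗ LinearMap.proj i)
    (LinearMap.pi fun i => LinearMap.codRestrict (fixedIdeal (w i))
      (LinearMap.toSpanSingleton R R (w i) ∘ₗ LinearMap.proj i) fun a => ?_) ?_
  · rw [mem_fixedIdeal]
    simp [mul_assoc, hw]
  · refine LinearMap.ext fun a => funext fun i => Subtype.ext ?_
    exact (a i).2

/-- The generator of the `i`-th summand of `⨁ R w_i`. -/
def presGen {n : ℕ} {w : Fin n → R} (hw : ∀ i, w i * w i = w i) (i : Fin n) : Pres w :=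
  Pi.single i ⟨w i, hw i⟩

theorem pres_eq_sum {n : ℕ} {w : Fin n → R} (hw : ∀ i, w i * w i = w i) (a : Pres w) :
    a = ∑ i, (a i : R) • presGen hw i := by
  funext j
  rw [Finset.sum_apply, Finset.sum_eq_single j]
  · refine Subtype.ext ?_
    rw [Pi.smul_apply, presGen, Pi.single_eq_same]
    exact (a j).2.symm
  · intro i _ hij
    rw [Pi.smul_apply, presGen, Pi.single_eq_of_ne hij.symm, smul_zero]
  · simp

/-- A finite family of elements `x_i ∈ w_i M` that generates `M` and whose relations have all their
coefficients in `J`. -/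
structure IsMinimalPresentation (J : Ideal R) {n : ℕ} (w : Fin n → R) {M : Type u}
    [AddCommGroup M] [Module R M] (x : Fin n → M) : Prop where
  fixed : ∀ i, w i • x i = x i
  generates : ∀ m : M, ∃ a : Fin n → R, m = ∑ i, a i • x i
  minimal : ∀ a : Fin n → R, ∑ i, a i • x i = 0 → ∀ i, a i * w i ∈ J

theorem IsMinimalPresentation.surjective {J : Ideal R} {n : ℕ} {w : Fin n → R} {M : Type u}
    [AddCommGroup M] [Module R M] {x : Fin n → M} (h : IsMinimalPresentation J w x)
    (hw : ∀ i, w i * w i = w i) : Function.Surjective (presMap w x) := by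
  intro m
  obtain ⟨a, rfl⟩ := h.generates m
  refine ⟨fun i => ⟨a i * w i, by rw [mem_fixedIdeal, mul_assoc, hw]⟩, ?_⟩
  rw [presMap_apply]
  exact Finset.sum_congr rfl fun i _ => by rw [mul_smul, h.fixed]

theorem IsMinimalPresentation.mem_of_mem_ker {J : Ideal R} {n : ℕ} {w : Fin n → R} {M : Type u}
    [AddCommGroup M] [Module R M] {x : Fin n → M} (h : IsMinimalPresentation J w x)
    {a : Pres w} (ha : presMap w x a = 0) (i : Fin n) : (a i : R) ∈ J := by
  have := h.minimal (fun i => a i) ha i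
  rwa [mem_fixedIdeal.1 (a i).2] at this

/-- If the idempotents `η_v` are local modulo `J` and their sum acts as the identity, then there is
a minimal presentation. -/
theorem exists_isMinimalPresentation {V : Type*} [Fintype V] (J : Ideal R) (η : V → R)
    (hη : ∀ v, η v * η v = η v)
    (hloc : ∀ v a, a * η v ∈ J ∨ ∃ y, y * (a * η v) = η v) (M : Type u) [AddCommGroup M]
    [Module R M] [hM : Module.Finite R M] (hsum : ∀ m : M, ∑ v, η v • m = m) :
    ∃ (n : ℕ) (v : Fin n → V) (x : Fin n → M),
      IsMinimalPresentation J (fun i => η (v i)) x := by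
  classical
  -- Minimality comes from taking the least possible number of generators, each supported at one
  -- vertex.
  let Q : ℕ → Prop := fun n => ∃ (v : Fin n → V) (x : Fin n → M), (∀ i, η (v i) • x i = x i) ∧
    ∀ m : M, ∃ a : Fin n → R, m = ∑ i, a i • x i
  have hQ : ∃ n, Q n := by
    obtain ⟨k, s, hs⟩ := Module.Finite.exists_fin (R := R) (M := M)
    let E := Fintype.equivFin (Fin k × V)
    refine ⟨_, fun i => (E.symm i).2, fun i => η (E.symm i).2 • s (E.symm i).1, fun i => ?_,
      fun m => ?_⟩
    · rw [← mul_smul, hη]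
    · have hm : m ∈ Submodule.span R (Set.range s) := hs ▸ Submodule.mem_top
      obtain ⟨c, rfl⟩ := (Submodule.mem_span_range_iff_exists_fun R).1 hm
      refine ⟨fun i => c (E.symm i).1, ?_⟩
      rw [Equiv.sum_comp E.symm fun z : Fin k × V => c z.1 • η z.2 • s z.1, Fintype.sum_prod_type]
      exact Finset.sum_congr rfl fun i _ => by dsimp only; rw [← Finset.smul_sum, hsum]
  obtain ⟨v, x, hfix, hgen⟩ := Nat.find_spec hQ
  refine ⟨_, v, x, hfix, hgen, fun a ha i₀ => ?_⟩
  rcases hloc (v i₀) (a i₀) with h | ⟨y, hy⟩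
  · exact h
  · exfalso
    generalize hn : Nat.find hQ = n at v x hfix hgen a ha i₀ hy
    obtain _ | n := n
    · exact i₀.elim0
    · refine Nat.find_min hQ (m := n) (by omega) ?_
      -- A relation whose `i₀`-th coefficient is invertible up to the idempotent expresses `x i₀`
      -- through the other generators, contradicting the choice of their number.
      have hx : x i₀ = ∑ i : Fin n, (-(y * a (i₀.succAbove i))) • x (i₀.succAbove i) := by
        rw [Fin.sum_univ_succAbove _ i₀] at ha
        have h1 : x i₀ = y • a i₀ • x i₀ := by
          conv_lhs => rw [← hfix, ← hy, mul_smul, mul_smul, hfix]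
        rw [h1, eq_neg_of_add_eq_zero_left ha, smul_neg, Finset.smul_sum, ← Finset.sum_neg_distrib]
        exact Finset.sum_congr rfl fun i _ => by rw [neg_smul, mul_smul]
      refine ⟨fun i => v (i₀.succAbove i), fun i => x (i₀.succAbove i), fun i => hfix _,
        fun m => ?_⟩
      obtain ⟨b, rfl⟩ := hgen m
      refine ⟨fun i => b i₀ * (-(y * a (i₀.succAbove i))) + b (i₀.succAbove i), ?_⟩
      rw [Fin.sum_univ_succAbove _ i₀, hx, Finset.smul_sum, ← Finset.sum_add_distrib]
      exact Finset.sum_congr rfl fun i _ => by rw [add_smul, mul_smul]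

end Presentation

/-! ### Splitting a module along complementary idempotents. -/

section Splitting

variable {R : Type u} [Ring R] {e f : R} (h1 : e + f = 1) {K : Type u} [AddCommGroup K]
  [Module R K]

/-- The submodule of the elements annihilated by `f`, if `f R e` acts by zero. -/
def annihilated (h1 : e + f = 1) (h : ∀ (r : R) (k : K), f • r • e • k = 0) : Submodule R K where
  carrier := {k | f • k = 0}
  add_mem' {a b} ha hb := by rw [Set.mem_ofPred_eq] at *; rw [smul_add, ha, hb, add_zero]
  zero_mem' := smul_zero f
  smul_mem' r k hk := by
    rw [Set.mem_ofPred_eq] at *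
    have : k = e • k := by
      conv_lhs => rw [← one_smul R k, ← h1, add_smul, hk, add_zero]
    rw [this, h]

theorem mem_annihilated {h : ∀ (r : R) (k : K), f • r • e • k = 0} {k : K} :
    k ∈ annihilated h1 h ↔ f • k = 0 := Iff.rfl

theorem annihilated_smul_eq (h1 : e + f = 1) {k : K} (hk : f • k = 0) : e • k = k := by
  conv_rhs => rw [← one_smul R k, ← h1, add_smul, hk, add_zero]

/-- A module on which `f R e` and `e R f` act by zero is the direct sum of its submodules
annihilated by `f` and by `e`. -/
def annihilatedProd (he : e * e = e) (h : ∀ (r : R) (k : K), f • r • e • k = 0)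
    (h' : ∀ (r : R) (k : K), e • r • f • k = 0) :
    K ≃ₗ[R] annihilated h1 h × annihilated ((add_comm f e).trans h1) h' :=
  LinearEquiv.symm (LinearEquiv.ofBijective
    ((annihilated h1 h).subtype.coprod (annihilated ((add_comm f e).trans h1) h').subtype) ⟨by
      rw [injective_iff_map_eq_zero]
      rintro ⟨⟨a, ha⟩, ⟨b, hb⟩⟩ hab
      rw [mem_annihilated] at ha hb
      change a + b = 0 at hab
      have ha' : a = 0 := by
        have := congrArg (e • ·) hab
        simpa [annihilated_smul_eq h1 ha, hb] using this
      have hb' : b = 0 := by rwa [ha', zero_add] at hab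
      subst ha' hb'
      rfl, fun k => by
      have hef : e * f = 0 := by
        have := congrArg (e * ·) h1
        simpa [mul_add, he] using this
      have hfe : f * e = 0 := by
        have := congrArg (· * e) h1
        simpa [add_mul, he] using this
      refine ⟨(⟨e • k, ?_⟩, ⟨f • k, ?_⟩), ?_⟩
      · rw [mem_annihilated, ← mul_smul, hfe, zero_smul]
      · rw [mem_annihilated, ← mul_smul, hef, zero_smul]
      · change e • k + f • k = k
        rw [← add_smul, h1, one_smul]⟩)

end Splitting

end IgusaTodorov

/-! ### Axioms of a gluing, and the shape of its syzygies. -/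

namespace IgusaTodorov

/-- A ring `R` glued from its quotients `S = R / R f R` and `T = R / R e R`, where `e + f = 1`: the
ideal `J` plays the role of the radical, the idempotents `ε_v` and `δ_w` are those of the vertices,
and `f R e J = 0 = e R f J`. -/
structure IsGluing {R S T : Type u} [Ring R] [Ring S] [Ring T] (p : R →+* S) (q : R →+* T)
    (J : Ideal R) (e f : R) {VA VB : Type u} [Fintype VA] [Fintype VB] (ε : VA → R)
    (δ : VB → R) : Prop where
  add_eq : e + f = 1
  e_mul_e : e * e = e
  f_mul_f : f * f = f
  map_f : p f = 0
  map_e : q e = 0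
  corner_p : ∀ x, p x = 0 → e * x * e = 0
  corner_q : ∀ x, q x = 0 → f * x * f = 0
  mem_ef : ∀ x, e * x * f ∈ J
  mem_fe : ∀ x, f * x * e ∈ J
  fe_mul : ∀ x, ∀ j ∈ J, f * x * (e * j) = 0
  ef_mul : ∀ x, ∀ j ∈ J, e * x * (f * j) = 0
  le_jacobson : J ≤ Ring.jacobson R
  ε_idem : ∀ v, ε v * ε v = ε v
  δ_idem : ∀ v, δ v * δ v = δ v
  ε_mul : ∀ v, ε v * e = ε v
  δ_mul : ∀ v, δ v * f = δ v
  sum_eq : ∑ v, ε v + ∑ v, δ v = 1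
  ε_local : ∀ v a, a * ε v ∈ J ∨ ∃ y, y * (a * ε v) = ε v
  δ_local : ∀ v a, a * δ v ∈ J ∨ ∃ y, y * (a * δ v) = δ v

namespace IsGluing

variable {R S T : Type u} [Ring R] [Ring S] [Ring T] {p : R →+* S} {q : R →+* T}
  {J : Ideal R} {e f : R} {VA VB : Type u} [Fintype VA] [Fintype VB] {ε : VA → R} {δ : VB → R}

theorem symm (h : IsGluing p q J e f ε δ) : IsGluing q p J f e δ ε where
  add_eq := (add_comm f e).trans h.add_eq
  e_mul_e := h.f_mul_f
  f_mul_f := h.e_mul_e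
  map_f := h.map_e
  map_e := h.map_f
  corner_p := h.corner_q
  corner_q := h.corner_p
  mem_ef := h.mem_fe
  mem_fe := h.mem_ef
  fe_mul := h.ef_mul
  ef_mul := h.fe_mul
  le_jacobson := h.le_jacobson
  ε_idem := h.δ_idem
  δ_idem := h.ε_idem
  ε_mul := h.δ_mul
  δ_mul := h.ε_mul
  sum_eq := (add_comm _ _).trans h.sum_eq
  ε_local := h.δ_local
  δ_local := h.ε_local

variable (h : IsGluing p q J e f ε δ)

include h

theorem e_mul_f : e * f = 0 := by
  have := congrArg (e * ·) h.add_eq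
  simpa [mul_add, h.e_mul_e] using this

theorem f_mul_e : f * e = 0 := h.symm.e_mul_f

/-- On such a module `e` acts as the identity, so `r` acts as `e * r * e`, which vanishes for `r` in
the kernel of `p`. -/
theorem smul_eq_zero {M : Type u} [AddCommGroup M] [Module R M] (hM : ∀ m : M, f • m = 0)
    (r : R) (hr : p r = 0) (m : M) : r • m = 0 := by
  have he : ∀ n : M, e • n = n := fun n => annihilated_smul_eq h.add_eq (hM n)
  rw [← he m, ← he (r • e • m), ← mul_smul, ← mul_smul, h.corner_p r hr, zero_smul]

/-- The module `N_v = f R ε_v`. -/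
def side (v : VA) : Submodule R R where
  carrier := {a | a * ε v = a ∧ e * a = 0}
  add_mem' {a b} ha hb := by
    rw [Set.mem_ofPred_eq] at *
    rw [add_mul, mul_add, ha.1, ha.2, hb.1, hb.2, add_zero]
    exact ⟨rfl, rfl⟩
  zero_mem' := ⟨zero_mul _, mul_zero _⟩
  -- An element of the carrier equals `f * a * e` and so lies in `J`; the axiom `ef_mul` then gives
  -- `e * r * a = 0`.
  smul_mem' r a ha := by
    rw [Set.mem_ofPred_eq, smul_eq_mul] at *
    refine ⟨by rw [mul_assoc, ha.1], ?_⟩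
    have h1 : a = f * a := by
      conv_lhs => rw [← one_mul a, ← h.add_eq, add_mul, ha.2, zero_add]
    have h2 : a = a * e := by rw [← ha.1, mul_assoc, h.ε_mul]
    have h3 : a ∈ J := by
      rw [h2, h1]
      exact h.mem_fe a
    rw [h1, ← mul_assoc]
    exact h.ef_mul r a h3

theorem exists_minimalPresentation_left [IsNoetherianRing R] (M : FGModuleCat.{u} R)
    (hM : ∀ m : M, f • m = 0) :
    ∃ (n : ℕ) (v : Fin n → VA) (x : Fin n → M),
      IsMinimalPresentation J (fun i => ε (v i)) x := by
  refine exists_isMinimalPresentation J ε h.ε_idem h.ε_local M fun m => ?_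
  have hδ : ∀ v, δ v • m = 0 := fun v => by rw [← h.δ_mul, mul_smul, hM, smul_zero]
  conv_rhs => rw [← one_smul R m, ← h.sum_eq, add_smul, Finset.sum_smul, Finset.sum_smul]
  simp [hδ]

theorem exists_minimalPresentation [IsNoetherianRing R] (M : FGModuleCat.{u} R) :
    ∃ (n : ℕ) (v : Fin n → VA ⊕ VB) (x : Fin n → M),
      IsMinimalPresentation J (fun i => Sum.elim ε δ (v i)) x := by
  refine exists_isMinimalPresentation J (Sum.elim ε δ) ?_ ?_ M fun m => ?_
  · rintro (v | v)
    exacts [h.ε_idem v, h.δ_idem v]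
  · rintro (v | v)
    exacts [h.ε_local v, h.δ_local v]
  · rw [Fintype.sum_sum_type]
    simp only [Sum.elim_inl, Sum.elim_inr]
    rw [← Finset.sum_smul, ← Finset.sum_smul, ← add_smul, h.sum_eq, one_smul]

section Kernel

variable {n : ℕ} {w : Fin n → R} {M : Type u} [AddCommGroup M] [Module R M] {x : Fin n → M}
  (hx : IsMinimalPresentation J w x)

include hx

/-- The components of a relation lie in `J` by minimality, and `f R e` annihilates `J`. This is the
hypothesis under which the syzygy splits. -/
theorem fe_smul_ker (r : R) (k : LinearMap.ker (presMap w x)) : f • r • e • k = 0 := by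
  refine Subtype.ext (funext fun i => Subtype.ext ?_)
  change f * (r * (e * (k.1 i : R))) = 0
  rw [← mul_assoc]
  exact h.fe_mul r _ (hx.mem_of_mem_ker k.2 i)

theorem ef_smul_ker (r : R) (k : LinearMap.ker (presMap w x)) : e • r • f • k = 0 :=
  h.symm.fe_smul_ker hx r k

/-- The part of the syzygy that is annihilated by `f`. -/
def kerLeft : Submodule R (LinearMap.ker (presMap w x)) :=
  annihilated h.add_eq (h.fe_smul_ker hx)

/-- The syzygy is the direct sum of its parts annihilated by `f` and by `e`. -/
def kerEquiv : LinearMap.ker (presMap w x) ≃ₗ[R] h.kerLeft hx × h.symm.kerLeft hx :=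
  annihilatedProd (K := LinearMap.ker (presMap w x)) h.add_eq h.e_mul_e (h.fe_smul_ker hx) (h.ef_smul_ker hx)

theorem mk_ker_eq [IsNoetherianRing R] :
    K0.mk (FGModuleCat.of R (LinearMap.ker (presMap w x))) =
      K0.mk (FGModuleCat.of R (h.kerLeft hx)) + K0.mk (FGModuleCat.of R (h.symm.kerLeft hx)) := by
  rw [← K0.mk_prod]
  exact K0.mk_congr (M := FGModuleCat.of R (LinearMap.ker (presMap w x)))
    (N := FGModuleCat.of R (h.kerLeft hx × h.symm.kerLeft hx))
    (h.kerEquiv hx)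

end Kernel

theorem omegaBar_mk_eq [IsNoetherianRing R] {n : ℕ} {w : Fin n → R} (hw : ∀ i, w i * w i = w i)
    {M : FGModuleCat.{u} R} {x : Fin n → M} (hx : IsMinimalPresentation J w x) :
    omegaBar R (K0.mk M) =
      K0.mk (FGModuleCat.of R (h.kerLeft hx)) + K0.mk (FGModuleCat.of R (h.symm.kerLeft hx)) := by
  rw [← h.mk_ker_eq hx, omegaBar_mk]
  have : Module.Projective R (FGModuleCat.of R (Pres w)) := pres_projective hw
  exact K0.mk_syzygy_eq (P := FGModuleCat.of R (Pres w)) (presMap w x) (hx.surjective hw)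

section Left

variable {n : ℕ} {v : Fin n → VA} {M : FGModuleCat.{u} R} {x : Fin n → M}
  (hx : IsMinimalPresentation J (fun i => ε (v i)) x) (hM : ∀ m : M, f • m = 0)

include hM in
/-- If `M` is annihilated by `f`, then the part of the syzygy that is annihilated by `e` is a direct
sum of modules `f R ε_v`. -/
def kerRightEquiv : h.symm.kerLeft hx ≃ₗ[R] ∀ i, h.side (v i) where
  toFun k i := ⟨(k.1.1 i : R), (k.1.1 i).2,
    congrArg (fun k : LinearMap.ker (presMap (fun i => ε (v i)) x) => (k.1 i : R)) k.2⟩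
  map_add' _ _ := rfl
  map_smul' _ _ := rfl
  invFun a := ⟨⟨fun i => ⟨a i, (a i).2.1⟩, by
    rw [LinearMap.mem_ker, presMap_apply]
    -- A component killed by `e` has the form `f * a`, and `f` kills `M`. Hence all of f R ε_v
    -- consists of relations, whatever the module is.
    refine Finset.sum_eq_zero fun i _ => ?_
    have h1 : (a i : R) = f * a i := by
      conv_lhs => rw [← one_mul (a i : R), ← h.add_eq, add_mul, (a i).2.2, zero_add]
    change (a i : R) • x i = 0
    rw [h1, mul_smul, hM]⟩,
    Subtype.ext (funext fun i => Subtype.ext (a i).2.2)⟩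
  left_inv _ := rfl
  right_inv _ := rfl

include hM in
theorem omegaBar_mk_left [IsNoetherianRing R] :
    omegaBar R (K0.mk M) =
      K0.mk (FGModuleCat.of R (h.kerLeft hx)) + ∑ i, K0.mk (FGModuleCat.of R (h.side (v i))) := by
  rw [h.omegaBar_mk_eq (fun i => h.ε_idem _) hx, ← K0.mk_pi]
  congr 1
  exact K0.mk_congr (M := FGModuleCat.of R (h.symm.kerLeft hx))
    (N := FGModuleCat.of R (∀ i, h.side (v i))) (h.kerRightEquiv hx hM)

/-- Components of elements of `Pres` are fixed by `e` on the right, so `e` times such an element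
lands in the corner `e * ker p * e`, which is zero. Passing to the deflation therefore loses nothing
of the part supported at `e`. -/
theorem smul_eq_zero_of_mem {y : Pres fun i => ε (v i)}
    (hy : y ∈ (RingHom.ker p • ⊤ : Submodule R (Pres fun i => ε (v i)))) : e • y = 0 := by
  refine Submodule.smul_induction_on hy (fun r hr z _ => ?_) fun y z hy hz => ?_
  · refine funext fun i => Subtype.ext ?_
    change e * (r * (z i : R)) = 0
    have hz : (z i : R) = z i * e := by
      rw [← mem_fixedIdeal.1 (z i).2, mul_assoc, h.ε_mul]
    rw [hz, ← mul_assoc, ← mul_assoc, mul_assoc e]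
    exact h.corner_p _ (by rw [map_mul, (RingHom.mem_ker).1 hr, zero_mul])
  · rw [smul_add, hy, hz, add_zero]

omit h in
/-- The deflation of a minimal presentation. -/
abbrev deflMap (p : R →+* S) [RingHomSurjective p] (v : Fin n → VA) (x : Fin n → M) :
    Defl p (Pres fun i => ε (v i)) →ₗ[S] Defl p M :=
  Defl.map p (presMap (fun i => ε (v i)) x)

variable [hp : RingHomSurjective p]

include hx in
theorem deflMap_surjective : Function.Surjective (deflMap (ε := ε) p v x) := by
  intro m
  obtain ⟨m, rfl⟩ := Defl.exists_mk p m
  obtain ⟨y, rfl⟩ := hx.surjective (fun i => h.ε_idem _) m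
  exact ⟨_, Defl.map_mk p _ y⟩

/-- The part of the syzygy that is annihilated by `f` is the syzygy of the deflation. -/
def kerLeftMap : h.kerLeft hx →ₗ[R] Infl p (LinearMap.ker (deflMap (ε := ε) p v x)) where
  toFun k := toInfl p _ ⟨(toInfl p _).symm (Defl.mk p _ k.1.1), by
    rw [LinearMap.mem_ker, Defl.map_mk, k.1.2, map_zero, map_zero]⟩
  map_add' _ _ := rfl
  map_smul' r k := congrArg (toInfl p _) (Subtype.ext ((Defl.mk p _).map_smul r k.1.1))

theorem kerLeftMap_injective : Function.Injective (h.kerLeftMap hx) := by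
  rw [injective_iff_map_eq_zero]
  intro k hk
  have h1 : Defl.mk p _ k.1.1 = 0 := congrArg Subtype.val hk
  have h2 := h.smul_eq_zero_of_mem ((Defl.mk_eq_zero p).1 h1)
  have h3 : e • k = k := Subtype.ext (annihilated_smul_eq h.add_eq ((mem_annihilated _).1 k.2))
  rw [← h3]
  exact Subtype.ext (Subtype.ext h2)

include hM in
-- Since `M` is its own deflation, any lift of a deflated relation is a relation. Replacing the lift
-- by its `e`-part does not change its image, because `p f = 0`.
theorem kerLeftMap_surjective : Function.Surjective (h.kerLeftMap hx) := by
  rintro ⟨d, hd⟩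
  obtain ⟨y, rfl⟩ := Defl.exists_mk p d
  rw [LinearMap.mem_ker, Defl.map_mk] at hd
  have hinj := (Defl.inflEquiv p (h.smul_eq_zero hM)).injective
  have hy : presMap (fun i => ε (v i)) x y = 0 := hinj (hd.trans (map_zero _).symm)
  have hy' : y = e • y + f • y := by rw [← add_smul, h.add_eq, one_smul]
  refine ⟨⟨⟨e • y, ?_⟩, ?_⟩, ?_⟩
  · rw [LinearMap.mem_ker, map_smul, hy, smul_zero]
  · refine (mem_annihilated _).2 (Subtype.ext ?_)
    change f • e • y = 0
    rw [← mul_smul, h.f_mul_e, zero_smul]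
  · refine Subtype.ext ?_
    change Defl.mk p _ (e • y) = Defl.mk p _ y
    have : Defl.mk p _ (f • y) = 0 :=
      (Defl.mk_eq_zero p).2 (Submodule.smul_mem_smul h.map_f Submodule.mem_top)
    conv_rhs => rw [hy', map_add, this, add_zero]

include hM in
-- The deflated presentation is a projective presentation of the deflation of `M`. By Schanuel's
-- lemma it computes the class of the syzygy over `S`, whether or not it is still minimal.
theorem defl_mk_kerLeft [IsNoetherianRing R] [IsNoetherianRing S] :
    K0.defl p (K0.mk (FGModuleCat.of R (h.kerLeft hx))) =
      omegaBar S (K0.defl p (K0.mk M)) := by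
  rw [K0.defl_mk p M, omegaBar_mk]
  have hproj : Module.Projective R (Pres fun i => ε (v i)) := pres_projective fun i => h.ε_idem _
  have : Module.Projective S (FGModuleCat.of S (Defl p (Pres fun i => ε (v i)))) :=
    inferInstanceAs (Module.Projective S (Defl p (Pres fun i => ε (v i))))
  rw [K0.mk_syzygy_eq (M := defl p M) (P := FGModuleCat.of S (Defl p (Pres fun i => ε (v i))))
    (deflMap p v x) (h.deflMap_surjective hx)]
  exact K0.defl_mk_of_equiv p (M := FGModuleCat.of R (h.kerLeft hx))
    (X := FGModuleCat.of S (LinearMap.ker (deflMap (ε := ε) p v x)))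
    (LinearEquiv.ofBijective (h.kerLeftMap hx)
      ⟨h.kerLeftMap_injective hx, h.kerLeftMap_surjective hx hM⟩)

include hM in
/-- If the deflation of `M` is projective, then its minimal presentation has no kernel. -/
theorem subsingleton_kerLeft [IsNoetherianRing R] [IsNoetherianRing S]
    [hproj : Module.Projective S (Defl p M)] : Subsingleton (h.kerLeft hx) := by
  obtain ⟨s, hs⟩ := Module.projective_lifting_property (deflMap (ε := ε) p v x) LinearMap.id
    (h.deflMap_surjective hx)
  let N := LinearMap.ker (deflMap (ε := ε) p v x)
  -- A section of the deflated presentation gives a retraction onto its kernel `N`. Elements of `N`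
  -- come from tuples with entries in `J`; writing them in the generators and applying the
  -- retraction shows N = rad · N, and Nakayama's lemma gives N = 0.
  let t : Defl p (Pres fun i => ε (v i)) →ₗ[S] N :=
    LinearMap.codRestrict N (LinearMap.id - s ∘ₗ deflMap p v x) fun y => by
      rw [LinearMap.mem_ker, LinearMap.sub_apply, map_sub, LinearMap.comp_apply, sub_eq_zero]
      exact (LinearMap.congr_fun hs _).symm
  let τ : Pres (fun i => ε (v i)) →ₗ[R] Infl p N := Infl.map p t ∘ₗ Defl.mk p _
  have hτ : ∀ k : h.kerLeft hx, h.kerLeftMap hx k = τ k.1.1 := by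
    intro k
    refine Subtype.ext ?_
    change (toInfl p _).symm (Defl.mk p _ k.1.1) = (toInfl p _).symm (Defl.mk p _ k.1.1) -
      s (deflMap p v x ((toInfl p _).symm (Defl.mk p _ k.1.1)))
    rw [Defl.map_mk, k.1.2, map_zero, map_zero, map_zero, sub_zero]
  have hfg : (⊤ : Submodule R (Infl p N)).FG := Module.Finite.fg_top
  have hle : (⊤ : Submodule R (Infl p N)) ≤ Ring.jacobson R • ⊤ := by
    rintro y -
    obtain ⟨k, rfl⟩ := h.kerLeftMap_surjective hx hM y
    rw [hτ, pres_eq_sum (fun i => h.ε_idem _) k.1.1, map_sum]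
    refine Submodule.sum_mem _ fun i _ => ?_
    rw [map_smul]
    exact Submodule.smul_mem_smul (h.le_jacobson (hx.mem_of_mem_ker k.1.2 i)) Submodule.mem_top
  have hbot := hfg.eq_bot_of_le_jacobson_smul hle
  have : Subsingleton (Infl p N) := by
    rw [← Submodule.subsingleton_iff R, ← subsingleton_iff_bot_eq_top]
    exact hbot.symm
  exact (h.kerLeftMap_injective hx).subsingleton

end Left

end IsGluing

end IgusaTodorov

/-! ### Comparison of Ω̄ over the gluing and over its two quotients. -/

namespace IgusaTodorov

namespace IsGluing

variable {R S T : Type u} [Ring R] [Ring S] [Ring T] {p : R →+* S} {q : R →+* T}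
  {J : Ideal R} {e f : R} {VA VB : Type u} [Fintype VA] [Fintype VB] {ε : VA → R} {δ : VB → R}

/-- The subgroup of `K₀(R)` generated by the modules annihilated by `e` or by `f`. -/
def splitSubgroup (e f : R) : AddSubgroup (K0 R) :=
  AddSubgroup.closure {z | ∃ M : FGModuleCat.{u} R,
    ((∀ m : M, f • m = 0) ∨ ∀ m : M, e • m = 0) ∧ z = K0.mk M}

variable (h : IsGluing p q J e f ε δ)

include h

theorem smul_kerLeft {n : ℕ} {w : Fin n → R} {M : Type u} [AddCommGroup M] [Module R M]
    {x : Fin n → M} (hx : IsMinimalPresentation J w x) (k : h.kerLeft hx) : f • k = 0 :=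
  Subtype.ext ((mem_annihilated _).1 k.2)

variable [IsNoetherianRing R]

/-- Every syzygy splits into an `e`-part and an `f`-part, so a single application of Ω̄ brings any
class into the range of the comparison results below. -/
theorem omegaBar_mem_splitSubgroup (z : K0 R) : omegaBar R z ∈ splitSubgroup e f := by
  induction z using K0.induction with
  | mk M =>
    obtain ⟨n, v, x, hx⟩ := h.exists_minimalPresentation M
    rw [h.omegaBar_mk_eq ?_ hx]
    · exact add_mem
        (AddSubgroup.subset_closure ⟨_, Or.inl (h.smul_kerLeft hx), rfl⟩)
        (AddSubgroup.subset_closure ⟨_, Or.inr (h.symm.smul_kerLeft hx), rfl⟩)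
    · intro i
      rcases v i with v | v
      exacts [h.ε_idem v, h.δ_idem v]
  | neg x hx => rw [map_neg]; exact neg_mem hx
  | add x y hx hy => rw [map_add]; exact add_mem hx hy

variable [hp : RingHomSurjective p] [hq : RingHomSurjective q]

/-- A module annihilated by `f` is the inflation of its deflation. -/
def inflEquiv {M : FGModuleCat.{u} R} (hM : ∀ m : M, f • m = 0) : M ≃ₗ[R] infl p (defl p M) :=
  Defl.inflEquiv p (h.smul_eq_zero hM)

theorem smul_infl (X : FGModuleCat.{u} S) (x : infl p X) : f • x = 0 := by
  change toInfl p X (p f • (toInfl p X).symm x) = 0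
  rw [h.map_f, zero_smul, map_zero]

/-- Here `e` acts as the identity while `q e = 0`: deflating to one side forgets the modules of the
other side. -/
theorem defl_eq_zero {M : FGModuleCat.{u} R} (hM : ∀ m : M, f • m = 0) :
    K0.defl q (K0.mk M) = 0 :=
  K0.defl_mk_eq_zero q fun m => ⟨e, h.map_e, annihilated_smul_eq h.add_eq (hM m)⟩

/-- The class `[N_v]`. -/
def sideClass (v : VA) : K0 R := K0.mk (FGModuleCat.of R (h.side v))

theorem smul_side (v : VA) (x : h.side v) : e • x = 0 := Subtype.ext x.2.2

section Left

variable [IsNoetherianRing S]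

theorem exists_omegaBar_mk {M : FGModuleCat.{u} R} (hM : ∀ m : M, f • m = 0) :
    ∃ (L : FGModuleCat.{u} R) (n : ℕ) (v : Fin n → VA), (∀ l : L, f • l = 0) ∧
      omegaBar R (K0.mk M) = K0.mk L + ∑ i, h.sideClass (v i) ∧
      K0.defl p (K0.mk L) = omegaBar S (K0.defl p (K0.mk M)) ∧
      (Module.Projective S (defl p M) → Subsingleton L) := by
  obtain ⟨n, v, x, hx⟩ := h.exists_minimalPresentation_left M hM
  exact ⟨FGModuleCat.of R (h.kerLeft hx), n, v, h.smul_kerLeft hx, h.omegaBar_mk_left hx hM,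
    h.defl_mk_kerLeft hx hM, fun hproj => h.subsingleton_kerLeft hx hM (hproj := hproj)⟩

theorem defl_omegaBar {M : FGModuleCat.{u} R} (hM : ∀ m : M, f • m = 0) :
    K0.defl p (omegaBar R (K0.mk M)) = omegaBar S (K0.defl p (K0.mk M)) := by
  obtain ⟨L, n, v, hL, h1, h2, -⟩ := h.exists_omegaBar_mk hM
  rw [h1, map_add, h2, map_sum, Finset.sum_eq_zero, add_zero]
  exact fun i _ => h.symm.defl_eq_zero (h.smul_side (v i))

/-- What a syzygy of a left module contributes to the right side is a sum of modules N_v, and the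
power `d` kills each of them. -/
theorem iterate_defl_omegaBar [IsNoetherianRing T] {d : ℕ}
    (hd : ∀ v, (omegaBar T)^[d] (K0.defl q (h.sideClass v)) = 0)
    {M : FGModuleCat.{u} R} (hM : ∀ m : M, f • m = 0) :
    (omegaBar T)^[d] (K0.defl q (omegaBar R (K0.mk M))) = 0 := by
  obtain ⟨L, n, v, hL, h1, -, -⟩ := h.exists_omegaBar_mk hM
  rw [h1, map_add, h.defl_eq_zero hL, zero_add, map_sum]
  let g : AddMonoid.End (K0 T) := omegaBar T
  have hpow : ∀ z, (omegaBar T)^[d] z = (g ^ d) z := fun z => by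
    rw [AddMonoid.End.coe_pow]
    rfl
  rw [hpow, map_sum]
  exact Finset.sum_eq_zero fun i _ => by rw [← hpow, hd]

variable (F : AddSubgroup (K0 R)) (hF : ∀ v, h.sideClass v ∈ F)

include hF in
-- A projective `S`-module need not inflate to a projective, but the left part of the syzygy of its
-- inflation vanishes by `subsingleton_kerLeft`. What remains is a sum of modules N_v, hence zero
-- modulo `F`.
theorem inflOmega_respects :
    AddSubgroup.closure (K0Relations S) ≤
      (FreeAbelianGroup.lift fun X : FGModuleCat.{u} S =>
        (QuotientAddGroup.mk' F (omegaBar R (K0.mk (infl p X))))).ker := by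
  rw [AddSubgroup.closure_le]
  rintro x (⟨M, M', M'', ⟨e'⟩, rfl⟩ | ⟨P, hP, rfl⟩)
  · simp only [SetLike.mem_coe, AddMonoidHom.mem_ker, map_sub, FreeAbelianGroup.lift_apply_of]
    rw [K0.mk_eq_add (M := infl p M) (M' := infl p M') (M'' := infl p M'') (show Infl p M ≃ₗ[R] Infl p M' × Infl p M'' from Infl.congrProd p e'),
      map_add, map_add]
    abel
  · simp only [SetLike.mem_coe, AddMonoidHom.mem_ker, FreeAbelianGroup.lift_apply_of]
    obtain ⟨L, n, v, hL, h1, -, h3⟩ := h.exists_omegaBar_mk (h.smul_infl P)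
    have hproj : Module.Projective S (defl p (infl p P)) :=
      Module.Projective.of_equiv (Defl.equivOfInfl p (LinearEquiv.refl R (Infl p P))).symm
    have := h3 hproj
    rw [h1, K0.mk_subsingleton L, zero_add]
    exact (QuotientAddGroup.eq_zero_iff _).2 (sum_mem fun i _ => hF _)

/-- The homomorphism `K₀(S) → K₀(R) / F` that maps the class of `X` to the class of the syzygy of the
inflation of `X`. -/
def inflOmega : K0 S →+ K0 R ⧸ F :=
  QuotientAddGroup.lift _ _ (h.inflOmega_respects F hF)

theorem inflOmega_mk (X : FGModuleCat.{u} S) : h.inflOmega F hF (K0.mk X) =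
    QuotientAddGroup.mk' F (omegaBar R (K0.mk (infl p X))) :=
  FreeAbelianGroup.lift_apply_of _ _

theorem inflOmega_defl {M : FGModuleCat.{u} R} (hM : ∀ m : M, f • m = 0) :
    h.inflOmega F hF (K0.defl p (K0.mk M)) = QuotientAddGroup.mk' F (omegaBar R (K0.mk M)) := by
  rw [K0.defl_mk, inflOmega_mk, K0.mk_congr (h.inflEquiv hM)]

variable (hF' : ∀ z ∈ F, omegaBar R z ∈ F)

omit h hp hq in
/-- The endomorphism of `K₀(R) / F` induced by `Ω̄`. -/
abbrev omegaQuot (F : AddSubgroup (K0 R)) (hF' : ∀ z ∈ F, omegaBar R z ∈ F) :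
    K0 R ⧸ F →+ K0 R ⧸ F :=
  QuotientAddGroup.map F F (omegaBar R) hF'

/-- The syzygies over `R` and over `S` differ by modules N_v. These lie in `F`, and so do their
syzygies because `F` is invariant. -/
theorem inflOmega_omegaBar (z : K0 S) : h.inflOmega F hF (omegaBar S z) =
    omegaQuot F hF' (h.inflOmega F hF z) := by
  induction z using K0.induction with
  | mk X =>
    obtain ⟨L, n, v, hL, h1, h2, -⟩ := h.exists_omegaBar_mk (h.smul_infl X)
    rw [inflOmega_mk, K0.defl_mk_of_equiv p (LinearEquiv.refl R (infl p X))] at *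
    rw [← h2, h.inflOmega_defl F hF hL, h1]
    change _ = QuotientAddGroup.mk' F (omegaBar R _)
    rw [map_add, map_add, map_sum, left_eq_add]
    exact (QuotientAddGroup.eq_zero_iff _).2 (sum_mem fun i _ => hF' _ (hF _))
  | neg x hx => rw [map_neg, map_neg, map_neg, map_neg, hx]
  | add x y hx hy => rw [map_add, map_add, map_add, map_add, hx, hy]

theorem inflOmega_iterate (n : ℕ) (z : K0 S) : h.inflOmega F hF ((omegaBar S)^[n] z) =
    (omegaQuot F hF')^[n] (h.inflOmega F hF z) := by
  induction n generalizing z with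
  | zero => rfl
  | succ n ih => rw [Function.iterate_succ_apply, Function.iterate_succ_apply, ih,
      h.inflOmega_omegaBar F hF hF']

/-- On the classes of the modules annihilated by `e` or by `f`, deflation commutes with `Ω̄` up to
modules of finite projective dimension. -/
theorem iterate_defl [IsNoetherianRing T] {d : ℕ}
    (hd : ∀ v, (omegaBar S)^[d] (K0.defl p (h.symm.sideClass v)) = 0)
    {z : K0 R} (hz : z ∈ splitSubgroup e f) :
    (omegaBar S)^[d] (K0.defl p (omegaBar R z)) = (omegaBar S)^[d + 1] (K0.defl p z) := by
  induction hz using AddSubgroup.closure_induction with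
  | mem z hz =>
    obtain ⟨M, hM | hM, rfl⟩ := hz
    · rw [h.defl_omegaBar hM, Function.iterate_succ_apply]
    -- For a module of the other side the deflation is zero, while that of its syzygy is a sum of
    -- side modules, killed by the power `d`.
    · rw [h.symm.iterate_defl_omegaBar hd hM, h.symm.defl_eq_zero hM, iterate_map_zero]
  | zero => rw [map_zero, map_zero, iterate_map_zero, iterate_map_zero]
  | neg x _ hx => rw [map_neg, map_neg, map_neg, iterate_map_neg, iterate_map_neg, hx]
  | add x y _ _ hx hy =>
    rw [map_add, map_add, map_add, iterate_map_add, iterate_map_add, hx, hy]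

/-- The same `d` serves for every `m`: the error made at each step is absorbed by the power of Ω̄
already in front. This uniformity makes the stationary exponent of `S` applicable. -/
theorem iterate_defl_iterate [IsNoetherianRing T] {d : ℕ}
    (hd : ∀ v, (omegaBar S)^[d] (K0.defl p (h.symm.sideClass v)) = 0)
    (m : ℕ) {z : K0 R} (hz : z ∈ splitSubgroup e f) :
    (omegaBar S)^[d] (K0.defl p ((omegaBar R)^[m] z)) = (omegaBar S)^[m + d] (K0.defl p z) := by
  induction m generalizing z with
  | zero => rw [zero_add]; rfl
  | succ m ih =>
    rw [Function.iterate_succ_apply, ih (h.omegaBar_mem_splitSubgroup z),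
      Function.iterate_add_apply, h.iterate_defl hd hz, ← Function.iterate_add_apply]
    congr 1
    omega

end Left

/-- The `φ`-dimension of a gluing is finite if the `φ`-dimensions of the two rings are, and the
modules `f R ε_v` and `e R δ_w` have finite projective dimension. -/
theorem phiDim_lt_top [IsNoetherianRing S] [IsArtinianRing S] [IsNoetherianRing T]
    [IsArtinianRing T] (hS : phiDim S < ⊤) (hT : phiDim T < ⊤)
    (hA : ∀ v, ∃ d, (omegaBar T)^[d] (K0.defl q (h.sideClass v)) = 0)
    (hB : ∀ v, ∃ d, (omegaBar S)^[d] (K0.defl p (h.symm.sideClass v)) = 0) :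
    phiDim R < ⊤ := by
  have uniform : ∀ {W : Type u} [Fintype W] {G : Type (u + 1)} [AddCommGroup G] (g : G →+ G)
      (c : W → G), (∀ v, ∃ d, g^[d] (c v) = 0) → ∃ d, ∀ v, g^[d] (c v) = 0 := by
    intro W _ G _ g c hc
    choose d hd using hc
    -- The sum over the finitely many vertices exceeds each exponent, and a class once killed stays
    -- killed.
    refine ⟨∑ v, d v, fun v => ?_⟩
    rw [← Nat.sub_add_cancel (Finset.single_le_sum (fun _ _ => Nat.zero_le _)
      (Finset.mem_univ v) : d v ≤ _), Function.iterate_add_apply, hd, iterate_map_zero]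
  obtain ⟨a, ha⟩ := uniform (omegaBar T) (fun v => K0.defl q (h.sideClass v)) hA
  obtain ⟨b, hb⟩ := uniform (omegaBar S) (fun v => K0.defl p (h.symm.sideClass v)) hB
  obtain ⟨s, hs⟩ := exists_omegaBar_stable hS
  obtain ⟨t, ht⟩ := exists_omegaBar_stable hT
  obtain ⟨F, hF, hF', r, hr⟩ := exists_invariant_addSubgroup (omegaBar R)
    ((Set.finite_range h.sideClass).union (Set.finite_range h.symm.sideClass))
  have hFA : ∀ v, h.sideClass v ∈ F := fun v => hF (Or.inl ⟨v, rfl⟩)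
  have hFB : ∀ v, h.symm.sideClass v ∈ F := fun v => hF (Or.inr ⟨v, rfl⟩)
  have hsplit : splitSubgroup f e = splitSubgroup e f := by
    unfold splitSubgroup
    simp only [or_comm]
  have key : ∀ z ∈ splitSubgroup e f, h.inflOmega F hFA (K0.defl p z) +
      h.symm.inflOmega F hFB (K0.defl q z) = QuotientAddGroup.mk' F (omegaBar R z) := by
    intro z hz
    induction hz using AddSubgroup.closure_induction with
    | mem z hz =>
      obtain ⟨M, hM | hM, rfl⟩ := hz
      · rw [h.inflOmega_defl F hFA hM, h.defl_eq_zero hM, map_zero, add_zero]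
      · rw [h.symm.inflOmega_defl F hFB hM, h.symm.defl_eq_zero hM, map_zero, zero_add]
    | zero => simp only [map_zero, add_zero]
    | neg x _ hx => simp only [map_neg, ← hx]; abel
    | add x y _ _ hx hy => simp only [map_add, ← hx, ← hy]; abel
  -- The final `1` makes the class split, `s + t + 1` carries it into `F`, and `r` is the stationary
  -- exponent on `F`.
  refine IgusaTodorov.phiDim_lt_top (d := r + (s + t + 1) + 1) fun z n hn => ?_
  have hz := h.omegaBar_mem_splitSubgroup z
  rw [Function.iterate_succ_apply]
  replace hn : (omegaBar R)^[n] (omegaBar R z) = 0 := by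
    rw [← Function.iterate_succ_apply, Function.iterate_succ_apply', hn, map_zero]
  generalize omegaBar R z = z at hz hn ⊢
  -- Vanishing over `R` after `n` steps gives vanishing over `S` after `n + b` steps, and then after
  -- `s` steps, with `s` independent of `z` and `n`.
  have h1 : (omegaBar S)^[s] (K0.defl p z) = 0 := by
    refine hs _ (n + b) ?_
    rw [← h.iterate_defl_iterate hb n hz, hn, map_zero, iterate_map_zero]
  have h2 : (omegaBar T)^[t] (K0.defl q z) = 0 := by
    refine ht _ (n + a) ?_
    rw [← h.symm.iterate_defl_iterate ha n (hsplit ▸ hz), hn, map_zero, iterate_map_zero]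
  -- Modulo `F`, one Ω̄ writes the class as a sum of two images under `inflOmega`; the exponent `s +
  -- t` is large enough to kill both.
  have hmem : (omegaBar R)^[s + t + 1] z ∈ F := by
    rw [← QuotientAddGroup.eq_zero_iff, Function.iterate_succ_apply]
    have hcomm : ∀ (m : ℕ) (y : K0 R), QuotientAddGroup.mk' F ((omegaBar R)^[m] y) =
        (omegaQuot F hF')^[m] (QuotientAddGroup.mk' F y) := by
      intro m
      induction m with
      | zero => intro y; rfl
      | succ m ih => intro y; rw [Function.iterate_succ_apply, ih]; rfl
    refine (hcomm _ _).trans ?_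
    rw [← key z hz, iterate_map_add, ← h.inflOmega_iterate F hFA hF',
      ← h.symm.inflOmega_iterate F hFB hF', Function.iterate_add_apply (omegaBar T),
      h2, add_comm s t, Function.iterate_add_apply (omegaBar S), h1]
    simp only [iterate_map_zero, map_zero, add_zero]
  rw [Function.iterate_add_apply]
  refine hr _ hmem n ?_
  rw [← Function.iterate_add_apply, add_comm, Function.iterate_add_apply, hn, iterate_map_zero]

end IsGluing

end IgusaTodorov

namespace IgusaTodorov

open Quiver

/-! ### The arrow ideal of a bound quiver algebra and the local rings at its vertices. -/

section BoundQuiver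

variable {k V : Type u} [Field k] [Quiver.{u} V] [Fintype V] [DecidableEq V]

namespace PathAlgebra

theorem ofPath_mul_ofPath_of_ne {a b c d : V} (p : Path a b) (q : Path c d) (h : b ≠ c) :
    (ofPath p * ofPath q : PathAlgebra k V) = 0 := by
  ext1 a' d'
  rw [mul_apply, zero_apply]
  refine Finset.sum_eq_zero fun b' _ => ?_
  by_cases hb : b' = b
  · subst hb
    simp [ofPath, Pi.single_eq_of_ne h]
  · by_cases ha : a' = a
    · subst ha
      simp [ofPath, Pi.single_eq_of_ne hb]
    · simp [ofPath, Pi.single_eq_of_ne ha]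

theorem vertex_mul_ofPath {a b : V} (p : Path a b) : vertex k a * ofPath p = ofPath p := by
  rw [vertex, ofPath_mul_ofPath, Path.nil_comp]

theorem ofPath_mul_vertex {a b : V} (p : Path a b) : ofPath p * vertex k b = ofPath p := by
  rw [vertex, ofPath_mul_ofPath, Path.comp_nil]

theorem ofPath_cons {a b c : V} (p : Path a b) (g : b ⟶ c) :
    (ofPath (p.cons g) : PathAlgebra k V) = ofPath p * arrow k g := by
  rw [arrow, ofPath_mul_ofPath]
  rfl

theorem induction {P : PathAlgebra k V → Prop}
    (path : ∀ (a b : V) (p : Path a b), P (ofPath p : PathAlgebra k V)) (zero : P 0)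
    (add : ∀ x y, P x → P y → P (x + y)) (smul : ∀ (r : k) x, P x → P (r • x))
    (x : PathAlgebra k V) : P x := by
  have hx : x ∈ Submodule.span k {x : PathAlgebra k V | ∃ (a b : V) (p : Path a b),
      x = ofPath p} := by
    rw [span_ofPath]
    exact Submodule.mem_top
  induction hx using Submodule.span_induction with
  | mem x h =>
    obtain ⟨a, b, p, rfl⟩ := h
    exact path a b p
  | zero => exact zero
  | add x y _ _ hx hy => exact add x y hx hy
  | smul r x _ hx => exact smul r x hx

end PathAlgebra

namespace BoundQuiverAlgebra

open PathAlgebra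

variable (I : TwoSidedIdeal (PathAlgebra k V))

theorem mk_surjective : Function.Surjective (mk I) := I.ringCon.mkₐ_surjective (α := k)

variable {I} in
theorem mk_eq_zero_iff {x : PathAlgebra k V} : mk I x = 0 ↔ x ∈ I := RingCon.eq _

/-- The subspace of a bound quiver algebra spanned by the paths of length at least `n`. -/
def pathPow (n : ℕ) : Submodule k (BoundQuiverAlgebra I) :=
  Submodule.span k {x | ∃ (a b : V) (p : Path a b), n ≤ p.length ∧ x = mk I (ofPath p)}

variable {I}

theorem mk_ofPath_mem_pathPow {n : ℕ} {a b : V} (p : Path a b) (hp : n ≤ p.length) :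
    mk I (ofPath p) ∈ pathPow I n :=
  Submodule.subset_span ⟨a, b, p, hp, rfl⟩

theorem mem_pathPow_zero (x : BoundQuiverAlgebra I) : x ∈ pathPow I 0 := by
  obtain ⟨x, rfl⟩ := mk_surjective I x
  induction x using PathAlgebra.induction with
  | path a b p => exact mk_ofPath_mem_pathPow p (Nat.zero_le _)
  | zero => rw [map_zero]; exact zero_mem _
  | add x y hx hy => rw [map_add]; exact add_mem hx hy
  | smul r x hx => rw [map_smul]; exact Submodule.smul_mem _ r hx

theorem mul_mem_pathPow {m n : ℕ} {x y : BoundQuiverAlgebra I} (hx : x ∈ pathPow I m)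
    (hy : y ∈ pathPow I n) : x * y ∈ pathPow I (m + n) := by
  have h : pathPow I m * pathPow I n ≤ pathPow I (m + n) := by
    rw [pathPow, pathPow, Submodule.span_mul_span, Submodule.span_le]
    rintro _ ⟨_, ⟨a, b, p, hp, rfl⟩, _, ⟨c, d, q, hq, rfl⟩, rfl⟩
    change mk I (ofPath p) * mk I (ofPath q) ∈ _
    rw [← map_mul]
    by_cases hbc : b = c
    · subst hbc
      rw [ofPath_mul_ofPath]
      exact mk_ofPath_mem_pathPow _ (by rw [Path.length_comp]; omega)
    · rw [ofPath_mul_ofPath_of_ne p q hbc, map_zero]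
      exact zero_mem _
  exact h (Submodule.mul_mem_mul hx hy)

theorem mul_mem_pathPow_left {n : ℕ} (x : BoundQuiverAlgebra I) {y : BoundQuiverAlgebra I}
    (hy : y ∈ pathPow I n) : x * y ∈ pathPow I n :=
  zero_add n ▸ mul_mem_pathPow (mem_pathPow_zero x) hy

theorem mul_mem_pathPow_right {n : ℕ} {x : BoundQuiverAlgebra I} (y : BoundQuiverAlgebra I)
    (hx : x ∈ pathPow I n) : x * y ∈ pathPow I n :=
  mul_mem_pathPow (n := 0) hx (mem_pathPow_zero y)

theorem pow_mem_pathPow {x : BoundQuiverAlgebra I} (hx : x ∈ pathPow I 1) (n : ℕ) :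
    x ^ n ∈ pathPow I n := by
  induction n with
  | zero => exact mem_pathPow_zero _
  | succ n ih => rw [pow_succ]; exact mul_mem_pathPow ih hx

theorem isNilpotent_of_mem_pathPow [hI : IsAdmissible I] {x : BoundQuiverAlgebra I}
    (hx : x ∈ pathPow I 1) : IsNilpotent x := by
  obtain ⟨m, -, hm⟩ := hI.exists_pow_le
  refine ⟨m, ?_⟩
  have hbot : pathPow I m = ⊥ := by
    rw [pathPow, Submodule.span_eq_bot]
    rintro _ ⟨a, b, p, hp, rfl⟩
    exact mk_eq_zero (ofPath_mem_of_le_length hm p hp)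
  simpa [hbot] using pow_mem_pathPow hx m

theorem mk_arrow_mem_pathPow {a b : V} (g : a ⟶ b) : mk I (arrow k g) ∈ pathPow I 1 :=
  mk_ofPath_mem_pathPow _ le_rfl

/-- An element annihilated by all arrows from the left is annihilated by the arrow ideal. -/
theorem mul_eq_zero_of_mem_pathPow {c j : BoundQuiverAlgebra I}
    (hc : ∀ (a b : V) (g : a ⟶ b), mk I (arrow k g) * c = 0) (hj : j ∈ pathPow I 1) :
    j * c = 0 := by
  induction hj using Submodule.span_induction with
  | mem x h =>
    obtain ⟨a, b, p, hp, rfl⟩ := h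
    cases p with
    | nil => simp at hp
    | cons p g => rw [ofPath_cons, map_mul, mul_assoc, hc, mul_zero]
  | zero => rw [zero_mul]
  | add x y _ _ hx hy => rw [add_mul, hx, hy, add_zero]
  | smul r x _ hx => rw [smul_mul_assoc, hx, smul_zero]

/-- Modulo paths of positive length only trivial paths remain, and `e_v` picks out the multiple of
itself. -/
theorem exists_vertex_mul_sub_mem (v : V) (x : BoundQuiverAlgebra I) :
    ∃ r : k, mk I (vertex k v) * x - r • mk I (vertex k v) ∈ pathPow I 1 := by
  obtain ⟨x, rfl⟩ := mk_surjective I x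
  induction x using PathAlgebra.induction with
  | zero => exact ⟨0, by rw [map_zero, mul_zero, zero_smul, sub_zero]; exact zero_mem _⟩
  | path a b p =>
    by_cases hp : 1 ≤ p.length
    · exact ⟨0, by
        rw [zero_smul, sub_zero]
        exact mul_mem_pathPow_left _ (mk_ofPath_mem_pathPow p hp)⟩
    · cases p with
      | nil =>
        by_cases h : v = a
        · subst h
          refine ⟨1, ?_⟩
          rw [one_smul, ← map_mul, vertex_mul_ofPath, vertex, sub_self]
          exact zero_mem _
        · refine ⟨0, ?_⟩
          rw [zero_smul, sub_zero, ← map_mul, vertex, ofPath_mul_ofPath_of_ne _ _ h, map_zero]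
          exact zero_mem _
      | cons p g => simp at hp
  | add x y hx hy =>
    obtain ⟨r, hr⟩ := hx
    obtain ⟨s, hs⟩ := hy
    refine ⟨r + s, ?_⟩
    rw [map_add, mul_add, add_smul, add_sub_add_comm]
    exact add_mem hr hs
  | smul s x hx =>
    obtain ⟨r, hr⟩ := hx
    refine ⟨s * r, ?_⟩
    rw [map_smul, mul_smul_comm, mul_smul, ← smul_sub]
    exact Submodule.smul_mem _ s hr

theorem vertex_mul_vertex (v : V) :
    mk I (vertex k v) * mk I (vertex k v) = mk I (vertex k v) := by
  rw [← map_mul]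
  exact congrArg _ (ofPath_mul_vertex Path.nil)

/-- The rings `e_v C e_v` are local. -/
theorem vertex_local [IsAdmissible I] (v : V) (x : BoundQuiverAlgebra I) :
    mk I (vertex k v) * x ∈ pathPow I 1 ∨
      ∃ y, mk I (vertex k v) * x * y = mk I (vertex k v) := by
  obtain ⟨r, hr⟩ := exists_vertex_mul_sub_mem v x
  by_cases h0 : r = 0
  · left
    rwa [h0, zero_smul, sub_zero] at hr
  · right
    set ε := mk I (vertex k v) with hε
    -- A nonzero scalar plus a nilpotent element is a unit; multiplied by `e_v` on the left, it
    -- becomes `e_v x`.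
    have hu : IsUnit (ε * x - r • ε + algebraMap k _ r) :=
      (isNilpotent_of_mem_pathPow hr).isUnit_add_right_of_commute
        ((isUnit_iff_ne_zero.2 h0).map (algebraMap k _)) (Algebra.commutes r _).symm
    obtain ⟨y, hy⟩ := hu.exists_right_inv
    refine ⟨y, ?_⟩
    have h1 : ε * x = ε * (ε * x - r • ε + algebraMap k _ r) := by
      rw [mul_add, mul_sub, ← mul_assoc, vertex_mul_vertex, mul_smul_comm, vertex_mul_vertex,
        ← Algebra.commutes, ← Algebra.smul_def, sub_add_cancel]
    rw [h1, mul_assoc, hy, mul_one]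

end BoundQuiverAlgebra

end BoundQuiver

/-! ### Corners of a ring as quotients. -/

section Corner

variable {A C : Type u} [Ring A] [Ring C] (ι : A →ₙ+* C) (hι : Function.Injective ι)
  (hcorner : ∀ c, ∃ a, ι a = ι 1 * c * ι 1)
  (hzero : ∀ c c', ι 1 * c * (1 - ι 1) * (c' * ι 1) = 0)

include hcorner in
/-- If `A` is identified with a corner `e C e` such that `e C (1 - e) C e = 0`, then `c ↦ e c e` is a
ring homomorphism. -/
def cornerHom : C →+* A where
  toFun c := (hcorner c).choose
  map_one' := hι (by rw [(hcorner 1).choose_spec, mul_one, ← map_mul, one_mul])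
  map_zero' := hι (by rw [(hcorner 0).choose_spec, mul_zero, zero_mul, map_zero])
  map_add' c c' := hι (by
    rw [map_add, (hcorner _).choose_spec, (hcorner _).choose_spec, (hcorner _).choose_spec,
      mul_add, add_mul])
  map_mul' c c' := hι (by
    rw [map_mul, (hcorner _).choose_spec, (hcorner _).choose_spec, (hcorner _).choose_spec]
    -- The hypothesis allows the idempotent to be inserted between `c` and `c'`, which is all that
    -- multiplicativity requires.
    have h1 := hzero c c'
    have h2 : ι 1 * ι 1 = ι 1 := by rw [← map_mul, one_mul]
    rw [mul_sub, sub_mul, mul_one, sub_eq_zero] at h1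
    calc ι 1 * (c * c') * ι 1 = ι 1 * c * (c' * ι 1) := by simp only [mul_assoc]
      _ = _ := h1
      _ = ι 1 * c * (ι 1 * ι 1) * (c' * ι 1) := by rw [h2]
      _ = _ := by simp only [mul_assoc])

theorem cornerHom_spec (c : C) : ι (cornerHom ι hι hcorner hzero c) = ι 1 * c * ι 1 :=
  (hcorner c).choose_spec

end Corner

end IgusaTodorov

/-! ### Glued algebras as gluings of opposite rings. -/

namespace IgusaTodorov

open Quiver

/-- The images in a glued algebra `C` of the two path algebras and of the new arrows, together with
the ideal generated by the arrows. -/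
structure GluedAlgebra {k VA VB : Type u} [Field k] [Fintype VA] [DecidableEq VA] [Fintype VB]
    [DecidableEq VB] [Quiver.{u} VA] [Quiver.{u} VB] (J : VA → VB → Type u) (K : VB → VA → Type u)
    (C : Type u) [Ring C] [Algebra k C] where
  toA : PathAlgebra k VA →ₙₐ[k] C
  toB : PathAlgebra k VB →ₙₐ[k] C
  toJ : ∀ {a b}, J a b → C
  toK : ∀ {b a}, K b a → C
  rad : Submodule k C
  toA_mul_toB : ∀ x y, toA x * toB y = 0
  toB_mul_toA : ∀ y x, toB y * toA x = 0
  add_one : toA 1 + toB 1 = 1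
  one_mul_toJ : ∀ {a b} (x : J a b), toA 1 * toJ x = toJ x
  toJ_mul_one : ∀ {a b} (x : J a b), toJ x * toB 1 = toJ x
  one_mul_toK : ∀ {b a} (y : K b a), toB 1 * toK y = toK y
  toK_mul_one : ∀ {b a} (y : K b a), toK y * toA 1 = toK y
  mul_mem_rad_left : ∀ c j, j ∈ rad → c * j ∈ rad
  mul_mem_rad_right : ∀ c j, j ∈ rad → j * c ∈ rad
  isNilpotent_of_mem_rad : ∀ j, j ∈ rad → IsNilpotent j
  toJ_mem_rad : ∀ {a b} (x : J a b), toJ x ∈ rad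
  toK_mem_rad : ∀ {b a} (y : K b a), toK y ∈ rad
  rad_mul_toJ : ∀ j, j ∈ rad → ∀ {a b} (x : J a b), j * toJ x = 0
  rad_mul_toK : ∀ j, j ∈ rad → ∀ {b a} (y : K b a), j * toK y = 0
  eq_top : ∀ W : Submodule k C, (∀ x, toA x ∈ W) → (∀ y, toB y ∈ W) →
    (∀ {a b} (x : J a b) y, toJ x * toB y ∈ W) → (∀ {b a} (y : K b a) x, toK y * toA x ∈ W) →
    ∀ c, c ∈ W
  local_toA : ∀ v c, toA (PathAlgebra.vertex k v) * c ∈ rad ∨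
    ∃ y, toA (PathAlgebra.vertex k v) * c * y = toA (PathAlgebra.vertex k v)
  local_toB : ∀ v c, toB (PathAlgebra.vertex k v) * c ∈ rad ∨
    ∃ y, toB (PathAlgebra.vertex k v) * c * y = toB (PathAlgebra.vertex k v)

namespace GluedAlgebra

variable {k VA VB : Type u} [Field k] [Fintype VA] [DecidableEq VA] [Fintype VB]
    [DecidableEq VB] [Quiver.{u} VA] [Quiver.{u} VB] {J : VA → VB → Type u} {K : VB → VA → Type u}
    {C : Type u} [Ring C] [Algebra k C] (G : GluedAlgebra (k := k) J K C)

/-- The same glued algebra with the roles of the two quivers exchanged. -/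
abbrev symm : GluedAlgebra (k := k) K J C where
  toA := G.toB
  toB := G.toA
  toJ := G.toK
  toK := G.toJ
  rad := G.rad
  toA_mul_toB := G.toB_mul_toA
  toB_mul_toA := G.toA_mul_toB
  add_one := (add_comm _ _).trans G.add_one
  one_mul_toJ := G.one_mul_toK
  toJ_mul_one := G.toK_mul_one
  one_mul_toK := G.one_mul_toJ
  toK_mul_one := G.toJ_mul_one
  mul_mem_rad_left := G.mul_mem_rad_left
  mul_mem_rad_right := G.mul_mem_rad_right
  isNilpotent_of_mem_rad := G.isNilpotent_of_mem_rad
  toJ_mem_rad := G.toK_mem_rad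
  toK_mem_rad := G.toJ_mem_rad
  rad_mul_toJ := G.rad_mul_toK
  rad_mul_toK := G.rad_mul_toJ
  eq_top := fun W hA hB hJ hK => G.eq_top W hB hA hK hJ
  local_toA := G.local_toB
  local_toB := G.local_toA

/-- The sum of the vertices of the first quiver. -/
abbrev idemA : C := G.toA 1

/-- The sum of the vertices of the second quiver. -/
abbrev idemB : C := G.toB 1

theorem idemA_mul_toA (x : PathAlgebra k VA) : G.idemA * G.toA x = G.toA x := by
  rw [← map_mul, one_mul]

theorem toA_mul_idemA (x : PathAlgebra k VA) : G.toA x * G.idemA = G.toA x := by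
  rw [← map_mul, mul_one]

theorem idemA_mul_toK {b : VB} {a : VA} (y : K b a) : G.idemA * G.toK y = 0 := by
  rw [← G.one_mul_toK, ← mul_assoc, G.toA_mul_toB, zero_mul]

/-- Among the spanning products of `eq_top`, only those from the first quiver have both ends on its
side. Hence the corner at `idemA` is the image of the first path algebra. -/
theorem exists_toA_eq (c : C) : ∃ x, G.toA x = G.idemA * c * G.idemA := by
  refine G.eq_top (Submodule.comap (LinearMap.mulRight k G.idemA ∘ₗ LinearMap.mulLeft k G.idemA)
    (LinearMap.range (G.toA : PathAlgebra k VA →ₗ[k] C))) (fun x => ?_) (fun y => ?_)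
    (fun x y => ?_) (fun y x => ?_) c
  · exact ⟨x, by simp [idemA_mul_toA, toA_mul_idemA]⟩
  · exact ⟨0, by simp [toA_mul_toB]⟩
  · exact ⟨0, by simp [mul_assoc, toB_mul_toA]⟩
  · exact ⟨0, by simp [← mul_assoc, idemA_mul_toK]⟩

theorem idemA_mul_idemB_mem (c : C) : G.idemA * c * G.idemB ∈ G.rad := by
  refine G.eq_top (Submodule.comap (LinearMap.mulRight k G.idemB ∘ₗ LinearMap.mulLeft k G.idemA)
    G.rad) (fun x => ?_) (fun y => ?_) (fun x y => ?_) (fun y x => ?_) c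
  · simp [mul_assoc, toA_mul_toB]
  · simp [toA_mul_toB]
  · exact G.mul_mem_rad_right _ _ (G.mul_mem_rad_left _ _ (G.mul_mem_rad_right _ _
      (G.toJ_mem_rad x)))
  · simp [← mul_assoc, idemA_mul_toK]

/-- Everything from the first side to the second begins with a new arrow, and a radical element in
front of a new arrow gives zero. -/
theorem rad_mul_idemA_mul_idemB {j : C} (hj : j ∈ G.rad) (c : C) :
    j * (G.idemA * c * G.idemB) = 0 := by
  refine G.eq_top (LinearMap.ker (LinearMap.mulLeft k j ∘ₗ LinearMap.mulRight k G.idemB ∘ₗ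
    LinearMap.mulLeft k G.idemA)) (fun x => ?_) (fun y => ?_) (fun x y => ?_) (fun y x => ?_) c
  · simp [mul_assoc, toA_mul_toB]
  · simp [toA_mul_toB]
  · simp [← mul_assoc, G.one_mul_toJ, G.rad_mul_toJ j hj]
  · simp [← mul_assoc, idemA_mul_toK]

theorem idemB_eq : G.idemB = 1 - G.idemA := by
  rw [← G.add_one, add_sub_cancel_left]

section Quotient

variable {IA : TwoSidedIdeal (PathAlgebra k VA)} (hA : ∀ x, G.toA x = 0 ↔ x ∈ IA)

include hA in
theorem toA_eq_iff (x y : PathAlgebra k VA) :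
    G.toA x = G.toA y ↔ BoundQuiverAlgebra.mk IA x = BoundQuiverAlgebra.mk IA y := by
  rw [← sub_eq_zero, ← map_sub, hA, ← sub_eq_zero (a := BoundQuiverAlgebra.mk IA x), ← map_sub,
    BoundQuiverAlgebra.mk_eq_zero_iff]

include hA in
theorem toA_surjInv (x : PathAlgebra k VA) :
    G.toA (Function.surjInv (BoundQuiverAlgebra.mk_surjective IA) (BoundQuiverAlgebra.mk IA x)) =
      G.toA x :=
  (G.toA_eq_iff hA _ _).2 (Function.surjInv_eq (BoundQuiverAlgebra.mk_surjective IA) _)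

/-- The embedding of the first algebra into the glued algebra. -/
def embA : BoundQuiverAlgebra IA →ₙ+* C where
  toFun a := G.toA (Function.surjInv (BoundQuiverAlgebra.mk_surjective IA) a)
  map_mul' a b := by
    obtain ⟨x, rfl⟩ := BoundQuiverAlgebra.mk_surjective IA a
    obtain ⟨y, rfl⟩ := BoundQuiverAlgebra.mk_surjective IA b
    rw [← map_mul, G.toA_surjInv hA, G.toA_surjInv hA, G.toA_surjInv hA, map_mul]
  map_zero' := by
    rw [← map_zero (BoundQuiverAlgebra.mk IA), G.toA_surjInv hA, map_zero]
  map_add' a b := by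
    obtain ⟨x, rfl⟩ := BoundQuiverAlgebra.mk_surjective IA a
    obtain ⟨y, rfl⟩ := BoundQuiverAlgebra.mk_surjective IA b
    rw [← map_add, G.toA_surjInv hA, G.toA_surjInv hA, G.toA_surjInv hA, map_add]

theorem embA_mk (x : PathAlgebra k VA) : G.embA hA (BoundQuiverAlgebra.mk IA x) = G.toA x :=
  G.toA_surjInv hA x

theorem embA_one : G.embA hA 1 = G.idemA := by
  rw [← map_one (BoundQuiverAlgebra.mk IA), embA_mk]

theorem embA_injective : Function.Injective (G.embA hA) := by
  intro a b hab
  obtain ⟨x, rfl⟩ := BoundQuiverAlgebra.mk_surjective IA a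
  obtain ⟨y, rfl⟩ := BoundQuiverAlgebra.mk_surjective IA b
  rwa [embA_mk, embA_mk, G.toA_eq_iff hA] at hab

/-- The projection of the glued algebra onto the first algebra. -/
def projA : C →+* BoundQuiverAlgebra IA :=
  cornerHom (G.embA hA) (G.embA_injective hA)
    (fun c => by
      obtain ⟨x, hx⟩ := G.exists_toA_eq c
      exact ⟨BoundQuiverAlgebra.mk IA x, by rw [embA_mk, embA_one, hx]⟩)
    (fun c c' => by
      rw [embA_one, ← idemB_eq]
      -- Crossing to the second side and back gives zero: the first crossing lies in the radical,
      -- which annihilates the second crossing.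
      have h1 := G.symm.rad_mul_idemA_mul_idemB (G.idemA_mul_idemB_mem c) c'
      have h2 : G.idemB * G.idemB = G.idemB := G.symm.idemA_mul_toA 1
      change G.idemA * c * G.idemB * (G.idemB * c' * G.idemA) = 0 at h1
      rwa [mul_assoc G.idemB, ← mul_assoc _ G.idemB, mul_assoc _ G.idemB G.idemB, h2] at h1)

theorem embA_projA (c : C) : G.embA hA (G.projA hA c) = G.idemA * c * G.idemA := by
  rw [projA, cornerHom_spec, embA_one]

theorem projA_eq_mk {c : C} {x : PathAlgebra k VA} (hx : G.toA x = G.idemA * c * G.idemA) :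
    G.projA hA c = BoundQuiverAlgebra.mk IA x :=
  G.embA_injective hA (by rw [embA_projA, embA_mk, hx])

theorem projA_surjective : Function.Surjective (G.projA hA) := by
  intro a
  obtain ⟨x, rfl⟩ := BoundQuiverAlgebra.mk_surjective IA a
  exact ⟨G.toA x, G.projA_eq_mk hA (by rw [idemA_mul_toA, toA_mul_idemA])⟩

theorem projA_idemB : G.projA hA G.idemB = 0 := by
  rw [G.projA_eq_mk hA (x := 0), map_zero]
  rw [G.toA_mul_toB, zero_mul, map_zero]

/-- The projection onto the first algebra, as a homomorphism of the opposite rings. -/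
def projOpA : Cᵐᵒᵖ →+* (BoundQuiverAlgebra IA)ᵐᵒᵖ := RingHom.op (G.projA hA)

instance : RingHomSurjective (G.projOpA hA) where
  is_surjective a := by
    obtain ⟨c, hc⟩ := G.projA_surjective hA a.unop
    exact ⟨MulOpposite.op c, MulOpposite.unop_injective hc⟩

end Quotient

open MulOpposite

/-- The ideal generated by the arrows, as a left ideal of the opposite ring. -/
def radOp : Ideal Cᵐᵒᵖ where
  carrier := {c | c.unop ∈ G.rad}
  add_mem' hx hy := add_mem (S := Submodule k C) hx hy
  zero_mem' := G.rad.zero_mem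
  smul_mem' c j hj := G.mul_mem_rad_right c.unop j.unop hj

theorem mem_radOp {c : Cᵐᵒᵖ} : c ∈ G.radOp ↔ c.unop ∈ G.rad := Iff.rfl

/-- A nil one-sided ideal lies in the Jacobson radical, since 1 plus a nilpotent element is a unit.
-/
theorem radOp_le_jacobson : G.radOp ≤ Ring.jacobson Cᵐᵒᵖ := by
  rw [← Ideal.jacobson_bot]
  intro j hj
  rw [Ideal.mem_jacobson_iff]
  intro y
  have hnil : IsNilpotent (y * j) := by
    obtain ⟨n, hn⟩ := G.isNilpotent_of_mem_rad _ (G.radOp.mul_mem_left y hj)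
    exact ⟨n, unop_injective hn⟩
  obtain ⟨z, hz⟩ := hnil.isUnit_one_add.exists_left_inv
  refine ⟨z, ?_⟩
  rw [mul_add, mul_one] at hz
  rw [mul_assoc, add_comm, hz, sub_self]
  exact zero_mem _

theorem sum_vertex : ∑ v, G.toA (PathAlgebra.vertex k v) = G.idemA := by
  rw [← map_sum, ← PathAlgebra.one_def]

theorem vertex_idem (v : VA) : G.toA (PathAlgebra.vertex k v) * G.toA (PathAlgebra.vertex k v) =
    G.toA (PathAlgebra.vertex k v) := by
  rw [← map_mul]
  exact congrArg _ (PathAlgebra.ofPath_mul_vertex Path.nil)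

theorem isGluing {IA : TwoSidedIdeal (PathAlgebra k VA)} (hA : ∀ x, G.toA x = 0 ↔ x ∈ IA)
    {IB : TwoSidedIdeal (PathAlgebra k VB)} (hB : ∀ x, G.toB x = 0 ↔ x ∈ IB) :
    IsGluing (G.projOpA hA) (G.symm.projOpA hB) G.radOp (op G.idemA) (op G.idemB)
      (fun v : VA => op (G.toA (PathAlgebra.vertex k v)))
      (fun v : VB => op (G.toB (PathAlgebra.vertex k v))) where
  add_eq := congrArg op G.add_one
  e_mul_e := congrArg op (G.idemA_mul_toA 1)
  f_mul_f := congrArg op (G.symm.idemA_mul_toA 1)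
  map_f := congrArg op (G.projA_idemB hA)
  map_e := congrArg op (G.symm.projA_idemB hB)
  corner_p x hx := unop_injective (by
    have h1 : G.projA hA x.unop = 0 := congrArg unop hx
    have h2 := G.embA_projA hA x.unop
    rw [h1, map_zero, mul_assoc] at h2
    exact h2.symm)
  corner_q x hx := unop_injective (by
    have h1 : G.symm.projA hB x.unop = 0 := congrArg unop hx
    have h2 := G.symm.embA_projA hB x.unop
    rw [h1, map_zero, mul_assoc] at h2
    exact h2.symm)
  -- Multiplication is reversed: `e * x * f` in the opposite ring is the corner from the second side
  -- to the first in `C`, hence the exchanged roles.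
  mem_ef x := by
    rw [mem_radOp, unop_mul, unop_mul, ← mul_assoc]
    exact G.symm.idemA_mul_idemB_mem x.unop
  mem_fe x := by
    rw [mem_radOp, unop_mul, unop_mul, ← mul_assoc]
    exact G.idemA_mul_idemB_mem x.unop
  fe_mul x j hj := unop_injective (by
    rw [unop_mul, unop_mul, unop_mul, mul_assoc, ← mul_assoc (unop (op G.idemA))]
    exact G.rad_mul_idemA_mul_idemB hj x.unop)
  ef_mul x j hj := unop_injective (by
    rw [unop_mul, unop_mul, unop_mul, mul_assoc, ← mul_assoc (unop (op G.idemB))]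
    exact G.symm.rad_mul_idemA_mul_idemB hj x.unop)
  le_jacobson := G.radOp_le_jacobson
  ε_idem v := congrArg op (G.vertex_idem v)
  δ_idem v := congrArg op (G.symm.vertex_idem v)
  ε_mul v := congrArg op (G.idemA_mul_toA _)
  δ_mul v := congrArg op (G.symm.idemA_mul_toA _)
  sum_eq := by
    rw [← Finset.op_sum, ← Finset.op_sum, G.sum_vertex]
    exact congrArg op ((congrArg _ G.symm.sum_vertex).trans G.add_one)
  ε_local v a := (G.local_toA v a.unop).imp id fun ⟨y, hy⟩ => ⟨op y, congrArg op hy⟩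
  δ_local v a := (G.local_toB v a.unop).imp id fun ⟨y, hy⟩ => ⟨op y, congrArg op hy⟩

/-- A module on which `C` acts through the first algebra is an inflation. -/
def inflEquiv {IA : TwoSidedIdeal (PathAlgebra k VA)} (hA : ∀ x, G.toA x = 0 ↔ x ∈ IA)
    {M M' : Type u} [AddCommGroup M] [Module (BoundQuiverAlgebra IA)ᵐᵒᵖ M] [AddCommGroup M']
    [Module Cᵐᵒᵖ M'] (e : M ≃+ M') (he : ∀ (x : PathAlgebra k VA) (m : M),
      e (op (BoundQuiverAlgebra.mk IA x) • m) = op (G.toA x) • e m) :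
    M' ≃ₗ[Cᵐᵒᵖ] Infl (G.projOpA hA) M :=
  LinearEquiv.symm
    { e with
      map_smul' := fun r m => by
        -- The compatibility hypothesis applied to 1 shows that `idemA` acts as the identity on
        -- `M'`, so each `r` acts through its corner.
        have h1 : ∀ n : M', op G.idemA • n = n := fun n => by
          obtain ⟨m, rfl⟩ := e.surjective n
          rw [← he, map_one, op_one, one_smul]
        obtain ⟨x, hx⟩ := G.exists_toA_eq r.unop
        have h2 : G.projOpA hA r = op (BoundQuiverAlgebra.mk IA x) :=
          congrArg op (G.projA_eq_mk hA hx)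
        change e (G.projOpA hA r • (toInfl _ M).symm m) = r • e ((toInfl _ M).symm m)
        rw [h2, he, hx, op_mul, op_mul, op_unop, mul_smul, mul_smul, h1, h1] }

end GluedAlgebra

end IgusaTodorov

/-! ### Paths of the glued quiver modulo the gluing relations. -/

namespace IgusaTodorov

open Quiver PathAlgebra

namespace PathAlgebra

variable {k V W : Type u} [Field k] [Quiver.{u} V] [Quiver.{u} W]

section

variable [DecidableEq V]

theorem ofPath_apply_self {a b : V} (p : Path a b) :
    (ofPath p : PathAlgebra k V) a b = Finsupp.single p 1 := by
  simp [ofPath]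

theorem ofPath_apply_of_ne_left {a b c : V} (p : Path a b) (h : a ≠ c) (d : V) :
    (ofPath p : PathAlgebra k V) c d = 0 := by
  simp [ofPath, Pi.single_eq_of_ne h.symm]

theorem ofPath_apply_of_ne_right {a b d : V} (p : Path a b) (c : V) (h : b ≠ d) :
    (ofPath p : PathAlgebra k V) c d = 0 := by
  by_cases h' : a = c
  · subst h'
    simp [ofPath, Pi.single_eq_of_ne h.symm]
  · exact ofPath_apply_of_ne_left p h' d

end

theorem compₗ_mapDomain (F : V ⥤q W) {a b c : V} (x : Path a b →₀ k) (y : Path b c →₀ k) :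
    compₗ (F.obj a) (F.obj b) (F.obj c) (x.mapDomain F.mapPath) (y.mapDomain F.mapPath) =
      (compₗ a b c x y).mapDomain F.mapPath := by
  induction x using Finsupp.induction_linear with
  | zero => simp
  | add x x' hx hx' => simp only [Finsupp.mapDomain_add, map_add, LinearMap.add_apply, hx, hx']
  | single p r =>
    induction y using Finsupp.induction_linear with
    | zero => simp
    | add y y' hy hy' => simp only [Finsupp.mapDomain_add, map_add, hy, hy']
    | single q s => simp only [Finsupp.mapDomain_single, compₗ_single, Prefunctor.mapPath_comp]

end PathAlgebra

namespace GluedQuiver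

variable {k VA VB : Type u} [Field k] [Quiver.{u} VA] [Quiver.{u} VB]
  {J : VA → VB → Type u} {K : VB → VA → Type u}
  [Fintype VA] [Fintype VB] [DecidableEq VA] [DecidableEq VB]

theorem sum_eq {M : Type*} [AddCommMonoid M] (g : GluedQuiver J K → M) :
    ∑ v, g v = ∑ a, g (inl a) + ∑ b, g (inr b) :=
  Fintype.sum_sum_type g

variable (k J K) in
/-- The inclusion of the path algebra of the first quiver as an algebra homomorphism. -/
def extAHom : PathAlgebra k VA →ₙₐ[k] PathAlgebra k (GluedQuiver J K) where
  toFun := extA J K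
  map_smul' c x := by
    ext1 v w
    rcases v with a | b <;> rcases w with a' | b'
    · exact Finsupp.mapDomain_smul c (x a a')
    all_goals exact (smul_zero c).symm
  map_zero' := by
    ext1 v w
    rcases v with a | b <;> rcases w with a' | b'
    · exact Finsupp.mapDomain_zero
    all_goals rfl
  map_add' x y := by
    ext1 v w
    rcases v with a | b <;> rcases w with a' | b'
    · exact Finsupp.mapDomain_add
    all_goals exact (add_zero 0).symm
  map_mul' x y := by
    ext1 v w
    rw [mul_apply, sum_eq]
    rcases v with a | b <;> rcases w with a' | b'
    · have h1 : ∀ b : VB, compₗ (k := k) (inl a : GluedQuiver J K) (inr b) (inl a')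
          (extA J K x (inl a) (inr b)) (extA J K y (inr b) (inl a')) = 0 := fun b => by
        rw [show extA J K x (inl a) (inr b) = 0 from rfl, map_zero, LinearMap.zero_apply]
      rw [Finset.sum_congr rfl fun b _ => h1 b, Finset.sum_const_zero, add_zero]
      exact (congrArg (Finsupp.mapDomain (inclA J K).mapPath) (mul_apply x y a a')).trans
        ((Finsupp.mapDomain_finsetSum).trans
          (Finset.sum_congr rfl fun _ _ => (compₗ_mapDomain (inclA J K) _ _).symm))
    · refine Eq.symm ((congrArg₂ (· + ·) (Finset.sum_eq_zero fun c _ => ?_)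
        (Finset.sum_eq_zero fun c _ => ?_)).trans (add_zero 0))
      · exact map_zero _
      · exact map_zero _
    all_goals
      refine Eq.symm ((congrArg₂ (· + ·) (Finset.sum_eq_zero fun c _ => ?_)
        (Finset.sum_eq_zero fun c _ => ?_)).trans (add_zero 0))
      · exact LinearMap.congr_fun (map_zero _) _
      · exact LinearMap.congr_fun (map_zero _) _

variable (k J K) in
/-- The inclusion of the path algebra of the second quiver as an algebra homomorphism. -/
def extBHom : PathAlgebra k VB →ₙₐ[k] PathAlgebra k (GluedQuiver J K) where
  toFun := extB J K
  map_smul' c x := by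
    ext1 v w
    rcases v with a | b <;> rcases w with a' | b'
    · exact (smul_zero c).symm
    · exact (smul_zero c).symm
    · exact (smul_zero c).symm
    · exact Finsupp.mapDomain_smul c (x b b')
  map_zero' := by
    ext1 v w
    rcases v with a | b <;> rcases w with a' | b'
    · rfl
    · rfl
    · rfl
    · exact Finsupp.mapDomain_zero
  map_add' x y := by
    ext1 v w
    rcases v with a | b <;> rcases w with a' | b'
    · exact (add_zero 0).symm
    · exact (add_zero 0).symm
    · exact (add_zero 0).symm
    · exact Finsupp.mapDomain_add
  map_mul' x y := by
    ext1 v w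
    rw [mul_apply, sum_eq]
    rcases v with a | b
    · refine Eq.symm ((congrArg₂ (· + ·) (Finset.sum_eq_zero fun c _ => ?_)
        (Finset.sum_eq_zero fun c _ => ?_)).trans (add_zero 0))
      · exact LinearMap.congr_fun (map_zero _) _
      · exact LinearMap.congr_fun (map_zero _) _
    · rcases w with a' | b'
      · refine Eq.symm ((congrArg₂ (· + ·) (Finset.sum_eq_zero fun c _ => ?_)
          (Finset.sum_eq_zero fun c _ => ?_)).trans (add_zero 0))
        · exact map_zero _
        · exact map_zero _
      · have h1 : ∀ a : VA, compₗ (k := k) (inr b : GluedQuiver J K) (inl a) (inr b')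
            (extB J K x (inr b) (inl a)) (extB J K y (inl a) (inr b')) = 0 := fun b => by
          rw [show extB J K x (inr _) (inl b) = 0 from rfl, map_zero, LinearMap.zero_apply]
        rw [Finset.sum_congr rfl fun b _ => h1 b, Finset.sum_const_zero, zero_add]
        exact (congrArg (Finsupp.mapDomain (inclB J K).mapPath) (mul_apply x y b b')).trans
          ((Finsupp.mapDomain_finsetSum).trans
            (Finset.sum_congr rfl fun _ _ => (compₗ_mapDomain (inclB J K) _ _).symm))

theorem inl_ne_inr (a : VA) (b : VB) : (inl a : GluedQuiver J K) ≠ inr b := Sum.inl_ne_inr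

theorem inr_ne_inl (b : VB) (a : VA) : (inr b : GluedQuiver J K) ≠ inl a := Sum.inr_ne_inl

theorem inl_ne_inl {a a' : VA} (h : a ≠ a') : (inl a : GluedQuiver J K) ≠ inl a' :=
  fun H => h (Sum.inl.inj H)

theorem inr_ne_inr {b b' : VB} (h : b ≠ b') : (inr b : GluedQuiver J K) ≠ inr b' :=
  fun H => h (Sum.inr.inj H)

theorem extAHom_ofPath {a a' : VA} (p : Path a a') :
    extAHom k J K (ofPath p) = ofPath ((inclA J K).mapPath p) := by
  ext1 v w
  rcases v with c | b
  · by_cases h : a = c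
    · subst h
      rcases w with c' | b'
      · by_cases h' : a' = c'
        · subst h'
          exact (congrArg (Finsupp.mapDomain (inclA J K).mapPath) (ofPath_apply_self p)).trans
            (Finsupp.mapDomain_single.trans (ofPath_apply_self ((inclA J K).mapPath p)).symm)
        · exact (congrArg (Finsupp.mapDomain (inclA J K).mapPath)
            (ofPath_apply_of_ne_right p a h')).trans (Finsupp.mapDomain_zero.trans
              (ofPath_apply_of_ne_right ((inclA J K).mapPath p) _ (inl_ne_inl h')).symm)
      · exact (ofPath_apply_of_ne_right _ _ (inl_ne_inr a' b')).symm
    · refine Eq.trans ?_ (ofPath_apply_of_ne_left ((inclA J K).mapPath p) (inl_ne_inl h) w).symm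
      rcases w with c' | b'
      · exact (congrArg (Finsupp.mapDomain (inclA J K).mapPath)
          (ofPath_apply_of_ne_left p h c')).trans Finsupp.mapDomain_zero
      · rfl
  · exact (ofPath_apply_of_ne_left _ (inl_ne_inr a b) w).symm

theorem extBHom_ofPath {b b' : VB} (p : Path b b') :
    extBHom k J K (ofPath p) = ofPath ((inclB J K).mapPath p) := by
  ext1 v w
  rcases v with a | c
  · exact (ofPath_apply_of_ne_left _ (inr_ne_inl b a) w).symm
  · by_cases h : b = c
    · subst h
      rcases w with a' | c'
      · exact (ofPath_apply_of_ne_right _ _ (inr_ne_inl b' a')).symm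
      · by_cases h' : b' = c'
        · subst h'
          exact (congrArg (Finsupp.mapDomain (inclB J K).mapPath) (ofPath_apply_self p)).trans
            (Finsupp.mapDomain_single.trans (ofPath_apply_self ((inclB J K).mapPath p)).symm)
        · exact (congrArg (Finsupp.mapDomain (inclB J K).mapPath)
            (ofPath_apply_of_ne_right p b h')).trans (Finsupp.mapDomain_zero.trans
              (ofPath_apply_of_ne_right ((inclB J K).mapPath p) _ (inr_ne_inr h')).symm)
    · refine Eq.trans ?_ (ofPath_apply_of_ne_left ((inclB J K).mapPath p) (inr_ne_inr h) w).symm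
      rcases w with a' | c'
      · rfl
      · exact (congrArg (Finsupp.mapDomain (inclB J K).mapPath)
          (ofPath_apply_of_ne_left p h c')).trans Finsupp.mapDomain_zero

theorem extAHom_mul_extBHom (x : PathAlgebra k VA) (y : PathAlgebra k VB) :
    extAHom k J K x * extBHom k J K y = 0 := by
  induction x using PathAlgebra.induction with
  | zero => rw [map_zero, zero_mul]
  | add x x' hx hx' => rw [map_add, add_mul, hx, hx', add_zero]
  | smul r x hx => rw [map_smul, smul_mul_assoc, hx, smul_zero]
  | path a a' p =>
    induction y using PathAlgebra.induction with
    | zero => rw [map_zero, mul_zero]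
    | add x x' hx hx' => rw [map_add, mul_add, hx, hx', add_zero]
    | smul r x hx => rw [map_smul, mul_smul_comm, hx, smul_zero]
    | path b b' q =>
      rw [extAHom_ofPath, extBHom_ofPath]
      exact ofPath_mul_ofPath_of_ne _ _ (inl_ne_inr a' b)

theorem extBHom_mul_extAHom (y : PathAlgebra k VB) (x : PathAlgebra k VA) :
    extBHom k J K y * extAHom k J K x = 0 := by
  induction x using PathAlgebra.induction with
  | zero => rw [map_zero, mul_zero]
  | add x x' hx hx' => rw [map_add, mul_add, hx, hx', add_zero]
  | smul r x hx => rw [map_smul, mul_smul_comm, hx, smul_zero]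
  | path a a' p =>
    induction y using PathAlgebra.induction with
    | zero => rw [map_zero, zero_mul]
    | add x x' hx hx' => rw [map_add, add_mul, hx, hx', add_zero]
    | smul r x hx => rw [map_smul, smul_mul_assoc, hx, smul_zero]
    | path b b' q =>
      rw [extAHom_ofPath, extBHom_ofPath]
      exact ofPath_mul_ofPath_of_ne _ _ (inr_ne_inl b' a)

theorem extAHom_vertex (a : VA) : extAHom k J K (vertex k a) = vertex k (inl a) :=
  extAHom_ofPath Path.nil

theorem extBHom_vertex (b : VB) : extBHom k J K (vertex k b) = vertex k (inr b) :=
  extBHom_ofPath Path.nil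

theorem extAHom_one_add_extBHom_one :
    extAHom k J K 1 + extBHom k J K 1 = (1 : PathAlgebra k (GluedQuiver J K)) := by
  rw [one_def, one_def, one_def, map_sum, map_sum, sum_eq]
  simp only [extAHom_vertex, extBHom_vertex]

theorem extAHom_one_mul {a : VA} {w : GluedQuiver J K} (p : Path (inl a : GluedQuiver J K) w) :
    extAHom k J K 1 * ofPath p = (ofPath p : PathAlgebra k (GluedQuiver J K)) := by
  rw [← vertex_mul_ofPath, ← mul_assoc, ← extAHom_vertex, ← map_mul, one_mul]

theorem mul_extAHom_one {a : VA} {v : GluedQuiver J K} (p : Path v (inl a : GluedQuiver J K)) :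
    ofPath p * extAHom k J K 1 = (ofPath p : PathAlgebra k (GluedQuiver J K)) := by
  rw [← ofPath_mul_vertex, mul_assoc, ← extAHom_vertex, ← map_mul, mul_one]

theorem extBHom_one_mul {b : VB} {w : GluedQuiver J K} (p : Path (inr b : GluedQuiver J K) w) :
    extBHom k J K 1 * ofPath p = (ofPath p : PathAlgebra k (GluedQuiver J K)) := by
  rw [← vertex_mul_ofPath, ← mul_assoc, ← extBHom_vertex, ← map_mul, one_mul]

theorem mul_extBHom_one {b : VB} {v : GluedQuiver J K} (p : Path v (inr b : GluedQuiver J K)) :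
    ofPath p * extBHom k J K 1 = (ofPath p : PathAlgebra k (GluedQuiver J K)) := by
  rw [← ofPath_mul_vertex, mul_assoc, ← extBHom_vertex, ← map_mul, mul_one]

theorem mk_arrow_mul_arrow_of_ne {IC : TwoSidedIdeal (PathAlgebra k (GluedQuiver J K))}
    {v v' w w' : GluedQuiver J K} (g : v ⟶ v') (g' : w ⟶ w') (h : v' ≠ w) :
    BoundQuiverAlgebra.mk IC (arrow k g) * BoundQuiverAlgebra.mk IC (arrow k g') = 0 := by
  rw [← map_mul, show arrow k g * arrow k g' = 0 from ofPath_mul_ofPath_of_ne _ _ h, map_zero]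

section Ideal

variable {IA : TwoSidedIdeal (PathAlgebra k VA)} {IB : TwoSidedIdeal (PathAlgebra k VB)}
  {IC : TwoSidedIdeal (PathAlgebra k (GluedQuiver J K))} (h : gluingIdeal J K IA IB ≤ IC)

include h

theorem arrow_mul_newJ {a a' : VA} {b : VB} (α : a ⟶ a') (x : J a' b) :
    BoundQuiverAlgebra.mk IC (arrow k ((inclA J K).map α)) *
      BoundQuiverAlgebra.mk IC (arrow k (newJ x)) = 0 := by
  rw [← map_mul]
  exact BoundQuiverAlgebra.mk_eq_zero (h (TwoSidedIdeal.subset_span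
    (Or.inl (Or.inl (Or.inl (Or.inr ⟨a, a', b, α, x, rfl⟩))))))

theorem arrow_mul_newK {b b' : VB} {a : VA} (β : b ⟶ b') (y : K b' a) :
    BoundQuiverAlgebra.mk IC (arrow k ((inclB J K).map β)) *
      BoundQuiverAlgebra.mk IC (arrow k (newK y)) = 0 := by
  rw [← map_mul]
  exact BoundQuiverAlgebra.mk_eq_zero (h (TwoSidedIdeal.subset_span
    (Or.inl (Or.inl (Or.inr ⟨b, b', a, β, y, rfl⟩)))))

theorem newJ_mul_newK {a a' : VA} {b : VB} (x : J a b) (y : K b a') :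
    BoundQuiverAlgebra.mk IC (arrow k (newJ (K := K) x)) *
      BoundQuiverAlgebra.mk IC (arrow k (newK y)) = 0 := by
  rw [← map_mul]
  exact BoundQuiverAlgebra.mk_eq_zero (h (TwoSidedIdeal.subset_span
    (Or.inl (Or.inr ⟨a, a', b, x, y, rfl⟩))))

theorem newK_mul_newJ {b b' : VB} {a : VA} (y : K b a) (x : J a b') :
    BoundQuiverAlgebra.mk IC (arrow k (newK (J := J) y)) *
      BoundQuiverAlgebra.mk IC (arrow k (newJ x)) = 0 := by
  rw [← map_mul]
  exact BoundQuiverAlgebra.mk_eq_zero (h (TwoSidedIdeal.subset_span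
    (Or.inr ⟨b, b', a, y, x, rfl⟩)))

/-- An arrow that ends where a new arrow starts is either old or a new one coming back, and both
products are gluing relations. So a new arrow can only be the first arrow of a nonzero path. -/
theorem rad_mul_newJ {j : BoundQuiverAlgebra IC} (hj : j ∈ BoundQuiverAlgebra.pathPow IC 1)
    {a : VA} {b : VB} (x : J a b) : j * BoundQuiverAlgebra.mk IC (arrow k (newJ x)) = 0 := by
  refine BoundQuiverAlgebra.mul_eq_zero_of_mem_pathPow (fun v w g => ?_) hj
  rcases w with a' | b'
  · by_cases ha : a' = a
    · subst ha
      rcases v with a'' | b''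
      · exact arrow_mul_newJ h (show a'' ⟶ a' from g) x
      · exact newK_mul_newJ h (show K b'' a' from g) x
    · exact mk_arrow_mul_arrow_of_ne _ _ (inl_ne_inl ha)
  · exact mk_arrow_mul_arrow_of_ne _ _ (inr_ne_inl b' a)

theorem rad_mul_newK {j : BoundQuiverAlgebra IC} (hj : j ∈ BoundQuiverAlgebra.pathPow IC 1)
    {b : VB} {a : VA} (y : K b a) : j * BoundQuiverAlgebra.mk IC (arrow k (newK y)) = 0 := by
  refine BoundQuiverAlgebra.mul_eq_zero_of_mem_pathPow (fun v w g => ?_) hj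
  rcases w with a' | b'
  · exact mk_arrow_mul_arrow_of_ne _ _ (inl_ne_inr a' b)
  · by_cases hb : b' = b
    · subst hb
      rcases v with a'' | b''
      · exact newJ_mul_newK h (show J a'' b' from g) y
      · exact arrow_mul_newK h (show b'' ⟶ b' from g) y
    · exact mk_arrow_mul_arrow_of_ne _ _ (inr_ne_inr hb)

theorem mk_path_mul_newJ {v : GluedQuiver J K} {a : VA} {b : VB}
    (p : Path v (inl a : GluedQuiver J K)) (hp : 1 ≤ p.length) (x : J a b) :
    BoundQuiverAlgebra.mk IC (ofPath p * arrow k (newJ x)) = 0 := by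
  rw [map_mul]
  exact rad_mul_newJ h (BoundQuiverAlgebra.mk_ofPath_mem_pathPow p hp) x

theorem mk_path_mul_newK {v : GluedQuiver J K} {a : VA} {b : VB}
    (p : Path v (inr b : GluedQuiver J K)) (hp : 1 ≤ p.length) (y : K b a) :
    BoundQuiverAlgebra.mk IC (ofPath p * arrow k (newK y)) = 0 := by
  rw [map_mul]
  exact rad_mul_newK h (BoundQuiverAlgebra.mk_ofPath_mem_pathPow p hp) y

/-- Appending an arrow either fails to compose, or stays in the first quiver, or leaves it by a new
arrow. In the last case only a trivial path can precede. -/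
theorem extA_mul_arrow {a a' : VA} (p : Path a a') {v w : GluedQuiver J K} (g : v ⟶ w) :
    BoundQuiverAlgebra.mk IC (extAHom k J K (ofPath p)) * BoundQuiverAlgebra.mk IC (arrow k g) = 0 ∨
    (∃ (a'' : VA) (p' : Path a a''),
      BoundQuiverAlgebra.mk IC (extAHom k J K (ofPath p)) * BoundQuiverAlgebra.mk IC (arrow k g) =
        BoundQuiverAlgebra.mk IC (extAHom k J K (ofPath p'))) ∨
    ∃ (b : VB) (x : J a b),
      BoundQuiverAlgebra.mk IC (extAHom k J K (ofPath p)) * BoundQuiverAlgebra.mk IC (arrow k g) =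
        BoundQuiverAlgebra.mk IC (arrow k (newJ x)) := by
  simp only [← map_mul]
  have hne : v ≠ inl a' → BoundQuiverAlgebra.mk IC (extAHom k J K (ofPath p) * arrow k g) = 0 := by
    intro hv
    rw [extAHom_ofPath, show ofPath ((inclA J K).mapPath p) * arrow k g = 0 from
      ofPath_mul_ofPath_of_ne _ _ hv.symm, map_zero]
  by_cases hv : v = inl a'
  · subst hv
    by_cases hw : ∃ a'', w = inl a''
    · obtain ⟨a'', rfl⟩ := hw
      refine Or.inr (Or.inl ⟨a'', p.cons (show a' ⟶ a'' from g), ?_⟩)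
      rw [extAHom_ofPath, extAHom_ofPath, Prefunctor.mapPath_cons]
      exact congrArg _ (ofPath_cons ((inclA J K).mapPath p) g).symm
    · obtain ⟨b, rfl⟩ : ∃ b, w = inr b := by
        rcases w with c | c
        · exact absurd ⟨c, rfl⟩ hw
        · exact ⟨c, rfl⟩
      rw [extAHom_ofPath]
      cases p with
      | nil =>
        refine Or.inr (Or.inr ⟨b, g, ?_⟩)
        exact congrArg _ (vertex_mul_ofPath (Quiver.Hom.toPath g))
      | cons p α =>
        refine Or.inl (mk_path_mul_newJ h ((inclA J K).mapPath (p.cons α)) ?_ g)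
        exact Nat.le_add_left 1 _
  · exact Or.inl (hne hv)

theorem extB_mul_arrow {b b' : VB} (p : Path b b') {v w : GluedQuiver J K} (g : v ⟶ w) :
    BoundQuiverAlgebra.mk IC (extBHom k J K (ofPath p)) * BoundQuiverAlgebra.mk IC (arrow k g) = 0 ∨
    (∃ (b'' : VB) (p' : Path b b''),
      BoundQuiverAlgebra.mk IC (extBHom k J K (ofPath p)) * BoundQuiverAlgebra.mk IC (arrow k g) =
        BoundQuiverAlgebra.mk IC (extBHom k J K (ofPath p'))) ∨
    ∃ (a : VA) (x : K b a),
      BoundQuiverAlgebra.mk IC (extBHom k J K (ofPath p)) * BoundQuiverAlgebra.mk IC (arrow k g) =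
        BoundQuiverAlgebra.mk IC (arrow k (newK x)) := by
  simp only [← map_mul]
  have hne : v ≠ inr b' → BoundQuiverAlgebra.mk IC (extBHom k J K (ofPath p) * arrow k g) = 0 := by
    intro hv
    rw [extBHom_ofPath, show ofPath ((inclB J K).mapPath p) * arrow k g = 0 from
      ofPath_mul_ofPath_of_ne _ _ hv.symm, map_zero]
  by_cases hv : v = inr b'
  · subst hv
    by_cases hw : ∃ b'', w = inr b''
    · obtain ⟨b'', rfl⟩ := hw
      refine Or.inr (Or.inl ⟨b'', p.cons (show b' ⟶ b'' from g), ?_⟩)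
      rw [extBHom_ofPath, extBHom_ofPath, Prefunctor.mapPath_cons]
      exact congrArg _ (ofPath_cons ((inclB J K).mapPath p) g).symm
    · obtain ⟨a, rfl⟩ : ∃ a, w = inl a := by
        rcases w with c | c
        · exact ⟨c, rfl⟩
        · exact absurd ⟨c, rfl⟩ hw
      rw [extBHom_ofPath]
      cases p with
      | nil =>
        refine Or.inr (Or.inr ⟨a, g, ?_⟩)
        exact congrArg _ (vertex_mul_ofPath (Quiver.Hom.toPath g))
      | cons p α =>
        refine Or.inl (mk_path_mul_newK h ((inclB J K).mapPath (p.cons α)) ?_ g)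
        exact Nat.le_add_left 1 _
  · exact Or.inl (hne hv)

/-- Modulo the gluing relations, the glued algebra is spanned by the paths in one of the two
quivers and the paths consisting of a new arrow and a path in one of the two quivers. -/
theorem mk_ofPath_cases {v w : GluedQuiver J K} (p : Path v w) :
    BoundQuiverAlgebra.mk IC (ofPath p) = 0 ∨
    (∃ (a a' : VA) (p' : Path a a'), BoundQuiverAlgebra.mk IC (ofPath p) =
      BoundQuiverAlgebra.mk IC (extAHom k J K (ofPath p'))) ∨
    (∃ (b b' : VB) (q' : Path b b'), BoundQuiverAlgebra.mk IC (ofPath p) =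
      BoundQuiverAlgebra.mk IC (extBHom k J K (ofPath q'))) ∨
    (∃ (a : VA) (b b' : VB) (x : J a b) (q' : Path b b'), BoundQuiverAlgebra.mk IC (ofPath p) =
      BoundQuiverAlgebra.mk IC (arrow k (newJ x)) *
        BoundQuiverAlgebra.mk IC (extBHom k J K (ofPath q'))) ∨
    (∃ (b : VB) (a a' : VA) (y : K b a) (p' : Path a a'), BoundQuiverAlgebra.mk IC (ofPath p) =
      BoundQuiverAlgebra.mk IC (arrow k (newK y)) *
        BoundQuiverAlgebra.mk IC (extAHom k J K (ofPath p'))) := by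
  induction p with
  | nil =>
    rcases v with a | b
    · exact Or.inr (Or.inl ⟨a, a, Path.nil, congrArg _ (extAHom_vertex a).symm⟩)
    · exact Or.inr (Or.inr (Or.inl ⟨b, b, Path.nil, congrArg _ (extBHom_vertex b).symm⟩))
  | cons p g ih =>
    rw [ofPath_cons, map_mul]
    rcases ih with ih | ⟨a, a', p', ih⟩ | ⟨b, b', q', ih⟩ | ⟨a, b, b', x, q', ih⟩ |
      ⟨b, a, a', y, p', ih⟩
    · exact Or.inl (by rw [ih, zero_mul])
    · rw [ih]
      rcases extA_mul_arrow h p' g with h0 | ⟨a'', p'', h0⟩ | ⟨b, x, h0⟩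
      · exact Or.inl h0
      · exact Or.inr (Or.inl ⟨a, a'', p'', h0⟩)
      · refine Or.inr (Or.inr (Or.inr (Or.inl ⟨a, b, b, x, Path.nil, ?_⟩)))
        rw [h0, ← map_mul]
        exact congrArg _ ((congrArg _ (extBHom_vertex b)).trans (ofPath_mul_vertex _)).symm
    · rw [ih]
      rcases extB_mul_arrow h q' g with h0 | ⟨b'', q'', h0⟩ | ⟨a, y, h0⟩
      · exact Or.inl h0
      · exact Or.inr (Or.inr (Or.inl ⟨b, b'', q'', h0⟩))
      · refine Or.inr (Or.inr (Or.inr (Or.inr ⟨b, a, a, y, Path.nil, ?_⟩)))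
        rw [h0, ← map_mul]
        exact congrArg _ ((congrArg _ (extAHom_vertex a)).trans (ofPath_mul_vertex _)).symm
    · rw [ih, mul_assoc]
      rcases extB_mul_arrow h q' g with h0 | ⟨b'', q'', h0⟩ | ⟨a', y, h0⟩
      · exact Or.inl (by rw [h0, mul_zero])
      · exact Or.inr (Or.inr (Or.inr (Or.inl ⟨a, b, b'', x, q'', by rw [h0]⟩)))
      · exact Or.inl (by rw [h0, newJ_mul_newK h])
    · rw [ih, mul_assoc]
      rcases extA_mul_arrow h p' g with h0 | ⟨a'', p'', h0⟩ | ⟨b', x, h0⟩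
      · exact Or.inl (by rw [h0, mul_zero])
      · exact Or.inr (Or.inr (Or.inr (Or.inr ⟨b, a, a'', y, p'', by rw [h0]⟩)))
      · exact Or.inl (by rw [h0, newK_mul_newJ h])

end Ideal

end GluedQuiver

end IgusaTodorov

/-! ### The bound quiver algebra as a glued algebra. -/

namespace IgusaTodorov

namespace GluedQuiver

open PathAlgebra

variable {k VA VB : Type u} [Field k] [Quiver.{u} VA] [Quiver.{u} VB]
  {J : VA → VB → Type u} {K : VB → VA → Type u}
  [Fintype VA] [Fintype VB] [DecidableEq VA] [DecidableEq VB]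
  {IA : TwoSidedIdeal (PathAlgebra k VA)} {IB : TwoSidedIdeal (PathAlgebra k VB)}
  {IC : TwoSidedIdeal (PathAlgebra k (GluedQuiver J K))} [IsAdmissible IC]

/-- The bound quiver algebra of a glued quiver is a glued algebra. -/
def gluedAlgebra (h : gluingIdeal J K IA IB ≤ IC) :
    GluedAlgebra (k := k) J K (BoundQuiverAlgebra IC) where
  toA := (BoundQuiverAlgebra.mk IC : _ →ₙₐ[k] _).comp (extAHom k J K)
  toB := (BoundQuiverAlgebra.mk IC : _ →ₙₐ[k] _).comp (extBHom k J K)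
  toJ x := BoundQuiverAlgebra.mk IC (arrow k (newJ x))
  toK y := BoundQuiverAlgebra.mk IC (arrow k (newK y))
  rad := BoundQuiverAlgebra.pathPow IC 1
  toA_mul_toB x y := by
    change BoundQuiverAlgebra.mk IC _ * BoundQuiverAlgebra.mk IC _ = 0
    rw [← map_mul]
    exact (congrArg _ (extAHom_mul_extBHom x y)).trans (map_zero _)
  toB_mul_toA y x := by
    change BoundQuiverAlgebra.mk IC _ * BoundQuiverAlgebra.mk IC _ = 0
    rw [← map_mul]
    exact (congrArg _ (extBHom_mul_extAHom y x)).trans (map_zero _)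
  add_one := by
    change BoundQuiverAlgebra.mk IC _ + BoundQuiverAlgebra.mk IC _ = 1
    rw [← map_add]
    exact (congrArg _ extAHom_one_add_extBHom_one).trans (map_one _)
  one_mul_toJ x := by
    change BoundQuiverAlgebra.mk IC _ * _ = _
    rw [← map_mul]
    exact congrArg _ (extAHom_one_mul _)
  toJ_mul_one x := by
    change _ * BoundQuiverAlgebra.mk IC _ = _
    rw [← map_mul]
    exact congrArg _ (mul_extBHom_one _)
  one_mul_toK x := by
    change BoundQuiverAlgebra.mk IC _ * _ = _
    rw [← map_mul]
    exact congrArg _ (extBHom_one_mul _)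
  toK_mul_one x := by
    change _ * BoundQuiverAlgebra.mk IC _ = _
    rw [← map_mul]
    exact congrArg _ (mul_extAHom_one _)
  mul_mem_rad_left c _ hj := BoundQuiverAlgebra.mul_mem_pathPow_left c hj
  mul_mem_rad_right c _ hj := BoundQuiverAlgebra.mul_mem_pathPow_right c hj
  isNilpotent_of_mem_rad _ hj := BoundQuiverAlgebra.isNilpotent_of_mem_pathPow hj
  toJ_mem_rad x := BoundQuiverAlgebra.mk_arrow_mem_pathPow _
  toK_mem_rad x := BoundQuiverAlgebra.mk_arrow_mem_pathPow _
  rad_mul_toJ _ hj _ _ x := rad_mul_newJ h hj x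
  rad_mul_toK _ hj _ _ y := rad_mul_newK h hj y
  eq_top W hA hB hJ hK c := by
    obtain ⟨c, rfl⟩ := BoundQuiverAlgebra.mk_surjective IC c
    induction c using PathAlgebra.induction with
    | zero => rw [map_zero]; exact zero_mem _
    | add x y hx hy => rw [map_add]; exact add_mem hx hy
    | smul r x hx => rw [map_smul]; exact Submodule.smul_mem _ r hx
    | path v w p =>
      rcases mk_ofPath_cases h p with h0 | ⟨_, _, p', h0⟩ | ⟨_, _, q', h0⟩ |
        ⟨_, _, _, x, q', h0⟩ | ⟨_, _, _, y, p', h0⟩ <;> rw [h0]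
      · exact zero_mem _
      · exact hA _
      · exact hB _
      · exact hJ x _
      · exact hK y _
  local_toA v c := by
    change BoundQuiverAlgebra.mk IC (extAHom k J K (vertex k v)) * c ∈ _ ∨
      ∃ y, BoundQuiverAlgebra.mk IC (extAHom k J K (vertex k v)) * c * y =
        BoundQuiverAlgebra.mk IC (extAHom k J K (vertex k v))
    rw [extAHom_vertex]
    exact BoundQuiverAlgebra.vertex_local _ c
  local_toB v c := by
    change BoundQuiverAlgebra.mk IC (extBHom k J K (vertex k v)) * c ∈ _ ∨
      ∃ y, BoundQuiverAlgebra.mk IC (extBHom k J K (vertex k v)) * c * y =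
        BoundQuiverAlgebra.mk IC (extBHom k J K (vertex k v))
    rw [extBHom_vertex]
    exact BoundQuiverAlgebra.vertex_local _ c

end GluedQuiver

/-! ### Minimal presentations of the vertex simples. -/

section VertexSimple

open MulOpposite PathAlgebra BoundQuiverAlgebra

variable {k V : Type u} [Field k] [Quiver.{u} V] [Fintype V] [DecidableEq V]
  [∀ a b : V, Finite (a ⟶ b)] (I : TwoSidedIdeal (PathAlgebra k V)) [IsAdmissible I]

/-- The generator of the simple module at a vertex. -/
def vertexSimpleGen (v : V) : vertexSimple I v := Submodule.Quotient.mk (mk I (vertex k v))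

theorem smul_vertexSimpleGen (v : V) (c : (BoundQuiverAlgebra I)ᵐᵒᵖ) :
    c • vertexSimpleGen I v = Submodule.Quotient.mk (mk I (vertex k v) * c.unop) := rfl

theorem mk_vertex_mul_mk_vertex_of_ne {v w : V} (h : w ≠ v) :
    mk I (vertex k w) * mk I (vertex k v) = 0 := by
  rw [← map_mul, show vertex k w * vertex k v = 0 from ofPath_mul_ofPath_of_ne _ _ h, map_zero]

theorem exists_smul_vertexSimpleGen (v : V) (m : vertexSimple I v) :
    ∃ c : (BoundQuiverAlgebra I)ᵐᵒᵖ, m = c • vertexSimpleGen I v := by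
  obtain ⟨c, rfl⟩ := Submodule.Quotient.mk_surjective _ m
  refine ⟨op c, ?_⟩
  refine (Submodule.Quotient.eq _).2 ?_
  have h1 : (1 : BoundQuiverAlgebra I) = ∑ w, mk I (vertex k w) := by
    rw [← map_sum, ← one_def, map_one]
  have h2 : c - mk I (vertex k v) * c = ∑ w ∈ Finset.univ.erase v, mk I (vertex k w) * c := by
    rw [← Finset.sum_mul, sub_eq_iff_eq_add, ← add_mul,
      Finset.sum_erase_add _ _ (Finset.mem_univ v), ← h1, one_mul]
  change c - mk I (vertex k v) * c ∈ _
  rw [h2]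
  refine Submodule.sum_mem _ fun w hw => ?_
  exact Submodule.smul_mem _ (op c) (Submodule.subset_span
    (Or.inr ⟨w, (Finset.mem_erase.1 hw).1, rfl⟩))

theorem smul_vertexSimpleGen_eq_zero {v : V} {c : (BoundQuiverAlgebra I)ᵐᵒᵖ}
    (hc : c • vertexSimpleGen I v = 0) : mk I (vertex k v) * c.unop ∈ pathPow I 1 := by
  replace hc := (Submodule.Quotient.mk_eq_zero _).1 hc
  have key : ∀ x ∈ Submodule.span (BoundQuiverAlgebra I)ᵐᵒᵖ
    ({x | ∃ (a b : V) (e : a ⟶ b), x = BoundQuiverAlgebra.mk I (PathAlgebra.arrow k e)} ∪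
      {x | ∃ w, w ≠ v ∧ x = BoundQuiverAlgebra.mk I (PathAlgebra.vertex k w)}),
      mk I (vertex k v) * x ∈ pathPow I 1 := by
    intro x hx
    induction hx using Submodule.span_induction with
    | mem x hx =>
      rcases hx with ⟨a, b, e, rfl⟩ | ⟨w, hw, rfl⟩
      · exact mul_mem_pathPow_left _ (mk_arrow_mem_pathPow e)
      · rw [mk_vertex_mul_mk_vertex_of_ne I hw.symm]
        exact zero_mem _
    | zero => rw [mul_zero]; exact zero_mem _
    | add x y _ _ hx hy => rw [mul_add]; exact add_mem hx hy
    | smul r x _ hx =>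
      change _ * (x * r.unop) ∈ _
      rw [← mul_assoc]
      exact mul_mem_pathPow_right _ hx
  have : _ * (_ * c.unop) ∈ _ := key _ hc
  rwa [← mul_assoc, vertex_mul_vertex] at this

/-- The simple is cyclic on the class of `e_v`, and the right ideal defining it meets `e_v C` inside
the arrow ideal. With one generator at `v`, its syzygy contains the side module N_v exactly once. -/
theorem vertexSimple_isMinimalPresentation (J : Ideal (BoundQuiverAlgebra I)ᵐᵒᵖ)
    (hJ : ∀ c, c.unop ∈ pathPow I 1 → c ∈ J) (v : V) :
    IsMinimalPresentation J (fun _ : Fin 1 => op (mk I (vertex k v)))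
      (fun _ : Fin 1 => vertexSimpleGen I v) where
  fixed _ := by
    rw [smul_vertexSimpleGen, unop_op, vertex_mul_vertex]
    rfl
  generates m := by
    obtain ⟨c, rfl⟩ := exists_smul_vertexSimpleGen I v m
    exact ⟨fun _ => c, by simp⟩
  minimal a ha i := by
    rw [Finset.univ_unique, Finset.sum_singleton] at ha
    refine hJ _ ?_
    rw [Subsingleton.elim i default]
    exact smul_vertexSimpleGen_eq_zero I ha

theorem pathPow_one_smul_vertexSimpleGen (v : V) {j : BoundQuiverAlgebra I}
    (hj : j ∈ pathPow I 1) : op j • vertexSimpleGen I v = 0 := by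
  refine (Submodule.Quotient.mk_eq_zero _).2 ?_
  change mk I (vertex k v) * j ∈ _
  replace hj := mul_mem_pathPow_left (mk I (vertex k v)) hj
  generalize mk I (vertex k v) * j = j at hj
  induction hj using Submodule.span_induction with
  | mem x hx =>
    obtain ⟨a, b, p, hp, rfl⟩ := hx
    induction p with
    | nil => simp at hp
    | cons p g ih =>
      cases p with
      | nil => exact Submodule.subset_span (Or.inl ⟨_, _, g, rfl⟩)
      -- The last arrow is peeled off until only the first one is left, because the span is a right
      -- ideal.
      | cons p g' =>
        rw [ofPath_cons, map_mul]
        exact Submodule.smul_mem _ (op (mk I (arrow k g))) (ih (Nat.le_add_left 1 _))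
  | zero => exact zero_mem _
  | add x y _ _ hx hy => exact add_mem hx hy
  | smul r x _ hx =>
    rw [Algebra.smul_def, Algebra.commutes]
    exact Submodule.smul_mem _ (op (algebraMap k _ r)) hx

end VertexSimple

/-! ### The side modules and the syzygies of the vertex simples. -/

namespace IsGluing

variable {R S T : Type u} [Ring R] [Ring S] [Ring T] {p : R →+* S} {q : R →+* T}
  {J : Ideal R} {e f : R} {VA VB : Type u} [Fintype VA] [Fintype VB] {ε : VA → R} {δ : VB → R}
  [IsNoetherianRing R] [RingHomSurjective p] [RingHomSurjective q]

/-- The class of `f R ε_v` can be computed from the syzygy of the simple module at `v`. -/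
theorem defl_omegaBar_eq_defl_sideClass (h : IsGluing p q J e f ε δ) {v : VA}
    {M : FGModuleCat.{u} R} {x : Fin 1 → M}
    (hx : IsMinimalPresentation J (fun _ => ε v) x) (hM : ∀ m : M, f • m = 0) :
    K0.defl q (omegaBar R (K0.mk M)) = K0.defl q (h.sideClass v) := by
  rw [h.omegaBar_mk_left (v := fun _ => v) hx hM, map_add, h.defl_eq_zero (h.smul_kerLeft hx),
    zero_add, Finset.univ_unique, Finset.sum_singleton]
  rfl

end IsGluing

namespace GluedAlgebra

open MulOpposite

variable {k VA VB : Type u} [Field k] [Fintype VA] [DecidableEq VA] [Fintype VB]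
    [DecidableEq VB] [Quiver.{u} VA] [Quiver.{u} VB] {J : VA → VB → Type u} {K : VB → VA → Type u}
    {C : Type u} [Ring C] [Algebra k C] [IsNoetherianRing Cᵐᵒᵖ] (G : GluedAlgebra (k := k) J K C)

/-- Both the given decomposition of the syzygy of the simple and the decomposition from its minimal
presentation are deflated to the second side. The first summands vanish there, so the classes of N_v
and of `N` agree. Comparing classes only after deflation avoids uniqueness of decompositions. -/
theorem exists_iterate_sideClass_eq_zero {IA : TwoSidedIdeal (PathAlgebra k VA)}
    (hA : ∀ x, G.toA x = 0 ↔ x ∈ IA) {IB : TwoSidedIdeal (PathAlgebra k VB)}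
    (hB : ∀ x, G.toB x = 0 ↔ x ∈ IB) [IsNoetherianRing (BoundQuiverAlgebra IB)ᵐᵒᵖ] {v : VA}
    {X : FGModuleCat.{u} Cᵐᵒᵖ} {s : X}
    (hs : IsMinimalPresentation G.radOp (fun _ : Fin 1 => op (G.toA (PathAlgebra.vertex k v)))
      (fun _ => s)) (hrad : ∀ j ∈ G.rad, op j • s = 0)
    {M : FGModuleCat.{u} (BoundQuiverAlgebra IA)ᵐᵒᵖ}
    {N : FGModuleCat.{u} (BoundQuiverAlgebra IB)ᵐᵒᵖ} {M' N' : FGModuleCat.{u} Cᵐᵒᵖ}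
    (eM : M' ≃ₗ[Cᵐᵒᵖ] Infl (G.projOpA hA) M) (eN : N' ≃ₗ[Cᵐᵒᵖ] Infl (G.symm.projOpA hB) N)
    (eX : syzygy X ≃ₗ[Cᵐᵒᵖ] M' × N') (hN : projectiveDimension N.obj < ⊤) :
    ∃ d, (omegaBar (BoundQuiverAlgebra IB)ᵐᵒᵖ)^[d]
      (K0.defl (G.symm.projOpA hB) ((G.isGluing hA hB).sideClass v)) = 0 := by
  have h := G.isGluing hA hB
  have hX : ∀ m : X, op G.idemB • m = 0 := by
    intro m
    obtain ⟨c, rfl⟩ := hs.generates m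
    rw [Finset.univ_unique, Finset.sum_singleton, ← hs.fixed default, ← mul_smul, ← mul_smul]
    refine hrad (G.toA (PathAlgebra.vertex k v) * ((c default).unop * G.idemB)) ?_
    rw [← mul_assoc, ← G.idemA_mul_toA, mul_assoc G.idemA]
    exact G.idemA_mul_idemB_mem _
  have hM' : ∀ m : M', op G.idemB • m = 0 := fun m => eM.injective (by
    rw [map_smul, map_zero]
    exact h.smul_infl M _)
  obtain ⟨d, hd⟩ := exists_omegaBar_iterate_eq_zero N hN
  refine ⟨d, ?_⟩
  rw [← h.defl_omegaBar_eq_defl_sideClass hs hX, omegaBar_mk, K0.mk_eq_add eX, map_add,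
    h.defl_eq_zero hM', zero_add, K0.defl_mk_of_equiv _ eN, hd]

end GluedAlgebra

end IgusaTodorov

end

/-! ### The main theorem. -/

open IgusaTodorov GluedQuiver in
theorem corollary3p4 {k : Type u} [Field k]
    {VA VB : Type u} [Fintype VA] [DecidableEq VA] [Fintype VB] [DecidableEq VB]
    [Quiver.{u} VA] [∀ a a' : VA, Finite (a ⟶ a')]
    [Quiver.{u} VB] [∀ b b' : VB, Finite (b ⟶ b')]
    (J : VA → VB → Type u) [∀ a b, Finite (J a b)]
    (K : VB → VA → Type u) [∀ b a, Finite (K b a)]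
    (IA : TwoSidedIdeal (PathAlgebra k VA)) [IsAdmissible IA]
    (IB : TwoSidedIdeal (PathAlgebra k VB)) [IsAdmissible IB]
    (IC : TwoSidedIdeal (PathAlgebra k (GluedQuiver J K))) [IsAdmissible IC]
    (hA : ∀ x : PathAlgebra k VA, extA J K x ∈ IC ↔ x ∈ IA)
    (hB : ∀ x : PathAlgebra k VB, extB J K x ∈ IC ↔ x ∈ IB)
    (h3 : gluingIdeal J K IA IB ≤ IC)
    (hSA : ∀ v : VA, ∃ (M : FGModuleCat.{u} (BoundQuiverAlgebra IA)ᵐᵒᵖ)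
      (N : FGModuleCat.{u} (BoundQuiverAlgebra IB)ᵐᵒᵖ)
      (M' N' : FGModuleCat.{u} (BoundQuiverAlgebra IC)ᵐᵒᵖ),
      IsInflationA IA IC M M' ∧ IsInflationB IB IC N N' ∧
      Nonempty (syzygy (vertexSimple IC (inl v)) ≃ₗ[(BoundQuiverAlgebra IC)ᵐᵒᵖ] M' × N') ∧
      projectiveDimension N.obj < ⊤)
    (hSB : ∀ v : VB, ∃ (M : FGModuleCat.{u} (BoundQuiverAlgebra IA)ᵐᵒᵖ)
      (N : FGModuleCat.{u} (BoundQuiverAlgebra IB)ᵐᵒᵖ)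
      (M' N' : FGModuleCat.{u} (BoundQuiverAlgebra IC)ᵐᵒᵖ),
      IsInflationA IA IC M M' ∧ IsInflationB IB IC N N' ∧
      Nonempty (syzygy (vertexSimple IC (inr v)) ≃ₗ[(BoundQuiverAlgebra IC)ᵐᵒᵖ] M' × N') ∧
      projectiveDimension M.obj < ⊤)
    (hφA : phiDim (BoundQuiverAlgebra IA)ᵐᵒᵖ < ⊤)
    (hφB : phiDim (BoundQuiverAlgebra IB)ᵐᵒᵖ < ⊤) :
    phiDim (BoundQuiverAlgebra IC)ᵐᵒᵖ < ⊤ := by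
  let G := gluedAlgebra h3
  -- The condition I_C ∩ kQ_A = I_A makes A a subring of C, up to the identity element; likewise for
  -- B.
  have hA' : ∀ x, G.toA x = 0 ↔ x ∈ IA := fun x =>
    BoundQuiverAlgebra.mk_eq_zero_iff.trans (hA x)
  have hB' : ∀ x, G.toB x = 0 ↔ x ∈ IB := fun x =>
    BoundQuiverAlgebra.mk_eq_zero_iff.trans (hB x)
  have : IsArtinianRing (BoundQuiverAlgebra IA)ᵐᵒᵖ := IsArtinianRing.of_finite k _
  have : IsArtinianRing (BoundQuiverAlgebra IB)ᵐᵒᵖ := IsArtinianRing.of_finite k _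
  refine (G.isGluing hA' hB').phiDim_lt_top hφA hφB (fun v => ?_) (fun v => ?_)
  · obtain ⟨M, N, M', N', ⟨eM, hM⟩, ⟨eN, hN⟩, ⟨e⟩, hd⟩ := hSA v
    have hs : IsMinimalPresentation G.radOp
        (fun _ : Fin 1 => MulOpposite.op (G.toA (PathAlgebra.vertex k v)))
        (fun _ => vertexSimpleGen IC (inl v)) := by
      rw [show G.toA (PathAlgebra.vertex k v) = BoundQuiverAlgebra.mk IC
        (PathAlgebra.vertex k (inl v)) from congrArg _ (extAHom_vertex v)]
      exact vertexSimple_isMinimalPresentation IC _ (fun _ hc => hc) _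
    exact G.exists_iterate_sideClass_eq_zero hA' hB' hs
      (fun j hj => pathPow_one_smul_vertexSimpleGen IC _ hj)
      (G.inflEquiv hA' eM hM) (G.symm.inflEquiv hB' eN hN) e hd
  · obtain ⟨M, N, M', N', ⟨eM, hM⟩, ⟨eN, hN⟩, ⟨e⟩, hd⟩ := hSB v
    have hs : IsMinimalPresentation G.radOp
        (fun _ : Fin 1 => MulOpposite.op (G.toB (PathAlgebra.vertex k v)))
        (fun _ => vertexSimpleGen IC (inr v)) := by
      rw [show G.toB (PathAlgebra.vertex k v) = BoundQuiverAlgebra.mk IC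
        (PathAlgebra.vertex k (inr v)) from congrArg _ (extBHom_vertex v)]
      exact vertexSimple_isMinimalPresentation IC _ (fun _ hc => hc) _
    -- At a vertex of the second quiver the roles of A and B are exchanged, so the summands of the
    -- syzygy are swapped.
    exact G.symm.exists_iterate_sideClass_eq_zero hB' hA' hs
      (fun j hj => pathPow_one_smul_vertexSimpleGen IC _ hj)
      (G.symm.inflEquiv hB' eN hN) (G.inflEquiv hA' eM hM)
      (e.trans (LinearEquiv.prodComm _ _ _)) hd
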